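/- For positive integers $d,n$ and $r>0$, let $G_d(n,r)$ be the random geometric graph on the vertex set $\{1,\dots,n\}$ in which, for independent uniform random points $X_1,\dots,X_n$ of $[0,1]^d$, two distinct vertices $i,j$ are adjacent if and only if $\lVert X_i-X_j\rVert\le r$ (Euclidean norm). For $\alpha\in[0,1]$, an $\alpha$-subgraph of a graph $G$ is a spanning subgraph $H\subseteq G$ such that $d_H(v)\ge\alpha\, d_G(v)$ for every vertex $v$ of $G$. Theorem. For every integer $d\ge 1$ and every real $\epsilon>0$ there are constants $c_3=c_3(d,\epsilon)>0$ and $C_3=C_3(d,\epsilon)>0$ such that the following holds for every $\eta\in[1/2,1)$ with $\epsilon\le 1-\eta$. Let $r=r(n)$ be any sequence with $C_3(\log n/n)^{1/d}\le r(n)\le c_3$ for all sufficiently large $n$. Then, with probability tending to $1$ as $n\to\infty$, the graph $G_d(n,r(n))$ has the following property: for every integer $L$ with $1/c_3\le L\le 2\eta n/(1+\eta)$, every vertex $v$ and every $(\eta+\epsilon)$-subgraph $H$ of $G_d(n,r(n))$, the graph $H$ contains a cycle of length $L$ through $v$. -/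

import Mathlib

open MeasureTheory

/-- The unit cube `[0,1]^d` in Euclidean space. -/
def unitCube (d : ℕ) : Set (EuclideanSpace ℝ (Fin d)) :=
  {x | ∀ i, x i ∈ Set.Icc (0 : ℝ) 1}

/-- The uniform distribution on `[0,1]^d`: Lebesgue measure restricted to the cube
(a probability measure, see `volume_unitCube`). -/
noncomputable def uniformCube (d : ℕ) : Measure (EuclideanSpace ℝ (Fin d)) :=
  volume.restrict (unitCube d)

/-- The joint law of `n` independent uniform points `X_1, …, X_n` of `[0,1]^d`. -/
noncomputable def pointsLaw (d n : ℕ) : Measure (Fin n → EuclideanSpace ℝ (Fin d)) :=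
  Measure.pi fun _ => uniformCube d

/-- The geometric graph on the index set `[n]` given by points `X_1, …, X_n` and radius `r`:
distinct `i, j` are joined iff the Euclidean distance of `X_i` and `X_j` is at most `r`.
If `X` has law `pointsLaw d n`, this is the random geometric graph `G_d(n,r)`. -/
def geomGraph {d n : ℕ} (X : Fin n → EuclideanSpace ℝ (Fin d)) (r : ℝ) :
    SimpleGraph (Fin n) where
  Adj i j := i ≠ j ∧ dist (X i) (X j) ≤ r
  symm := ⟨fun i j h => ⟨h.1.symm, by rw [dist_comm]; exact h.2⟩⟩
  loopless := ⟨fun _ h => h.1 rfl⟩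

/-- `H` is an `α`-subgraph of `G`: `H ⊆ G` and `d_H(v) ≥ α d_G(v)` for every vertex `v`. -/
def IsAlphaSubgraph {V : Type*} (α : ℝ) (H G : SimpleGraph V) : Prop :=
  H ≤ G ∧ ∀ v : V, α * ((G.neighborSet v).ncard : ℝ) ≤ ((H.neighborSet v).ncard : ℝ)

/-- `H` contains a cycle of length `L` through the vertex `v`. -/
def HasCycleThrough {V : Type*} (H : SimpleGraph V) (L : ℕ) (v : V) : Prop :=
  ∃ (u : V) (p : H.Walk u u), p.IsCycle ∧ p.length = L ∧ v ∈ p.support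

theorem volume_unitCube (d : ℕ) : volume (unitCube d) = 1 := by
  have h : unitCube d = (MeasurableEquiv.toLp 2 (Fin d → ℝ)).symm ⁻¹'
      (Set.univ.pi fun _ => Set.Icc (0 : ℝ) 1) := by
    ext x; simp [unitCube, Pi.le_def, forall_and]
  rw [h, ((EuclideanSpace.volume_preserving_symm_measurableEquiv_toLp (Fin d))).measure_preimage_equiv,
    volume_pi_pi]
  simp

instance uniformCube_isProbabilityMeasure (d : ℕ) : IsProbabilityMeasure (uniformCube d) :=
  ⟨by simp [uniformCube, volume_unitCube]⟩

instance pointsLaw_isProbabilityMeasure (d n : ℕ) : IsProbabilityMeasure (pointsLaw d n) := by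
  unfold pointsLaw; infer_instance

/-! Cut the cube into boxes whose side is a large constant multiple of `r`, and cut the boxes into
much finer cells. Chernoff bounds show that with high probability the points are evenly spread over
cells, boxes and inner parts of boxes (`EvenlySpread`, `measure_not_evenlySpread_le_inv`). The rest
is deterministic and treats all `H`, `v`, `L` at once (`exists_cycles_of_evenlySpread`).

Slots. Let `D` be the expected degree of a vertex far from the boundary and `α = η + ε`. In the
subgraph of `H` induced on a box, all degrees are at most about `D`, and all but few are at least
about `αD`, since the layer of width `r` at the boundary of the box is thin. Apply Szemerédi's
regularity lemma and keep the dense uniform pairs among the `k` parts. For an independent set `I` of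
parts, double counting edges gives `|N(I)| ≥ α|I|` up to a small error, while `|I| + |N(I)| ≤ k`; so
the deficiency is at most about `(1-α)/(1+α) * k`, and Hall's theorem yields an injection along kept
pairs, defined on about `2α/(1+α)` of the parts. Halving each part, one half for its role as source
and one for its role as target, gives disjoint robust pairs covering that proportion of the box,
which exceeds `2η/(1+η)` (`exists_slots`). Each pair carries paths on every even number of vertices
from 4 to nearly its full size, avoiding any prescribed small set (`IsRobustPair.exists_pathNode`).

Links. Vertices in adjacent cells have almost the same ball, and `α > 1/2`, so their
`H`-neighbourhoods share many vertices (`EvenlySpread.exists_common_neighbor`). Stepping from cell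
to cell gives paths of one fixed length between vertices of nearby boxes
(`EvenlySpread.exists_connecting_path`).

Assembly. Follow a Hamiltonian path of the grid of boxes through all slots and come back through one
return vertex per box. Each link can interfere with boundedly many others only, so a greedy choice
makes everything disjoint (`hasCycleThrough_of_nodes`). Tuning the slots realises all lengths of one
parity in a long interval; inserting an edge at `v` in place of `v` alone changes the parity
(`hasCycleThrough_of_boxes`). For smaller lengths, boxes are dropped from the ends of the chain; the
intervals of successive chains overlap (`exists_subchain`, `hasCycleThrough_of_grid`). -/

/-! ### Hall's theorem with deficiency, and robust pairs. -/

/-- Deficiency version of Hall's theorem for a relation on a finite type. -/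
theorem exists_partial_matching {ι : Type*} [Fintype ι] [DecidableEq ι] (R : ι → ι → Prop)
    [DecidableRel R] (t : ℕ)
    (h : ∀ I : Finset ι, I.card ≤ (I.biUnion fun i => Finset.univ.filter (R i)).card + t) :
    ∃ (S : Finset ι) (f : ι → ι), Fintype.card ι ≤ S.card + t ∧ Set.InjOn f S ∧
      ∀ i ∈ S, R i (f i) := by
  classical
  -- Adding `t` common dummy targets to every neighbourhood turns the deficiency condition into
  -- Hall's condition; at most `t` indices are then matched to a dummy.
  let T : ι → Finset (ι ⊕ Fin t) := fun i => (Finset.univ.filter (R i)).disjSum Finset.univ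
  have hall : ∀ I : Finset ι, I.card ≤ (I.biUnion T).card := by
    intro I
    rcases I.eq_empty_or_nonempty with rfl | ⟨i₀, hi₀⟩
    · simp
    have : I.biUnion T = (I.biUnion fun i => Finset.univ.filter (R i)).disjSum Finset.univ := by
      ext x
      cases x with
      | inl x => simp [T]
      | inr x => simpa [T] using ⟨i₀, hi₀⟩
    rw [this, Finset.card_disjSum]
    simpa using h I
  obtain ⟨φ, hφ, hφT⟩ := (Finset.all_card_le_biUnion_card_iff_exists_injective T).1 hall
  let S : Finset ι := Finset.univ.filter fun i => (φ i).isLeft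
  refine ⟨S, fun i => (φ i).elim id fun _ => i, ?_, ?_, ?_⟩
  · have h1 : S.card + (Finset.univ.filter fun i => ¬ (φ i).isLeft).card = Fintype.card ι := by
      rw [Finset.card_filter_add_card_filter_not, Finset.card_univ]
    have h2 : (Finset.univ.filter fun i => ¬ (φ i).isLeft).card ≤ t := by
      have : (Finset.univ.filter fun i => ¬ (φ i).isLeft).card
          ≤ ((Finset.univ : Finset (Fin t)).image (Sum.inr : Fin t → ι ⊕ Fin t)).card := by
        apply Finset.card_le_card_of_injOn φ
        · intro i hi
          have hi' : ¬ (φ i).isLeft := by simpa using hi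
          cases hx : φ i with
          | inl x => simp [hx] at hi'
          | inr x => simp
        · exact hφ.injOn
      refine this.trans (Finset.card_image_le.trans ?_)
      simp
    omega
  · intro i hi j hj hij
    have hi' : (φ i).isLeft := by simpa [S] using hi
    have hj' : (φ j).isLeft := by simpa [S] using hj
    apply hφ
    cases hx : φ i with
    | inr x => simp [hx] at hi'
    | inl x =>
      cases hy : φ j with
      | inr y => simp [hy] at hj'
      | inl y => simpa [hx, hy] using hij
  · intro i hi
    have hi' : (φ i).isLeft := by simpa [S] using hi
    have := hφT i
    cases hx : φ i with
    | inr x => simp [hx] at hi'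
    | inl x => simpa [hx, T] using this

/-- A pair of vertex sets in which large subsets span edges, and moreover every large subset
of one side has a vertex with many neighbours in any given larger subset of the other side. -/
structure IsRobustPair {V : Type*} (H : SimpleGraph V) (A B : Finset V) (γ g : ℕ) : Prop where
  adj : ∀ A' ⊆ A, ∀ B' ⊆ B, γ ≤ A'.card → γ ≤ B'.card → ∃ a ∈ A', ∃ b ∈ B', H.Adj a b
  left : ∀ A' ⊆ A, ∀ B' ⊆ B, γ ≤ A'.card → g ≤ B'.card →
    ∃ a ∈ A', ∃ T ⊆ B', T.card = 3 * γ ∧ ∀ b ∈ T, H.Adj a b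
  right : ∀ A' ⊆ A, ∀ B' ⊆ B, g ≤ A'.card → γ ≤ B'.card →
    ∃ b ∈ B', ∃ T ⊆ A', T.card = 3 * γ ∧ ∀ a ∈ T, H.Adj a b

/-! ### Robust pairs from dense uniform pairs. -/

section Density

open SimpleGraph

/-- If there are many edges between two sets, some vertex has large degree to the other set. -/
theorem exists_large_degree {V : Type*} [DecidableEq V] (H : SimpleGraph V) [DecidableRel H.Adj]
    (A B : Finset V) (hA : A.Nonempty) (ρ : ℝ) (k : ℕ)
    (h : ρ * (A.card * B.card) ≤ ((H.interedges A B).card : ℝ)) (hk : (k : ℝ) ≤ ρ * B.card) :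
    ∃ a ∈ A, ∃ T ⊆ B, T.card = k ∧ ∀ b ∈ T, H.Adj a b := by
  have hsum : (H.interedges A B).card = ∑ a ∈ A, (B.filter (H.Adj a)).card := by
    rw [SimpleGraph.interedges, Rel.interedges, Finset.card_filter, Finset.sum_product]
    exact Finset.sum_congr rfl fun a _ => (Finset.card_filter _ _).symm
  have : ∃ a ∈ A, (k : ℝ) ≤ (B.filter (H.Adj a)).card := by
    apply Finset.exists_le_of_sum_le hA
    rw [Finset.sum_const, nsmul_eq_mul]
    calc (A.card : ℝ) * k ≤ A.card * (ρ * B.card) := by gcongr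
      _ = ρ * (A.card * B.card) := by ring
      _ ≤ _ := h
      _ = _ := by rw [hsum]; push_cast; rfl
  obtain ⟨a, ha, hle⟩ := this
  obtain ⟨T, hT, hTc⟩ := Finset.exists_subset_card_eq (Nat.cast_le.1 hle)
  exact ⟨a, ha, T, fun b hb => (Finset.mem_filter.1 (hT hb)).1, hTc,
    fun b hb => (Finset.mem_filter.1 (hT hb)).2⟩

/-- Subsets of a dense uniform pair form a robust pair. -/
theorem IsUniform.isRobustPair {V : Type*} [DecidableEq V] (H : SimpleGraph V)
    [DecidableRel H.Adj] {U W A B : Finset V} {εs ρ : ℝ} {γ g : ℕ} (hρ : 0 < ρ)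
    (hU : H.IsUniform εs U W) (hd : 2 * ρ ≤ H.edgeDensity U W) (hε : εs ≤ ρ)
    (hAU : A ⊆ U) (hBW : B ⊆ W) (hγ : 0 < γ)
    (hγU : εs * U.card ≤ γ) (hγW : εs * W.card ≤ γ) (hγg : γ ≤ g)
    (hg : (3 * γ : ℝ) ≤ ρ * g) : IsRobustPair H A B γ g := by
  have key : ∀ A' ⊆ A, ∀ B' ⊆ B, γ ≤ A'.card → γ ≤ B'.card →
      ρ * (A'.card * B'.card) ≤ ((H.interedges A' B').card : ℝ) := by
    intro A' hA' B' hB' hAc hBc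
    have h1 := hU (hA'.trans hAU) (hB'.trans hBW)
      (by rw [mul_comm]; exact hγU.trans (by exact_mod_cast hAc))
      (by rw [mul_comm]; exact hγW.trans (by exact_mod_cast hBc))
    -- Density at least `2ρ`, less the uniformity error `εs ≤ ρ`.
    have h2 : ρ ≤ ((H.edgeDensity A' B' : ℚ) : ℝ) := by
      have := (abs_lt.1 h1).1
      linarith
    have hA0 : (0 : ℝ) < A'.card := by exact_mod_cast hγ.trans_le hAc
    have hB0 : (0 : ℝ) < B'.card := by exact_mod_cast hγ.trans_le hBc
    rw [SimpleGraph.edgeDensity_def] at h2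
    push_cast at h2
    rwa [le_div_iff₀ (by positivity)] at h2
  have hne : ∀ {X : Finset V}, γ ≤ X.card → X.Nonempty := fun h =>
    Finset.card_pos.1 (hγ.trans_le h)
  refine ⟨?_, ?_, ?_⟩
  · intro A' hA' B' hB' hAc hBc
    have := key A' hA' B' hB' hAc hBc
    have hA0 : (0 : ℝ) < A'.card := by exact_mod_cast hγ.trans_le hAc
    have hB0 : (0 : ℝ) < B'.card := by exact_mod_cast hγ.trans_le hBc
    have h0 : (0 : ℝ) < (H.interedges A' B').card := lt_of_lt_of_le (by positivity) this
    obtain ⟨⟨a, b⟩, hab⟩ := Finset.card_pos.1 (Nat.cast_pos.1 h0)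
    rw [SimpleGraph.mem_interedges_iff] at hab
    exact ⟨a, hab.1, b, hab.2.1, hab.2.2⟩
  · intro A' hA' B' hB' hAc hBc
    -- The average degree into a set of size at least `g` is at least `ρ * g ≥ 3γ`.
    refine exists_large_degree H A' B' (hne hAc) ρ (3 * γ)
      (key A' hA' B' hB' hAc (hγg.trans hBc)) ?_
    push_cast
    refine hg.trans ?_
    gcongr
  · intro A' hA' B' hB' hAc hBc
    have := key A' hA' B' hB' (hγg.trans hAc) hBc
    have hsymm := H.symm
    rw [SimpleGraph.interedges, Rel.card_interedges_comm] at this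
    obtain ⟨b, hb, T, hT, hTc, hTa⟩ := exists_large_degree H B' A' (hne hBc) ρ (3 * γ)
      (by rwa [mul_comm (B'.card : ℝ)]) (by
        push_cast
        refine hg.trans ?_
        gcongr)
    exact ⟨b, hb, T, hT, hTc, fun a ha => (hTa a ha).symm⟩

end Density

/-! ### Edges lost in the reduced graph, and double counting. -/

section Regularity

open SimpleGraph Finset

/-- Passing to the dense uniform pairs of a regular partition destroys few edges. -/
theorem card_unreduced_le {V : Type*} [Fintype V] [DecidableEq V] [Nonempty V]
    (G : SimpleGraph V) [DecidableRel G.Adj] (P : Finpartition (univ : Finset V)) {ε₁ εs : ℝ}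
    (hε₁ : 0 < ε₁) (hεs : 0 < εs) (hs : εs ≤ ε₁ / 16) (hP : P.IsEquipartition)
    (hPu : P.IsUniform G εs) (hcard : 4 / ε₁ ≤ #P.parts) :
    (#{x : V × V | G.Adj x.1 x.2 ∧ ¬(G.regularityReduced P εs (ε₁ / 16)).Adj x.1 x.2} : ℝ) ≤
      ε₁ * (Fintype.card V : ℝ) ^ 2 := by
  -- A lost edge lies in a non-uniform pair, inside one part, or in a sparse pair. As fractions of
  -- `|V|²` these cost at most `ε₁/4`, `ε₁/2` and `ε₁/4`.
  let A := (P.nonUniforms G εs).biUnion fun (U, V) ↦ U ×ˢ V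
  let B := P.parts.biUnion offDiag
  let C := (P.sparsePairs G (ε₁ / 16)).biUnion fun (U, V) ↦ G.interedges U V
  have hsub : ({x : V × V | G.Adj x.1 x.2 ∧
      ¬(G.regularityReduced P εs (ε₁ / 16)).Adj x.1 x.2} : Finset (V × V)) ⊆ A ∪ B ∪ C := by
    rintro ⟨x, y⟩ hxy
    simp only [mem_filter, mem_univ, true_and, regularityReduced_adj, not_and, not_exists,
      not_le] at hxy
    obtain ⟨h, h'⟩ := hxy
    replace h' := h' h
    obtain ⟨U, hU, hx⟩ := P.exists_mem (mem_univ x)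
    obtain ⟨W, hW, hy⟩ := P.exists_mem (mem_univ y)
    simp only [A, B, C, mem_union, mem_biUnion, Prod.exists, mem_product, mem_offDiag,
      P.mk_mem_nonUniforms, Finpartition.mk_mem_sparsePairs, mem_interedges_iff]
    obtain rfl | hUW := eq_or_ne U W
    · exact Or.inl (Or.inr ⟨U, hU, hx, hy, G.ne_of_adj h⟩)
    by_cases h₂ : G.IsUniform εs U W
    · exact Or.inr ⟨U, W, ⟨hU, hW, hUW, h' _ hU _ hW hx hy hUW h₂⟩, hx, hy, h⟩
    · exact Or.inl (Or.inl ⟨U, W, ⟨hU, hW, hUW, h₂⟩, hx, hy⟩)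
  have h1 : (#(A ∪ B ∪ C) : ℝ) ≤ #A + #B + #C := by
    exact_mod_cast (card_union_le _ _).trans (Nat.add_le_add_right (card_union_le _ _) _)
  have hA : (#A : ℝ) ≤ 4 * εs * (Fintype.card V : ℝ) ^ 2 :=
    (hP.sum_nonUniforms_lt univ_nonempty hεs hPu).le
  have hB : (#B : ℝ) ≤ ε₁ / 2 * (Fintype.card V : ℝ) ^ 2 :=
    hP.card_biUnion_offDiag_le hε₁ hcard
  have hC : (#C : ℝ) ≤ 4 * (ε₁ / 16) * (Fintype.card V : ℝ) ^ 2 :=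
    hP.card_interedges_sparsePairs_le (G := G) (by positivity)
  have h2 : (#{x : V × V | G.Adj x.1 x.2 ∧
      ¬(G.regularityReduced P εs (ε₁ / 16)).Adj x.1 x.2} : ℝ) ≤ #(A ∪ B ∪ C) := by
    exact_mod_cast card_le_card hsub
  have h3 : 4 * εs * (Fintype.card V : ℝ) ^ 2 ≤ 4 * (ε₁ / 16) * (Fintype.card V : ℝ) ^ 2 := by
    gcongr
  linarith

/-- If few edges are lost in passing from `G` to `G'`, few vertices lose many edges. -/
theorem card_filter_lost_le {V : Type*} [Fintype V] [DecidableEq V]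
    (G G' : SimpleGraph V) [DecidableRel G.Adj] [DecidableRel G'.Adj] (hG : G' ≤ G) {a b : ℝ}
    (h : (#{x : V × V | G.Adj x.1 x.2 ∧ ¬G'.Adj x.1 x.2} : ℝ) ≤ a) :
    b * #{v | b < (#{w | G.Adj v w} : ℝ) - #{w | G'.Adj v w}} ≤ a := by
  -- The number of lost edges is the sum of the degree losses, so the claim is Markov's inequality.
  have hsum : (#{x : V × V | G.Adj x.1 x.2 ∧ ¬G'.Adj x.1 x.2} : ℝ) =
      ∑ v, ((#{w | G.Adj v w} : ℝ) - #{w | G'.Adj v w}) := by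
    rw [card_filter, ← univ_product_univ, sum_product]
    push_cast
    refine sum_congr rfl fun v _ => ?_
    have hsub : (univ.filter (G'.Adj v)) ⊆ univ.filter (G.Adj v) := by
      intro w; simpa using fun h => hG h
    rw [← cast_card_sdiff hsub, ← filter_and_not, card_filter]
    push_cast
    rfl
  rw [hsum] at h
  refine le_trans ?_ h
  calc b * #{v | b < (#{w | G.Adj v w} : ℝ) - #{w | G'.Adj v w}}
      = ∑ v ∈ ({v | b < (#{w | G.Adj v w} : ℝ) - #{w | G'.Adj v w}} : Finset V), b := by
        rw [sum_const, nsmul_eq_mul, mul_comm]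
    _ ≤ ∑ v ∈ ({v | b < (#{w | G.Adj v w} : ℝ) - #{w | G'.Adj v w}} : Finset V),
          ((#{w | G.Adj v w} : ℝ) - #{w | G'.Adj v w}) :=
        sum_le_sum fun v hv => (mem_filter.1 hv).2.le
    _ ≤ _ := by
        refine sum_le_univ_sum_of_nonneg fun v => ?_
        rw [sub_nonneg]
        exact_mod_cast card_le_card (fun w => by simpa using fun h => hG h)

/-- Double counting of the edges leaving a set of vertices of large degree. -/
theorem card_mul_le_card_mul_of_degrees {V : Type*} [Fintype V] [DecidableEq V]
    (G : SimpleGraph V) [DecidableRel G.Adj] (X Y : Finset V) {a b : ℝ}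
    (hXY : ∀ x ∈ X, ∀ y, G.Adj x y → y ∈ Y)
    (hX : ∀ x ∈ X, a ≤ (#{w | G.Adj x w} : ℝ)) (hY : ∀ y ∈ Y, (#{w | G.Adj y w} : ℝ) ≤ b) :
    a * #X ≤ b * #Y := by
  have h1 : ∑ x ∈ X, #{w | G.Adj x w} ≤ ∑ y ∈ Y, #{w | G.Adj y w} := by
    calc ∑ x ∈ X, #{w | G.Adj x w} = ∑ x ∈ X, #(Y.filter (G.Adj x)) := by
          refine sum_congr rfl fun x hx => congrArg _ ?_
          ext y
          simpa using fun h => hXY x hx y h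
      _ = ∑ y ∈ Y, #(X.filter fun x => G.Adj x y) :=
          sum_card_bipartiteAbove_eq_sum_card_bipartiteBelow _
      _ ≤ _ := by
          refine sum_le_sum fun y _ => card_le_card fun x => ?_
          simpa using fun _ h => h.symm
  have h2 : a * #X ≤ ∑ x ∈ X, (#{w | G.Adj x w} : ℝ) := by
    rw [mul_comm, ← nsmul_eq_mul]; exact card_nsmul_le_sum _ _ _ hX
  have h3 : ∑ y ∈ Y, (#{w | G.Adj y w} : ℝ) ≤ b * #Y := by
    rw [mul_comm, ← nsmul_eq_mul]; exact sum_le_card_nsmul _ _ _ hY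
  have h4 : (∑ x ∈ X, (#{w | G.Adj x w} : ℝ)) ≤ ∑ y ∈ Y, (#{w | G.Adj y w} : ℝ) := by
    exact_mod_cast h1
  linarith

/-- For a symmetric relation, the deficiency of a set is at most that of its isolated part, which
is disjoint from its neighbourhood. -/
theorem exists_isolated_subset {ι : Type*} [Fintype ι] [DecidableEq ι] (R : ι → ι → Prop)
    [DecidableRel R] (hR : ∀ i j, R i j → R j i) (I : Finset ι) :
    ∃ I₁ : Finset ι, #I + #(I₁.biUnion fun i => univ.filter (R i)) ≤
        #(I.biUnion fun i => univ.filter (R i)) + #I₁ ∧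
      #I₁ + #(I₁.biUnion fun i => univ.filter (R i)) ≤ Fintype.card ι := by
  -- An element of `I` related to another element of `I` lies in the neighbourhood of `I` by
  -- symmetry and adds no deficiency. The neighbours of the remaining elements lie outside `I`.
  let I₁ := I.filter fun i => ∀ j ∈ I, ¬ R i j
  have hdisj : Disjoint I (I₁.biUnion fun i => univ.filter (R i)) := by
    rw [Finset.disjoint_left]
    intro x hx hx'
    simp only [mem_biUnion, mem_filter, mem_univ, true_and, I₁] at hx'
    obtain ⟨i, ⟨-, hi⟩, hix⟩ := hx'
    exact hi x hx hix
  have hI₁ : I₁ ⊆ I := filter_subset _ _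
  refine ⟨I₁, ?_, ?_⟩
  · have hsub : (I \ I₁) ∪ (I₁.biUnion fun i => univ.filter (R i)) ⊆
        I.biUnion fun i => univ.filter (R i) := by
      apply union_subset
      · intro i hi
        simp only [mem_sdiff, mem_filter, not_and, not_forall, not_not, I₁] at hi
        obtain ⟨j, hj, hij⟩ := hi.2 hi.1
        simpa using ⟨j, hj, hR _ _ hij⟩
      · exact biUnion_subset_biUnion_of_subset_left _ (filter_subset _ _)
    have := card_le_card hsub
    rw [card_union_of_disjoint (disjoint_of_subset_left sdiff_subset hdisj),
      card_sdiff_of_subset hI₁] at this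
    have h2 : #I₁ ≤ #I := card_le_card hI₁
    omega
  · rw [← card_union_of_disjoint (disjoint_of_subset_left (filter_subset _ _) hdisj)]
    exact card_le_univ _

end Regularity

/-! ### Large matchings of parts, and disjoint slots. -/

section Matching

open SimpleGraph Finset

/-- Arithmetic of the deficiency bound. Here `a` counts isolated parts and `b` their neighbours, `p`
is the part size, and `x`, `y` count the vertices that enter the double counting. Up to errors of
order `β * k`, the degree inequality says `α * a ≤ b`; the constraint `a + b ≤ k` then bounds `a -
b`. -/
theorem matching_deficiency_le {α β a b k p N x y : ℝ} (hβ : 0 < β) (hβ1 : β ≤ 1 / 100)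
    (hα : 1 / 2 ≤ α) (hα1 : α ≤ 1) (ha : 0 ≤ a) (hb : 0 ≤ b) (hab : a + b ≤ k) (hp : 0 < p)
    (hβp : 1 ≤ β * p) (hN : N ≤ k * (p + 1)) (hx : a * p - 2 * β * N ≤ x)
    (hy : y ≤ b * (p + 1)) (hxy : (α - 2 * β) * x ≤ (1 + β) * y) :
    a - b ≤ ((1 - α) / (1 + α) + 16 * β) * k := by
  have hk : 0 ≤ k := by linarith
  have hp1 : p + 1 ≤ (1 + β) * p := by linarith
  have e1 : (α - 2 * β) * (a - 2 * β * ((1 + β) * k)) ≤ (1 + β) * ((1 + β) * b) := by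
    have h1 : (a - 2 * β * ((1 + β) * k)) * p ≤ x := by
      have : 2 * β * N ≤ 2 * β * (k * ((1 + β) * p)) := by
        gcongr
        exact hN.trans (by gcongr)
      linarith
    have h2 : y ≤ b * ((1 + β) * p) := hy.trans (by gcongr)
    have h3 : (α - 2 * β) * ((a - 2 * β * ((1 + β) * k)) * p) ≤ (α - 2 * β) * x :=
      mul_le_mul_of_nonneg_left h1 (by linarith)
    have h4 : (1 + β) * y ≤ (1 + β) * (b * ((1 + β) * p)) := by gcongr
    have h5 : (α - 2 * β) * (a - 2 * β * ((1 + β) * k)) * p ≤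
        (1 + β) * ((1 + β) * b) * p := by linarith
    exact le_of_mul_le_mul_right h5 hp
  have e2 : α * a - 8 * β * k ≤ b := by
    have h1 : β * b ≤ β * k := by gcongr; linarith
    have h2 : β * a ≤ β * k := by gcongr; linarith
    have hβk : 0 ≤ β * k := by positivity
    have h3 : β * (β * b) ≤ β * k := by nlinarith
    have h4 : (α - 2 * β) * (2 * β * ((1 + β) * k)) ≤ 3 * (β * k) := by
      have : (α - 2 * β) * (2 * (1 + β)) ≤ 3 := by nlinarith
      nlinarith
    linarith
  -- From the identity `(a - b)(1 + α) = (1 - α)(a + b) + 2(α a - b)`.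
  have e3 : (a - b) * (1 + α) ≤ (1 - α) * k + 16 * β * k := by
    have h1 : (1 - α) * (a + b) ≤ (1 - α) * k := by gcongr
    linarith
  have e4 : a - b ≤ ((1 - α) * k + 16 * β * k) / (1 + α) := by
    rw [le_div_iff₀ (by linarith)]; exact e3
  have e5 : 16 * β * k / (1 + α) ≤ 16 * β * k := div_le_self (by positivity) (by linarith)
  calc a - b ≤ ((1 - α) * k + 16 * β * k) / (1 + α) := e4
    _ = (1 - α) / (1 + α) * k + 16 * β * k / (1 + α) := by ring
    _ ≤ _ := by linarith

/-- A near-regular graph that respects a symmetric relation on the parts of an equipartition forces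
a large (directed) matching of that relation. -/
theorem exists_parts_matching {V : Type*} [Fintype V] [DecidableEq V] (G : SimpleGraph V)
    [DecidableRel G.Adj] (P : Finpartition (univ : Finset V)) (hP : P.IsEquipartition)
    (R : P.parts → P.parts → Prop) [DecidableRel R] (hR : ∀ i j, R i j → R j i)
    (hRG : ∀ i j : P.parts, ∀ x ∈ i.1, ∀ y ∈ j.1, G.Adj x y → R i j)
    {α β D : ℝ} (hD : 0 < D) (hβ : 0 < β) (hβ1 : β ≤ 1 / 100) (hα : 1 / 2 ≤ α) (hα1 : α ≤ 1)
    (hp : 1 ≤ β * (Fintype.card V / #P.parts : ℕ)) (Bad : Finset V)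
    (hBad : (#Bad : ℝ) ≤ 2 * β * Fintype.card V)
    (hup : ∀ y, (#{w | G.Adj y w} : ℝ) ≤ (1 + β) * D)
    (hlow : ∀ x ∉ Bad, (α - 2 * β) * D ≤ (#{w | G.Adj x w} : ℝ)) :
    ∃ (S : Finset P.parts) (f : P.parts → P.parts), Set.InjOn f S ∧ (∀ i ∈ S, R i (f i)) ∧
      (2 * α / (1 + α) - 16 * β) * #P.parts - 1 ≤ #S := by
  set k := #P.parts with hk
  set N := Fintype.card V with hN
  set p := N / k with hpdef
  have hcardι : Fintype.card P.parts = k := by simp [hk]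
  have hlo : ∀ i : P.parts, p ≤ #i.1 := fun i => by
    simpa [hpdef, hN, hk] using hP.average_le_card_part i.2
  have hhi : ∀ i : P.parts, #i.1 ≤ p + 1 := fun i => by
    simpa [hpdef, hN, hk] using hP.card_part_le_average_add_one i.2
  have hNk : (N : ℝ) ≤ k * (p + 1) := by
    have : N ≤ k * (p + 1) := by
      rw [hN, ← card_univ, ← P.sum_card_parts]
      exact sum_le_card_nsmul _ _ _ fun i hi => hhi ⟨i, hi⟩
    exact_mod_cast this
  have hp0 : (0 : ℝ) < p := by
    by_contra h
    nlinarith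
  set t : ℕ := ⌈((1 - α) / (1 + α) + 16 * β) * k⌉₊ with ht
  obtain ⟨S, f, hS, hf, hRf⟩ := exists_partial_matching R t (by
    intro I
    obtain ⟨I₁, h1, h2⟩ := exists_isolated_subset R hR I
    set J := I₁.biUnion fun i => univ.filter (R i) with hJ
    rw [hcardι] at h2
    -- Every edge at a vertex of `X` ends in `Y`, because `G` respects `R`; vertices of `X` have
    -- large degree as the bad ones are removed.
    let X := (I₁.biUnion fun i => i.1) \ Bad
    let Y := J.biUnion fun i => i.1
    have hX : (#I₁ : ℝ) * p - 2 * β * N ≤ #X := by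
      have e1 : #I₁ * p ≤ #(I₁.biUnion fun i => i.1) := by
        rw [card_biUnion]
        · exact card_nsmul_le_sum _ _ _ fun i _ => hlo i
        · intro i _ j _ hij
          exact P.disjoint i.2 j.2 fun h => hij (Subtype.ext h)
      have e2 : #(I₁.biUnion fun i => i.1) ≤ #X + #Bad := by
        have : #(I₁.biUnion fun i => i.1) - #Bad ≤ #X := le_card_sdiff Bad _
        omega
      have e3 : (#I₁ : ℝ) * p ≤ #X + #Bad := by exact_mod_cast e1.trans e2
      linarith
    have hY : (#Y : ℝ) ≤ #J * (p + 1) := by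
      have : #Y ≤ #J * (p + 1) :=
        card_biUnion_le.trans (sum_le_card_nsmul _ _ _ fun i _ => hhi i)
      exact_mod_cast this
    have hXY : (α - 2 * β) * D * #X ≤ (1 + β) * D * #Y := by
      apply card_mul_le_card_mul_of_degrees G X Y
      · intro x hx y hxy
        simp only [X, mem_sdiff, mem_biUnion] at hx
        obtain ⟨⟨i, hi, hxi⟩, -⟩ := hx
        obtain ⟨W, hW, hy⟩ := P.exists_mem (mem_univ y)
        refine mem_biUnion.2 ⟨⟨W, hW⟩, ?_, hy⟩
        refine mem_biUnion.2 ⟨i, hi, mem_filter.2 ⟨mem_univ _, hRG i ⟨W, hW⟩ x hxi y hy hxy⟩⟩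
      · intro x hx
        exact hlow x (mem_sdiff.1 hx).2
      · exact fun y _ => hup y
    have hXY' : (α - 2 * β) * #X ≤ (1 + β) * #Y := by
      have : ((α - 2 * β) * #X) * D ≤ ((1 + β) * #Y) * D := by linarith
      exact le_of_mul_le_mul_right this hD
    have hsum : (#I₁ : ℝ) + #J ≤ k := by exact_mod_cast h2
    have h3 : (#I₁ : ℝ) - #J ≤ ((1 - α) / (1 + α) + 16 * β) * k :=
      matching_deficiency_le hβ hβ1 hα hα1 (Nat.cast_nonneg _) (Nat.cast_nonneg _) hsum hp0 hp hNk
        hX hY hXY'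
    have h4 : (#I₁ : ℝ) ≤ #J + t := by
      have := Nat.le_ceil (((1 - α) / (1 + α) + 16 * β) * k)
      linarith
    have h5 : #I₁ ≤ #J + t := by exact_mod_cast h4
    omega)
  refine ⟨S, f, hf, hRf, ?_⟩
  rw [hcardι] at hS
  have h1 : (k : ℝ) ≤ #S + t := by exact_mod_cast hS
  have h2 : (t : ℝ) < ((1 - α) / (1 + α) + 16 * β) * k + 1 := Nat.ceil_lt_add_one (by
    have : 0 ≤ (1 - α) / (1 + α) := div_nonneg (by linarith) (by linarith)
    positivity)
  have h3 : (1 - α) / (1 + α) = 1 - 2 * α / (1 + α) := by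
    have : 1 + α ≠ 0 := by linarith
    field_simp
    ring
  rw [h3] at h2
  linarith

/-- The function `x ↦ 2x/(1+x)` grows by at least `ε/2` from `η` to `η + ε`. This gain pays for the
error in the matching, for rounding the halves, and for the `3g` vertices given up on each side of a
pair. -/
theorem cover_le_of_matching {ε η k p h g s N : ℝ} (hε : 0 < ε) (hη : 1 / 2 ≤ η)
    (hηε : η + ε ≤ 1) (hk : 0 ≤ k) (hp : 0 ≤ p) (hβp : 1 ≤ ε / 100 * p) (hβk : 1 ≤ ε / 100 * k)
    (hh : p ≤ 2 * h + 1) (hg : g ≤ ε * p / 640)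
    (hs : (2 * (η + ε) / (1 + (η + ε)) - 16 * (ε / 100)) * k - 1 ≤ s) (hN : N ≤ k * (p + 1)) :
    2 * η / (1 + η) * N ≤ 2 * s * (h - 3 * g) := by
  have hq : 2 * η / (1 + η) + ε / 2 ≤ 2 * (η + ε) / (1 + (η + ε)) := by
    have h1 : 2 * (η + ε) / (1 + (η + ε)) - 2 * η / (1 + η) =
        2 * ε / ((1 + (η + ε)) * (1 + η)) := by
      have h2 : 1 + (η + ε) ≠ 0 := by linarith
      have h3 : 1 + η ≠ 0 := by linarith
      field_simp
      ring
    have h2 : ε / 2 ≤ 2 * ε / ((1 + (η + ε)) * (1 + η)) := by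
      have h4 : (1 + (η + ε)) * (1 + η) ≤ 2 * 2 := by
        apply mul_le_mul <;> linarith
      rw [div_le_div_iff₀ (by norm_num) (by apply mul_pos <;> linarith)]
      nlinarith
    linarith
  set q := 2 * η / (1 + η) with hqdef
  have hq0 : 0 ≤ q := div_nonneg (by linarith) (by linarith)
  have hq1 : q ≤ 1 := by rw [hqdef, div_le_one (by linarith)]; linarith
  have hS' : (q + 33 / 100 * ε) * k ≤ s := by
    have : (q + ε / 2) * k ≤ 2 * (η + ε) / (1 + (η + ε)) * k := by gcongr
    linarith
  have hsize : (1 - 3 / 100 * ε) * (p + 1) ≤ 2 * (h - 3 * g) := by linarith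
  have h0 : 0 ≤ (1 - 3 / 100 * ε) * (p + 1) := mul_nonneg (by linarith) (by positivity)
  have h1 : q ≤ (q + 33 / 100 * ε) * (1 - 3 / 100 * ε) := by
    have : ε * (q + 33 / 100 * ε) ≤ ε * 2 := by gcongr; linarith
    linarith
  calc q * N ≤ q * (k * (p + 1)) := by gcongr
    _ ≤ (q + 33 / 100 * ε) * (1 - 3 / 100 * ε) * (k * (p + 1)) := by gcongr
    _ = (q + 33 / 100 * ε) * k * ((1 - 3 / 100 * ε) * (p + 1)) := by ring
    _ ≤ s * (2 * (h - 3 * g)) :=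
        mul_le_mul hS' hsize h0 (le_trans (by positivity) hS')
    _ = _ := by ring

/-- **Slots.** A dense, nearly regular graph contains boundedly many disjoint robust pairs of equal
size that cover (up to a small loss) the proportion of vertices given by its degree ratio. -/
theorem exists_slots {ε κ : ℝ} (hε : 0 < ε) (hε1 : ε ≤ 1) (hκ : 0 < κ) :
    ∃ K N₀ : ℕ, 0 < K ∧ ∀ {V : Type} [Fintype V] [DecidableEq V] (G : SimpleGraph V)
      [DecidableRel G.Adj] (D η : ℝ), N₀ ≤ Fintype.card V → κ * Fintype.card V ≤ D →
      1 / 2 ≤ η → η + ε ≤ 1 → (∀ v, (#{w | G.Adj v w} : ℝ) ≤ (1 + ε / 100) * D) →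
      (#{v | (#{w | G.Adj v w} : ℝ) < (η + ε - ε / 100) * D} : ℝ) ≤ ε / 100 * Fintype.card V →
      ∃ (k h γ g : ℕ) (A B : Fin k → Finset V), k ≤ K ∧ (∀ i, #(A i) = h) ∧ (∀ i, #(B i) = h) ∧
        (∀ i j, i ≠ j → Disjoint (A i) (A j)) ∧ (∀ i j, i ≠ j → Disjoint (B i) (B j)) ∧
        (∀ i j, Disjoint (A i) (B j)) ∧ (∀ i, IsRobustPair G (A i) (B i) γ g) ∧
        γ ≤ g ∧ 4 * g ≤ h ∧ Fintype.card V ≤ K * γ ∧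
        2 * η / (1 + η) * Fintype.card V ≤ 2 * k * (h - 3 * g : ℝ) := by
  classical
  set β := ε / 100 with hβ
  have hβ0 : 0 < β := by positivity
  -- With `κN ≤ D` this gives `ε₁N² ≤ (βD)(βN)`, so at most `βN` vertices lose more than `βD` of
  -- their degree.
  set ε₁ := β ^ 2 * min κ 1 with hε₁
  have hκm : 0 < min κ 1 := lt_min hκ one_pos
  have hε₁0 : 0 < ε₁ := by positivity
  set ρ := ε₁ / 32 with hρ
  have hρ0 : 0 < ρ := by positivity
  -- Since `γ` is about `εs * p` and `g` about `3γ/ρ`, this makes `g ≤ εp/640`, negligible against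
  -- half a part.
  set εs := ε * ρ / 6400 with hεs
  have hεs0 : 0 < εs := by positivity
  set l := max ⌈4 / ε₁⌉₊ ⌈1 / β⌉₊ with hl
  set b := SzemerediRegularity.bound εs l with hb
  have hb0 : 0 < b := SzemerediRegularity.bound_pos _ _
  -- The first bound dominates both the number of slots and `N / γ`; the second makes the parts so
  -- large that rounding is harmless.
  refine ⟨max b ⌈b / εs⌉₊, max l (b * (⌈1 / εs⌉₊ + ⌈1 / β⌉₊ + 1000)), by positivity, ?_⟩
  intro V _ _ G _ D η hN hκD hη hηε hup hlow
  set N := Fintype.card V with hNdef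
  obtain ⟨P, hPe, hPl, hPb, hPu⟩ := szemeredi_regularity G hεs0 ((le_max_left _ _).trans hN)
  set k := #P.parts with hk
  set p := N / k with hpdef
  set X₀ := ⌈1 / εs⌉₊ + ⌈1 / β⌉₊ + 1000 with hX₀
  have hNX : b * X₀ ≤ N := (le_max_right _ _).trans hN
  have hN0 : 0 < N := lt_of_lt_of_le (by positivity) hNX
  have : Nonempty V := Fintype.card_pos_iff.1 hN0
  have hk0 : 0 < k := card_pos.2 (P.parts_nonempty (univ_nonempty (α := V)).ne_empty)
  have hpX : X₀ ≤ p := by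
    rw [hpdef, Nat.le_div_iff_mul_le hk0, mul_comm]
    exact (Nat.mul_le_mul_right _ hPb).trans hNX
  have hκ1 : min κ 1 ≤ 1 := min_le_right _ _
  have hβ1 : β ≤ 1 / 100 := by rw [hβ]; linarith
  have hε₁1 : ε₁ ≤ 1 := by exact mul_le_one₀ (pow_le_one₀ hβ0.le (by linarith)) hκm.le hκ1
  have hρ1 : ρ ≤ 1 := by rw [hρ]; linarith
  have hεs1 : εs ≤ ρ / 6400 := by rw [hεs]; gcongr; exact mul_le_of_le_one_left hρ0.le hε1
  have hpX' : (⌈1 / εs⌉₊ : ℝ) + ⌈1 / β⌉₊ + 1000 ≤ p := by exact_mod_cast hpX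
  have hεsp : 1 ≤ εs * p := by
    have h1 := Nat.le_ceil (1 / εs)
    have h2 : 1 / εs ≤ p := by linarith [Nat.cast_nonneg (α := ℝ) ⌈1 / β⌉₊]
    rwa [div_le_iff₀' hεs0] at h2
  have hβp : 1 ≤ β * p := by
    have h1 := Nat.le_ceil (1 / β)
    have h2 : 1 / β ≤ p := by linarith [Nat.cast_nonneg (α := ℝ) ⌈1 / εs⌉₊]
    rwa [div_le_iff₀' hβ0] at h2
  have hp1000 : (1000 : ℝ) ≤ p := by
    linarith [Nat.cast_nonneg (α := ℝ) ⌈1 / εs⌉₊, Nat.cast_nonneg (α := ℝ) ⌈1 / β⌉₊]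
  have hl1 : 4 / ε₁ ≤ k := by
    refine (Nat.le_ceil _).trans ?_
    exact_mod_cast (le_max_left _ _).trans hPl
  have hβk : 1 ≤ β * k := by
    have h1 : 1 / β ≤ k := by
      refine (Nat.le_ceil _).trans ?_
      exact_mod_cast (le_max_right _ _).trans hPl
    rwa [div_le_iff₀' hβ0] at h1
  have hNr : (0 : ℝ) < N := by exact_mod_cast hN0
  have hD : 0 < D := lt_of_lt_of_le (by positivity) hκD
  have hNk : (N : ℝ) ≤ k * (p + 1) := by
    have : N ≤ k * (p + 1) := by
      rw [hNdef, ← card_univ, ← P.sum_card_parts]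
      refine sum_le_card_nsmul _ _ _ fun i hi => ?_
      simpa [hpdef, hNdef, hk] using hPe.card_part_le_average_add_one hi
    exact_mod_cast this
  let G' := G.regularityReduced P εs (ε₁ / 16)
  have hG' : G' ≤ G := regularityReduced_le
  let R : P.parts → P.parts → Prop := fun i j =>
    i.1 ≠ j.1 ∧ G.IsUniform εs i.1 j.1 ∧ ε₁ / 16 ≤ G.edgeDensity i.1 j.1
  have hR : ∀ i j, R i j → R j i := by
    rintro i j ⟨h1, h2, h3⟩
    exact ⟨h1.symm, h2.symm, by rwa [edgeDensity_comm]⟩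
  have hRG : ∀ i j : P.parts, ∀ x ∈ i.1, ∀ y ∈ j.1, G'.Adj x y → R i j := by
    rintro i j x hx y hy ⟨-, U, hU, W, hW, hxU, hyW, h1, h2, h3⟩
    obtain rfl : i.1 = U := P.disjoint.elim i.2 hU (not_disjoint_iff.2 ⟨x, hx, hxU⟩)
    obtain rfl : j.1 = W := P.disjoint.elim j.2 hW (not_disjoint_iff.2 ⟨y, hy, hyW⟩)
    exact ⟨h1, h2, h3⟩
  let Bad₁ : Finset V := univ.filter fun v => (#{w | G.Adj v w} : ℝ) < (η + ε - ε / 100) * D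
  let Bad₂ : Finset V :=
    univ.filter fun v => β * D < (#{w | G.Adj v w} : ℝ) - #{w | G'.Adj v w}
  have hBad₂ : (#Bad₂ : ℝ) ≤ β * N := by
    have h1 : β * D * #Bad₂ ≤ ε₁ * (N : ℝ) ^ 2 :=
      card_filter_lost_le G G' hG' (card_unreduced_le G P hε₁0 hεs0 (by linarith) hPe hPu hl1)
    have h2 : ε₁ * (N : ℝ) ^ 2 ≤ β * D * (β * N) := by
      calc ε₁ * (N : ℝ) ^ 2 ≤ β ^ 2 * κ * (N : ℝ) ^ 2 := by
            rw [hε₁]; gcongr; exact min_le_left _ _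
        _ = β ^ 2 * N * (κ * N) := by ring
        _ ≤ β ^ 2 * N * D := by gcongr
        _ = _ := by ring
    exact le_of_mul_le_mul_left (h1.trans h2) (by positivity)
  have hBad : (#(Bad₁ ∪ Bad₂) : ℝ) ≤ 2 * β * N := by
    have : (#(Bad₁ ∪ Bad₂) : ℝ) ≤ #Bad₁ + #Bad₂ := by exact_mod_cast card_union_le _ _
    have h1 : (#Bad₁ : ℝ) ≤ β * N := hlow
    linarith
  obtain ⟨S, f, hf, hRf, hS⟩ := exists_parts_matching G' P hPe R hR hRG (α := η + ε) (β := β) hD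
    hβ0 hβ1 (by linarith) hηε hβp (Bad₁ ∪ Bad₂) hBad
    (fun y => le_trans (by exact_mod_cast card_le_card fun w => by simpa using fun h => hG' h)
      (hup y))
    (fun x hx => by
      simp only [mem_union, not_or, Bad₁, Bad₂, mem_filter, mem_univ, true_and, not_lt] at hx
      have h1 := hx.1
      have h2 := hx.2
      simp only [← hβ] at h1
      linarith)
  rw [← hk] at hS
  set h := p / 2 with hh
  -- A part can be a source and a target of the matching at once; each role gets its own half.
  have hhalf : ∀ i : P.parts, ∃ A B : Finset V, A ⊆ i.1 ∧ B ⊆ i.1 ∧ #A = h ∧ #B = h ∧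
      Disjoint A B := by
    intro i
    have hi : p ≤ #i.1 := by
      simpa [hpdef, hNdef, hk] using hPe.average_le_card_part i.2
    obtain ⟨A, hA, hAc⟩ := exists_subset_card_eq (show h ≤ #i.1 by omega)
    obtain ⟨B, hB, hBc⟩ := exists_subset_card_eq (show h ≤ #(i.1 \ A) by
      rw [card_sdiff_of_subset hA]; omega)
    exact ⟨A, B, hA, hB.trans sdiff_subset, hAc, hBc,
      (disjoint_of_subset_left hB sdiff_disjoint).symm⟩
  choose A B hA hB hAc hBc hAB using hhalf
  have hdisj : ∀ i j : P.parts, i ≠ j → Disjoint i.1 j.1 := fun i j hij =>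
    P.disjoint i.2 j.2 fun h => hij (Subtype.ext h)
  set γ := ⌈εs * (p + 1)⌉₊ with hγ
  set g := ⌈3 * γ / ρ⌉₊ with hg
  have hγ1 : εs * (p + 1) ≤ γ := Nat.le_ceil _
  have hγ2 : (γ : ℝ) ≤ 3 * (εs * p) := by
    have := Nat.ceil_lt_add_one (show 0 ≤ εs * (p + 1 : ℝ) by positivity)
    rw [← hγ] at this
    linarith
  have hγ0 : 0 < γ := Nat.ceil_pos.2 (by positivity)
  have hg1 : (3 * γ : ℝ) ≤ ρ * g := by
    rw [← div_le_iff₀' hρ0]; exact Nat.le_ceil _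
  have hεsp' : εs * p = ρ * (ε * p / 6400) := by rw [hεs]; ring
  have hg2 : (g : ℝ) ≤ ε * p / 640 := by
    have h1 := Nat.ceil_lt_add_one (show 0 ≤ 3 * (γ : ℝ) / ρ by positivity)
    rw [← hg] at h1
    have h2 : 3 * (γ : ℝ) / ρ ≤ 9 * (ε * p / 6400) := by
      rw [div_le_iff₀ hρ0]; linarith
    have h3 : 1 ≤ ε * p / 6400 := by
      have : ρ * (ε * p / 6400) ≤ 1 * (ε * p / 6400) := by gcongr
      linarith
    linarith
  have hγg : γ ≤ g := by
    have : (γ : ℝ) ≤ g := by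
      have : ρ * g ≤ 1 * g := by gcongr
      linarith [Nat.cast_nonneg (α := ℝ) γ]
    exact_mod_cast this
  have hh1 : (p : ℝ) ≤ 2 * h + 1 := by
    have : p ≤ 2 * h + 1 := by omega
    exact_mod_cast this
  have hεp : ε * p ≤ 1 * p := by gcongr
  let e := S.equivFin.symm
  have einj : ∀ i j, i ≠ j → (e i : P.parts) ≠ e j := fun i j hij h =>
    hij (e.injective (Subtype.ext h))
  have hpart : ∀ i : P.parts, (#i.1 : ℝ) ≤ p + 1 := fun i => by
    have : #i.1 ≤ p + 1 := by
      simpa [hpdef, hNdef, hk] using hPe.card_part_le_average_add_one i.2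
    exact_mod_cast this
  refine ⟨#S, h, γ, g, fun i => A (e i), fun i => B (f (e i)), ?_, fun i => hAc _, fun i => hBc _,
    ?_, ?_, ?_, ?_, hγg, ?_, ?_, ?_⟩
  · refine le_trans ?_ (le_max_left _ _)
    refine (card_le_univ S).trans ?_
    simpa using hPb
  · intro i j hij
    exact disjoint_of_subset_left (hA _) (disjoint_of_subset_right (hA _)
      (hdisj _ _ (einj i j hij)))
  · intro i j hij
    refine disjoint_of_subset_left (hB _) (disjoint_of_subset_right (hB _) (hdisj _ _ ?_))
    exact fun h => einj i j hij (hf (e i).2 (e j).2 h)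
  · intro i j
    by_cases hij : (e i : P.parts) = f (e j)
    · show Disjoint (A (e i)) (B (f (e j)))
      rw [hij]; exact hAB _
    · exact disjoint_of_subset_left (hA _) (disjoint_of_subset_right (hB _) (hdisj _ _ hij))
  · intro i
    obtain ⟨-, h2, h3⟩ := hRf (e i) (e i).2
    refine IsUniform.isRobustPair G hρ0 h2 (le_trans (by rw [hρ]; linarith) h3)
      (by linarith) (hA _) (hB _) hγ0 (le_trans ?_ hγ1) (le_trans ?_ hγ1) hγg hg1
    · gcongr; exact hpart _
    · gcongr; exact hpart _
  · have : (4 * g : ℝ) ≤ h := by linarith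
    exact_mod_cast this
  · refine le_trans ?_ (Nat.mul_le_mul_right γ (le_max_right b ⌈(b : ℝ) / εs⌉₊))
    have : (N : ℝ) ≤ ⌈(b : ℝ) / εs⌉₊ * γ := by
      calc (N : ℝ) ≤ k * (p + 1) := hNk
        _ ≤ b * (p + 1) := by gcongr
        _ = b / εs * (εs * (p + 1)) := by field_simp
        _ ≤ ⌈(b : ℝ) / εs⌉₊ * γ := by gcongr; exact Nat.le_ceil _
    exact_mod_cast this
  · exact cover_le_of_matching hε hη hηε (by positivity) (by positivity) (by rw [← hβ]; exact hβp)
      (by rw [← hβ]; exact hβk) hh1 hg2 (by rw [← hβ]; exact hS) hNk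

end Matching

/-! ### Flexible paths in robust pairs, and greedy disjoint choices. -/

section Paths

/-- Greedy path in a robust pair, ending through a reserved set of neighbours of the end vertex. -/
theorem IsRobustPair.exists_path_aux {V : Type*} [DecidableEq V] {H : SimpleGraph V}
    {A B : Finset V} {γ g : ℕ} (hH : IsRobustPair H A B γ g) (hAB : Disjoint A B)
    {b : V} {Nb : Finset V} (hNb : Nb ⊆ A) (hNbγ : γ ≤ Nb.card) (hNbb : ∀ y ∈ Nb, H.Adj y b)
    (i : ℕ) : ∀ (A' B' T : Finset V) (a : V), A' ⊆ A → B' ⊆ B → Disjoint A' Nb →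
      g + i ≤ A'.card → g + i ≤ B'.card → T ⊆ B' → γ ≤ T.card → (∀ x ∈ T, H.Adj a x) →
      ∃ p : List V, p.length = 2 * i + 2 ∧ (a :: (p ++ [b])).IsChain H.Adj ∧ p.Nodup ∧
        ∀ x ∈ p, x ∈ A' ∨ x ∈ B' ∨ x ∈ Nb := by
  induction i with
  | zero =>
    intro A' B' T a hA' hB' hd hAc hBc hT hTc hTa
    -- The reserved set `Nb` is untouched until now, so an edge between it and `T` closes the path
    -- towards `b`.
    obtain ⟨y, hy, x, hx, hxy⟩ := hH.adj Nb hNb T (hT.trans hB') hNbγ hTc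
    refine ⟨[x, y], rfl, ?_, ?_, ?_⟩
    · simpa using ⟨hTa x hx, hxy.symm, hNbb y hy⟩
    · simpa using hxy.ne'
    · intro z hz
      simp only [List.mem_cons, List.not_mem_nil, or_false] at hz
      rcases hz with rfl | rfl
      · exact Or.inr (Or.inl (hT hx))
      · exact Or.inr (Or.inr hy)
  | succ i ih =>
    intro A' B' T a hA' hB' hd hAc hBc hT hTc hTa
    -- Invariant: the current end has at least `γ` unused neighbours `T`. Some `x ∈ T` has `3γ`
    -- neighbours in `A'`, and one of those has `3γ` neighbours in `B'` without `x`, which restores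
    -- the invariant two vertices later.
    obtain ⟨x, hx, T₂, hT₂, hT₂c, hT₂x⟩ := hH.right A' hA' T (hT.trans hB') (by omega) hTc
    have hxB : x ∈ B' := hT hx
    have hc : (B'.erase x).card + 1 = B'.card := Finset.card_erase_add_one hxB
    obtain ⟨y, hy, T₃, hT₃, hT₃c, hT₃y⟩ := hH.left T₂ (hT₂.trans hA') (B'.erase x)
      ((Finset.erase_subset _ _).trans hB') (by omega) (by omega)
    have hyA : y ∈ A' := hT₂ hy
    have hc' : (A'.erase y).card + 1 = A'.card := Finset.card_erase_add_one hyA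
    obtain ⟨p, hp, hpc, hpn, hpm⟩ := ih (A'.erase y) (B'.erase x) T₃ y
      ((Finset.erase_subset _ _).trans hA') ((Finset.erase_subset _ _).trans hB')
      (Finset.disjoint_of_subset_left (Finset.erase_subset _ _) hd) (by omega) (by omega) hT₃
      (by omega) hT₃y
    refine ⟨x :: y :: p, by simp [hp]; ring, ?_, ?_, ?_⟩
    · simp only [List.cons_append, List.isChain_cons_cons] at hpc ⊢
      exact ⟨hTa x hx, (hT₂x y hy).symm, hpc⟩
    · rw [List.nodup_cons, List.nodup_cons]
      refine ⟨?_, ?_, hpn⟩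
      · rw [List.mem_cons, not_or]
        refine ⟨(hT₂x y hy).ne', fun h => ?_⟩
        rcases hpm x h with h | h | h
        · exact Finset.disjoint_left.1 hAB (hA' (Finset.mem_of_mem_erase h)) (hB' hxB)
        · simp at h
        · exact Finset.disjoint_left.1 hAB (hNb h) (hB' hxB)
      · intro h
        rcases hpm y h with h | h | h
        · simp at h
        · exact Finset.disjoint_left.1 hAB (hA' hyA) (hB' (Finset.mem_of_mem_erase h))
        · exact Finset.disjoint_left.1 hd hyA h
    · intro z hz
      rw [List.mem_cons, List.mem_cons] at hz
      rcases hz with rfl | rfl | hz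
      · exact Or.inr (Or.inl hxB)
      · exact Or.inl hyA
      · rcases hpm z hz with h | h | h
        · exact Or.inl (Finset.mem_of_mem_erase h)
        · exact Or.inr (Or.inl (Finset.mem_of_mem_erase h))
        · exact Or.inr (Or.inr h)

/-- A flexible piece of a cycle: between `inn` and `out` there are paths with `base + 2 * i`
vertices for all `i ≤ cap`, inside `dom`, avoiding any set that meets `dom` in at most `Q`
vertices. -/
structure PathNode {V : Type*} [DecidableEq V] (H : SimpleGraph V) (Q : ℕ) where
  inn : V
  out : V
  base : ℕ
  cap : ℕ
  dom : Finset V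
  spec : ∀ i ≤ cap, ∀ F : Finset V, (F ∩ dom).card ≤ Q → ∃ c : List V, c.length = base + 2 * i ∧
    c.IsChain H.Adj ∧ c.Nodup ∧ c.head? = some inn ∧ c.getLast? = some out ∧
    ∀ x ∈ c, x = inn ∨ x = out ∨ (x ∈ dom ∧ x ∉ F)

/-- The node consisting of a single vertex. -/
def PathNode.single {V : Type*} [DecidableEq V] (H : SimpleGraph V) (Q : ℕ) (v : V) :
    PathNode H Q where
  inn := v
  out := v
  base := 1
  cap := 0
  dom := ∅
  spec := by
    intro i hi F _
    obtain rfl : i = 0 := by omega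
    exact ⟨[v], by simp⟩

/-- The node consisting of a single edge. -/
def PathNode.edge {V : Type*} [DecidableEq V] (H : SimpleGraph V) (Q : ℕ) {v w : V}
    (h : H.Adj v w) : PathNode H Q where
  inn := v
  out := w
  base := 2
  cap := 0
  dom := ∅
  spec := by
    intro i hi F _
    obtain rfl : i = 0 := by omega
    exact ⟨[v, w], by simp [h, h.ne]⟩

/-- The node given by a robust pair. -/
theorem IsRobustPair.exists_pathNode {V : Type*} [DecidableEq V] {H : SimpleGraph V}
    {A B : Finset V} {γ g h Q : ℕ} (hH : IsRobustPair H A B γ g) (hAB : Disjoint A B)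
    (hA : A.card = h) (hB : B.card = h) (hγ : γ ≤ g) (hg : 4 * g ≤ h) (hQ : Q + 2 ≤ γ)
    (W : Finset V) (hW : W.card ≤ Q) :
    ∃ n : PathNode H Q, n.inn ∈ A ∧ n.out ∈ B ∧ n.inn ∉ W ∧ n.out ∉ W ∧ n.base = 4 ∧
      n.cap = h - 3 * g ∧ n.dom = A ∪ B := by
  have hWA : A.card - W.card ≤ (A \ W).card := Finset.le_card_sdiff _ _
  have hWB : B.card - W.card ≤ (B \ W).card := Finset.le_card_sdiff _ _
  obtain ⟨a, ha, Ta, hTa, hTac, hTaa⟩ := hH.left (A \ W) Finset.sdiff_subset B subset_rfl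
    (by omega) (by omega)
  obtain ⟨b, hb, Tb, hTb, hTbc, hTbb⟩ := hH.right A subset_rfl (B \ W) Finset.sdiff_subset
    (by omega) (by omega)
  rw [Finset.mem_sdiff] at ha hb
  refine ⟨⟨a, b, 4, h - 3 * g, A ∪ B, ?_⟩, ha.1, hb.1, ha.2, hb.2, rfl, rfl, rfl⟩
  intro i hi F hF
  -- The ends were chosen before `F` is known. At most `γ` of the `3γ` reserved neighbours of each
  -- end are forbidden, so `γ` can be set aside for the last step; `A` still keeps `h - 2γ ≥ g + i`
  -- vertices.
  set F' := (F ∩ (A ∪ B)) ∪ {a, b} with hF'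
  have hF'c : F'.card ≤ γ := by
    have h1 := Finset.card_union_le (F ∩ (A ∪ B)) {a, b}
    have h2 := Finset.card_le_two (a := a) (b := b)
    rw [← hF'] at h1
    omega
  have h1 : Tb.card - F'.card ≤ (Tb \ F').card := Finset.le_card_sdiff _ _
  obtain ⟨Nb, hNb, hNbc⟩ := Finset.exists_subset_card_eq (show γ ≤ (Tb \ F').card by omega)
  have h2 : Ta.card - F'.card ≤ (Ta \ F').card := Finset.le_card_sdiff _ _
  have h3 : B.card - F'.card ≤ (B \ F').card := Finset.le_card_sdiff _ _
  have h4 : A.card - (F' ∪ Nb).card ≤ (A \ (F' ∪ Nb)).card := Finset.le_card_sdiff _ _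
  have h5 := Finset.card_union_le F' Nb
  obtain ⟨p, hp, hpc, hpn, hpm⟩ := hH.exists_path_aux hAB (b := b) (Nb := Nb)
    ((hNb.trans Finset.sdiff_subset).trans hTb) hNbc.ge
    (fun y hy => hTbb y (Finset.mem_sdiff.1 (hNb hy)).1) i (A \ (F' ∪ Nb)) (B \ F') (Ta \ F') a
    Finset.sdiff_subset Finset.sdiff_subset
    (Finset.disjoint_of_subset_right Finset.subset_union_right Finset.sdiff_disjoint)
    (by omega) (by omega) (Finset.sdiff_subset_sdiff hTa subset_rfl) (by omega)
    (fun x hx => hTaa x (Finset.mem_sdiff.1 hx).1)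
  have hpF : ∀ x ∈ p, x ∈ A ∪ B ∧ x ∉ F' := by
    intro x hx
    rcases hpm x hx with h | h | h
    · rw [Finset.mem_sdiff, Finset.mem_union, not_or] at h
      exact ⟨Finset.mem_union_left _ h.1, h.2.1⟩
    · rw [Finset.mem_sdiff] at h
      exact ⟨Finset.mem_union_right _ h.1, h.2⟩
    · have := Finset.mem_sdiff.1 (hNb h)
      exact ⟨Finset.mem_union_left _ (hTb this.1), this.2⟩
  have hab : a ≠ b := fun h => Finset.disjoint_left.1 hAB ha.1 (h ▸ hb.1)
  have hap : a ∉ p := fun h => (hpF a h).2 (by simp [hF'])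
  have hbp : b ∉ p := fun h => (hpF b h).2 (by simp [hF'])
  refine ⟨a :: (p ++ [b]), by simp [hp]; ring, hpc, ?_, by simp,
    by rw [← List.cons_append]; exact List.getLast?_concat, ?_⟩
  · simp only [List.nodup_cons, List.mem_append, List.mem_singleton, not_or, List.nodup_append]
    refine ⟨⟨hap, hab⟩, hpn, by simp, ?_⟩
    rintro x hx y rfl rfl
    exact hbp hx
  · intro x hx
    simp only [List.mem_cons, List.mem_append, List.not_mem_nil, or_false] at hx
    rcases hx with rfl | hx | rfl
    · exact Or.inl rfl
    · refine Or.inr (Or.inr ⟨(hpF x hx).1, fun h => (hpF x hx).2 ?_⟩)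
      exact Finset.mem_union_left _ (Finset.mem_inter.2 ⟨h, (hpF x hx).1⟩)
    · exact Or.inr (Or.inl rfl)

/-- A cyclic list of distinct vertices with consecutive ones adjacent gives a cycle. -/
theorem hasCycleThrough_of_list {V : Type*} {H : SimpleGraph V} (l : List V) (hl : 3 ≤ l.length)
    (hn : l.Nodup) (hc : l.IsChain H.Adj)
    (hlast : ∀ x ∈ l.getLast?, ∀ y ∈ l.head?, H.Adj x y) {v : V} (hv : v ∈ l) :
    HasCycleThrough H l.length v := by
  have hne : l ≠ [] := by rintro rfl; simp at hl
  have hadj : H.Adj (l.getLast hne) (l.head hne) :=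
    hlast _ (List.getLast_mem_getLast? hne) _ (List.head_mem_head? hne)
  let p := SimpleGraph.Walk.ofSupport l hne hc
  have hps : p.support = l := SimpleGraph.Walk.support_ofSupport hne hc
  have hpl : p.length + 1 = l.length := by
    have := p.length_support
    rw [hps] at this
    exact this.symm
  refine ⟨_, SimpleGraph.Walk.cons hadj p, ?_, ?_, ?_⟩
  · rw [SimpleGraph.Walk.isCycle_iff_isPath_tail_and_le_length]
    refine ⟨?_, ?_⟩
    · refine SimpleGraph.Walk.IsPath.mk' ?_
      rw [SimpleGraph.Walk.support_tail_of_not_nil _ SimpleGraph.Walk.not_nil_cons,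
        SimpleGraph.Walk.support_cons, List.tail_cons, hps]
      exact hn
    · rw [SimpleGraph.Walk.length_cons, hpl]; exact hl
  · rw [SimpleGraph.Walk.length_cons, hpl]
  · rw [SimpleGraph.Walk.support_cons, hps]
    exact List.mem_cons_of_mem _ hv

/-- Greedy choice of pairwise disjoint lists when each list conflicts with few others. -/
theorem exists_disjoint_choice {ι V : Type*} [Fintype ι] [DecidableEq ι] [DecidableEq V]
    (Good : ι → List V → Prop) (conf : ι → ι → Prop) [DecidableRel conf] (W : ι → Finset V)
    {m w q : ℕ} (hlen : ∀ i p, Good i p → p.length ≤ m)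
    (hex : ∀ i, ∀ U : Finset V, U.card ≤ q * m + w → ∃ p, Good i p ∧ ∀ x ∈ p, x ∉ U)
    (hconf : ∀ i j p p' x, Good i p → Good j p' → x ∈ p → x ∈ p' → conf i j)
    (hq : ∀ i, (Finset.univ.filter (conf i)).card ≤ q) (hW : ∀ i, (W i).card ≤ w) :
    ∃ p : ι → List V, (∀ i, Good i (p i)) ∧ (∀ i, ∀ x ∈ p i, x ∉ W i) ∧
      ∀ i j, i ≠ j → ∀ x ∈ p i, x ∉ p j := by
  suffices h : ∀ s : Finset ι, ∃ p : ι → List V, (∀ i ∈ s, Good i (p i)) ∧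
      (∀ i ∈ s, ∀ x ∈ p i, x ∉ W i) ∧
      ∀ i ∈ s, ∀ j ∈ s, i ≠ j → ∀ x ∈ p i, x ∉ p j by
    obtain ⟨p, h1, h2, h3⟩ := h Finset.univ
    exact ⟨p, fun i => h1 i (Finset.mem_univ _), fun i => h2 i (Finset.mem_univ _),
      fun i j => h3 i (Finset.mem_univ _) j (Finset.mem_univ _)⟩
  intro s
  induction s using Finset.induction_on with
  | empty => exact ⟨fun _ => [], by simp⟩
  | insert i s hi ih =>
    obtain ⟨p, h1, h2, h3⟩ := ih
    -- Only conflicting lists have to be avoided, which keeps the forbidden set bounded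
    -- independently of `s`; any other list is disjoint automatically.
    let U := ((s.filter (conf i)).biUnion fun j => (p j).toFinset) ∪ W i
    have hU : U.card ≤ q * m + w := by
      refine (Finset.card_union_le _ _).trans (Nat.add_le_add ?_ (hW i))
      refine (Finset.card_biUnion_le_card_mul _ _ m ?_).trans (Nat.mul_le_mul_right _ ?_)
      · intro j hj
        exact (List.toFinset_card_le _).trans (hlen j _ (h1 j (Finset.mem_filter.1 hj).1))
      · refine (Finset.card_le_card ?_).trans (hq i)
        intro j hj
        simpa using (Finset.mem_filter.1 hj).2
    obtain ⟨r, hr, hrU⟩ := hex i U hU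
    have hnew : ∀ j ∈ s, ∀ x ∈ r, x ∉ p j := by
      intro j hj x hx hxj
      refine hrU x hx (Finset.mem_union_left _ (Finset.mem_biUnion.2 ⟨j, ?_, by simpa using hxj⟩))
      exact Finset.mem_filter.2 ⟨hj, hconf i j r (p j) x hr (h1 j hj) hx hxj⟩
    have hne : ∀ j ∈ s, j ≠ i := fun j hj h => hi (h ▸ hj)
    refine ⟨Function.update p i r, ?_, ?_, ?_⟩
    · intro j hj
      rcases Finset.mem_insert.1 hj with rfl | hj
      · simpa using hr
      · simpa [hne j hj] using h1 j hj
    · intro j hj x hx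
      rcases Finset.mem_insert.1 hj with rfl | hj
      · rw [Function.update_self] at hx
        exact fun h => hrU x hx (Finset.mem_union_right _ h)
      · rw [Function.update_of_ne (hne j hj)] at hx
        exact h2 j hj x hx
    · intro j hj k hk hjk x hx
      rcases Finset.mem_insert.1 hj with hj' | hj' <;>
        rcases Finset.mem_insert.1 hk with hk' | hk'
      · exact absurd (hj'.trans hk'.symm) hjk
      · subst hj'
        rw [Function.update_self] at hx
        rw [Function.update_of_ne (hne k hk')]
        exact hnew k hk' x hx
      · subst hk'
        rw [Function.update_of_ne (hne j hj')] at hx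
        rw [Function.update_self]
        exact fun h => hnew j hj' x h hx
      · rw [Function.update_of_ne (hne j hj')] at hx
        rw [Function.update_of_ne (hne k hk')]
        exact h3 j hj' k hk' hjk x hx

end Paths

/-! ### Assembling nodes and links into a cycle. -/

section Assembly

/-- Cyclically ordered nodes whose consecutive ends can be linked by paths with `m` inner vertices,
avoiding any small set, can be assembled to a cycle, provided each node conflicts with at most `q`
others. -/
theorem hasCycleThrough_of_nodes {V ι : Type*} [DecidableEq V] {H : SimpleGraph V}
    {Q m q T : ℕ} [NeZero T] (bx : V → ι) (near : ι → ι → Prop) (hrefl : ∀ b, near b b)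
    (node : Fin T → PathNode H Q) (home : Fin T → ι) (hm : 3 ≤ m)
    (hQ : q * (m + 2) ≤ Q)
    (hlink : ∀ t, ∀ U : Finset V, U.card ≤ q * m + q * 2 → ∃ p : List V, p.length = m ∧
      ((node t).out :: (p ++ [(node (t + 1)).inn])).IsChain H.Adj ∧ p.Nodup ∧
      ∀ x ∈ p, x ∉ U ∧ near (home t) (bx x))
    (hq : ∀ t, {t' | ∃ b, near (home t) b ∧ near (home t') b}.ncard ≤ q)
    (hinn : ∀ t, near (home t) (bx (node t).inn)) (hout : ∀ t, near (home t) (bx (node t).out))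
    (hdom : ∀ t, ∀ x ∈ (node t).dom, bx x = home t)
    (hwp : ∀ t t', t ≠ t' → Disjoint ({(node t).inn, (node t).out} : Finset V)
      {(node t').inn, (node t').out})
    (hdd : ∀ t t', t ≠ t' → Disjoint (node t).dom (node t').dom)
    (s : Fin T → ℕ) (hs : ∀ t, s t ≤ (node t).cap) (t₀ : Fin T) :
    HasCycleThrough H (∑ t, ((node t).base + 2 * s t + m)) (node t₀).inn := by
  classical
  let wp : Fin T → Finset V := fun t => {(node t).inn, (node t).out}
  have hwpc : ∀ t, (wp t).card ≤ 2 := fun t => Finset.card_le_two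
  have hwpn : ∀ t, ∀ x ∈ wp t, near (home t) (bx x) := by
    intro t x hx
    simp only [wp, Finset.mem_insert, Finset.mem_singleton] at hx
    rcases hx with rfl | rfl
    exacts [hinn t, hout t]
  let conf : Fin T → Fin T → Prop := fun t t' => ∃ b, near (home t) b ∧ near (home t') b
  have hq' : ∀ t, (Finset.univ.filter (conf t)).card ≤ q := by
    intro t
    rw [← Set.ncard_coe_finset]
    simpa [conf] using hq t
  -- The links are fixed before the interiors of the nodes: they need to avoid only each other and
  -- the node ends, and the flexible nodes then avoid them.
  obtain ⟨J, hJ, hJW, hJd⟩ := exists_disjoint_choice (ι := Fin T) (V := V)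
    (fun t p => p.length = m ∧
      ((node t).out :: (p ++ [(node (t + 1)).inn])).IsChain H.Adj ∧ p.Nodup ∧
      ∀ x ∈ p, near (home t) (bx x)) conf
    (fun t => (Finset.univ.filter (conf t)).biUnion wp) (m := m) (w := q * 2) (q := q)
    (fun t p hp => hp.1.le)
    (fun t U hU => by
      obtain ⟨p, h1, h2, h3, h4⟩ := hlink t U hU
      exact ⟨p, ⟨h1, h2, h3, fun x hx => (h4 x hx).2⟩, fun x hx => (h4 x hx).1⟩)
    (fun t t' p p' x hp hp' hx hx' => ⟨bx x, hp.2.2.2 x hx, hp'.2.2.2 x hx'⟩) hq'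
    (fun t => (Finset.card_biUnion_le_card_mul _ _ 2 fun t' _ => hwpc t').trans
      (Nat.mul_le_mul_right _ (hq' t)))
  have hJwp : ∀ t t', ∀ x ∈ J t, x ∉ wp t' := by
    intro t t' x hx hx'
    refine hJW t x hx (Finset.mem_biUnion.2 ⟨t', ?_, hx'⟩)
    exact Finset.mem_filter.2 ⟨Finset.mem_univ _, bx x, (hJ t).2.2.2 x hx, hwpn t' x hx'⟩
  let F : Finset V := Finset.univ.biUnion fun t => (J t).toFinset ∪ wp t
  -- Only links and ends whose home conflicts with that of `t` can reach its domain: at most `q` of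
  -- them, with at most `m + 2` vertices each.
  have hF : ∀ t, (F ∩ (node t).dom).card ≤ Q := by
    intro t
    refine le_trans ?_ hQ
    have hsub : F ∩ (node t).dom ⊆
        (Finset.univ.filter (conf t)).biUnion fun t' => (J t').toFinset ∪ wp t' := by
      intro x hx
      obtain ⟨hxF, hxd⟩ := Finset.mem_inter.1 hx
      obtain ⟨t', -, hx'⟩ := Finset.mem_biUnion.1 hxF
      refine Finset.mem_biUnion.2 ⟨t', Finset.mem_filter.2 ⟨Finset.mem_univ _, home t,
        hrefl _, ?_⟩, hx'⟩
      rw [← hdom t x hxd]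
      rcases Finset.mem_union.1 hx' with h | h
      · exact (hJ t').2.2.2 x (List.mem_toFinset.1 h)
      · exact hwpn t' x h
    refine (Finset.card_le_card hsub).trans ?_
    refine (Finset.card_biUnion_le_card_mul _ _ (m + 2) fun t' _ => ?_).trans
      (Nat.mul_le_mul_right _ (hq' t))
    refine (Finset.card_union_le _ _).trans (Nat.add_le_add ?_ (hwpc t'))
    exact (List.toFinset_card_le _).trans (hJ t').1.le
  choose c hcl hcc hcn hch hcg hcm using fun t => (node t).spec (s t) (hs t) F (hF t)
  have hcm' : ∀ t, ∀ x ∈ c t, x ∈ wp t ∨ (x ∈ (node t).dom ∧ x ∉ F) := by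
    intro t x hx
    rcases hcm t x hx with h | h | h
    · exact Or.inl (by simp [wp, h])
    · exact Or.inl (by simp [wp, h])
    · exact Or.inr h
  have hJF : ∀ t, ∀ x ∈ J t, x ∈ F := fun t x hx =>
    Finset.mem_biUnion.2 ⟨t, Finset.mem_univ _, Finset.mem_union_left _ (List.mem_toFinset.2 hx)⟩
  have hwF : ∀ t, ∀ x ∈ wp t, x ∈ F := fun t x hx =>
    Finset.mem_biUnion.2 ⟨t, Finset.mem_univ _, Finset.mem_union_right _ hx⟩
  have hcJ : ∀ t t', ∀ x ∈ c t, x ∉ J t' := by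
    intro t t' x hx hx'
    rcases hcm' t x hx with h | h
    · exact hJwp t' t x hx' h
    · exact h.2 (hJF t' x hx')
  have hcc' : ∀ t t', t ≠ t' → ∀ x ∈ c t, x ∉ c t' := by
    intro t t' htt x hx hx'
    rcases hcm' t x hx with h | h <;> rcases hcm' t' x hx' with h' | h'
    · exact Finset.disjoint_left.1 (hwp t t' htt) h h'
    · exact h'.2 (hwF t x h)
    · exact h.2 (hwF t' x h')
    · exact Finset.disjoint_left.1 (hdd t t' htt) h.1 h'.1
  let f : Fin T → List V := fun t => c t ++ J t
  have hJne : ∀ t, J t ≠ [] := fun t h => by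
    have := (hJ t).1
    rw [h] at this
    simp at this
    omega
  have hcne : ∀ t, c t ≠ [] := fun t h => by
    have := hch t
    simp [h] at this
  have hfhead : ∀ t, (f t).head? = some (node t).inn := fun t => by
    simp only [f]
    rw [List.head?_append_of_ne_nil _ (hcne t), hch]
  have hflast : ∀ t, ∀ x ∈ (f t).getLast?, H.Adj x (node (t + 1)).inn := by
    intro t x hx
    simp only [f] at hx
    rw [List.getLast?_append_of_ne_nil _ (hJne t)] at hx
    have h1 := (hJ t).2.1
    rw [← List.cons_append, List.isChain_append] at h1
    refine h1.2.2 x ?_ _ (by simp)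
    rw [List.getLast?_cons]
    rw [Option.mem_def] at hx
    simp [hx]
  have hfchain : ∀ t, (f t).IsChain H.Adj := by
    intro t
    have h1 := (hJ t).2.1
    rw [← List.cons_append, List.isChain_append] at h1
    have h2 : ((node t).out :: J t).IsChain H.Adj := h1.1
    rw [List.isChain_append]
    refine ⟨hcc t, h2.tail, ?_⟩
    intro x hx y hy
    rw [hcg t] at hx
    obtain rfl : (node t).out = x := by simpa using hx
    rw [List.isChain_cons] at h2
    exact h2.1 y hy
  have hnil : [] ∉ List.ofFn f := by
    intro h
    obtain ⟨t, ht⟩ := (List.mem_ofFn' f _).1 h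
    exact hcne t (List.append_eq_nil_iff.1 ht).1
  set l := (List.ofFn f).flatten with hl
  have hlen : l.length = ∑ t, ((node t).base + 2 * s t + m) := by
    rw [hl, List.length_flatten, List.map_ofFn, List.sum_ofFn]
    refine Finset.sum_congr rfl fun t _ => ?_
    simp [f, hcl, (hJ t).1]
  have hTpos : 0 < T := Nat.pos_of_ne_zero (NeZero.ne T)
  have hmem : (node t₀).inn ∈ l := by
    rw [hl, List.mem_flatten]
    refine ⟨f t₀, (List.mem_ofFn' f _).2 ⟨t₀, rfl⟩, List.mem_of_mem_head? (hfhead t₀)⟩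
  rw [← hlen]
  refine hasCycleThrough_of_list l ?_ ?_ ?_ ?_ hmem
  · rw [hlen]
    calc 3 ≤ m := hm
      _ ≤ (node t₀).base + 2 * s t₀ + m := by omega
      _ ≤ _ := Finset.single_le_sum (f := fun t => (node t).base + 2 * s t + m)
        (fun _ _ => Nat.zero_le _) (Finset.mem_univ t₀)
  · rw [hl, List.nodup_flatten]
    refine ⟨?_, ?_⟩
    · intro r hr
      obtain ⟨t, rfl⟩ := (List.mem_ofFn' f _).1 hr
      rw [List.nodup_append']
      exact ⟨hcn t, (hJ t).2.2.1, fun x hx hx' => hcJ t t x hx hx'⟩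
    · rw [List.pairwise_ofFn]
      intro t t' htt x hx hx'
      rcases List.mem_append.1 hx with h | h <;> rcases List.mem_append.1 hx' with h' | h'
      · exact hcc' t t' htt.ne x h h'
      · exact hcJ t t' x h h'
      · exact hcJ t' t x h' h
      · exact hJd t t' htt.ne x h h'
  · rw [hl, List.isChain_flatten hnil]
    refine ⟨?_, ?_⟩
    · intro r hr
      obtain ⟨t, rfl⟩ := (List.mem_ofFn' f _).1 hr
      exact hfchain t
    · rw [List.isChain_ofFn]
      intro i hi x hx y hy
      rw [hfhead] at hy
      obtain rfl : (node ⟨i + 1, hi⟩).inn = y := by simpa using hy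
      have := hflast _ x hx
      convert this using 3
      apply Fin.ext
      rw [Fin.val_add]
      simp only [Fin.val_one']
      rw [Nat.add_mod_mod, Nat.mod_eq_of_lt hi]
  · intro x hx y hy
    obtain ⟨k, rfl⟩ : ∃ k, T = k + 1 := ⟨T - 1, by omega⟩
    have hfne : ∀ t, f t ≠ [] := fun t h => hcne t (List.append_eq_nil_iff.1 h).1
    rw [hl, List.ofFn_succ, List.flatten_cons, List.head?_append_of_ne_nil _ (hfne _),
      hfhead] at hy
    rw [hl, List.ofFn_succ', List.concat_eq_append, List.flatten_append, List.flatten_singleton,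
      List.getLast?_append_of_ne_nil _ (hfne _)] at hx
    obtain rfl : (node 0).inn = y := by simpa using hy
    have := hflast _ x hx
    convert this using 3
    apply Fin.ext
    simp

end Assembly

/-! ### Grid boxes and the cyclic order of the nodes. -/

section Boxes

/-- Two points of the integer grid are at `ℓ∞`-distance at most `k`. -/
def GridNear {d : ℕ} (k : ℕ) (b b' : Fin d → ℕ) : Prop :=
  ∀ i, b i ≤ b' i + k ∧ b' i ≤ b i + k

theorem GridNear.refl {d k : ℕ} (b : Fin d → ℕ) : GridNear k b b := fun _ => ⟨by omega, by omega⟩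

theorem GridNear.symm {d k : ℕ} {b b' : Fin d → ℕ} (h : GridNear k b b') : GridNear k b' b :=
  fun i => ⟨(h i).2, (h i).1⟩

theorem GridNear.trans {d k l : ℕ} {b b' b'' : Fin d → ℕ} (h : GridNear k b b')
    (h' : GridNear l b' b'') : GridNear (k + l) b b'' := fun i => by
  have h1 := h i
  have h2 := h' i
  omega

theorem GridNear.mono {d k l : ℕ} {b b' : Fin d → ℕ} (h : GridNear k b b') (hkl : k ≤ l) :
    GridNear l b b' := fun i => by
  have h1 := h i
  omega

/-- The grid ball as a finite set. -/
def gridBall {d : ℕ} (k : ℕ) (b : Fin d → ℕ) : Finset (Fin d → ℕ) :=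
  Fintype.piFinset fun i => Finset.Icc (b i - k) (b i + k)

theorem mem_gridBall {d k : ℕ} {b b' : Fin d → ℕ} (h : GridNear k b b') : b' ∈ gridBall k b := by
  rw [gridBall, Fintype.mem_piFinset]
  intro i
  have := h i
  rw [Finset.mem_Icc]
  omega

theorem card_gridBall_le {d k : ℕ} (b : Fin d → ℕ) : (gridBall k b).card ≤ (2 * k + 1) ^ d := by
  rw [gridBall, Fintype.card_piFinset]
  refine (Finset.prod_le_pow_card _ _ (2 * k + 1) fun i _ => ?_).trans_eq (by simp)
  rw [Nat.card_Icc]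
  omega

/-- Serves to distribute the missing length over the slots. -/
theorem exists_sum_eq_of_le_sum {ι : Type*} [Fintype ι] [DecidableEq ι] (cap : ι → ℕ) (S : ℕ)
    (hS : S ≤ ∑ t, cap t) : ∃ s : ι → ℕ, (∀ t, s t ≤ cap t) ∧ ∑ t, s t = S := by
  induction S with
  | zero => exact ⟨fun _ => 0, by simp⟩
  | succ S ih =>
    obtain ⟨s, hs, hsum⟩ := ih (by omega)
    obtain ⟨t, -, ht⟩ : ∃ t ∈ Finset.univ, s t < cap t :=
      Finset.exists_lt_of_sum_lt (by omega)
    refine ⟨Function.update s t (s t + 1), fun t' => ?_, ?_⟩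
    · by_cases h : t' = t
      · subst h; simpa using ht
      · simpa [h] using hs t'
    · rw [Finset.sum_update_of_mem (Finset.mem_univ t), ← hsum,
        ← Finset.add_sum_erase _ _ (Finset.mem_univ t), Finset.sdiff_singleton_eq_erase]
      ring

/-- Consecutive entries of a cyclic list, indexed cyclically. -/
theorem rel_getElem_add_one {α : Type*} {S : α → α → Prop} {l : List α} [NeZero l.length]
    (h : l.IsChain S) (hlast : ∀ x ∈ l.getLast?, ∀ y ∈ l.head?, S x y) (t : Fin l.length) :
    S (l.get t) (l.get (t + 1)) := by
  have hpos : 0 < l.length := t.pos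
  by_cases ht : t.1 + 1 < l.length
  · have h1 := List.isChain_iff_getElem.1 h t.1 ht
    have h2 : t + 1 = ⟨t.1 + 1, ht⟩ := by
      apply Fin.ext
      rw [Fin.val_add]
      simp only [Fin.val_one']
      rw [Nat.add_mod_mod, Nat.mod_eq_of_lt ht]
    rw [h2]
    exact h1
  · have h2 : t + 1 = ⟨0, hpos⟩ := by
      apply Fin.ext
      rw [Fin.val_add]
      simp only [Fin.val_one']
      have : t.1 + 1 = l.length := by omega
      rw [Nat.add_mod_mod, this, Nat.mod_self]
    rw [h2]
    apply hlast
    · rw [List.getLast?_eq_getElem?]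
      have : l.length - 1 = t.1 := by omega
      simp [this]
    · rw [List.head?_eq_getElem?]
      simp [hpos]

/-- The cyclic order of nodes: the slots `(b, j)`, `j < k b`, of the boxes `b` in order, then one
return node `(b, K)` for each box in reverse order. -/
def nodeKeys {β : Type*} (bs : List β) (k : β → ℕ) (K : ℕ) : List (β × ℕ) :=
  (bs.flatMap fun b => (List.range (k b)).map fun j => (b, j)) ++ bs.reverse.map fun b => (b, K)

theorem mem_nodeKeys {β : Type*} {bs : List β} {k : β → ℕ} {K : ℕ} {x : β × ℕ} :
    x ∈ nodeKeys bs k K ↔ x.1 ∈ bs ∧ (x.2 < k x.1 ∨ x.2 = K) := by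
  obtain ⟨b, j⟩ := x
  simp only [nodeKeys, List.mem_append, List.mem_flatMap, List.mem_map, List.mem_range,
    Prod.mk.injEq, List.mem_reverse]
  constructor
  · rintro (⟨b', hb, j', hj, rfl, rfl⟩ | ⟨b', hb, rfl, rfl⟩)
    · exact ⟨hb, Or.inl hj⟩
    · exact ⟨hb, Or.inr rfl⟩
  · rintro ⟨hb, h | h⟩
    · exact Or.inl ⟨b, hb, j, h, rfl, rfl⟩
    · exact Or.inr ⟨b, hb, rfl, h.symm⟩

theorem nodup_nodeKeys {β : Type*} {bs : List β} {k : β → ℕ} {K : ℕ} (hbs : bs.Nodup)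
    (hk : ∀ b ∈ bs, k b ≤ K) : (nodeKeys bs k K).Nodup := by
  rw [nodeKeys, List.nodup_append']
  refine ⟨?_, ?_, ?_⟩
  · rw [List.nodup_flatMap]
    refine ⟨fun b _ => List.nodup_range.map fun j j' h => (Prod.mk.inj h).2, ?_⟩
    refine hbs.imp fun {b b'} hbb x hx hx' => ?_
    simp only [List.mem_map] at hx hx'
    obtain ⟨j, -, rfl⟩ := hx
    obtain ⟨j', -, h⟩ := hx'
    exact hbb (Prod.mk.inj h).1.symm
  · exact (List.nodup_reverse.2 hbs).map fun b b' h => (Prod.mk.inj h).1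
  · intro x hx hx'
    simp only [List.mem_flatMap, List.mem_map, List.mem_range] at hx hx'
    obtain ⟨b, hb, j, hj, rfl⟩ := hx
    obtain ⟨b', -, h⟩ := hx'
    have h1 := (Prod.mk.inj h).2
    have h2 := hk b hb
    omega

/-- Used twice, for total capacity and for total base length: slots of one box contribute equally,
return nodes are counted apart. -/
theorem sum_map_nodeKeys {β : Type*} (bs : List β) (k : β → ℕ) (K : ℕ) (f : β × ℕ → ℕ) (a : β → ℕ)
    (ha : ∀ b ∈ bs, ∀ j < k b, f (b, j) = a b) :
    ((nodeKeys bs k K).map f).sum =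
      (bs.map fun b => k b * a b).sum + (bs.map fun b => f (b, K)).sum := by
  rw [nodeKeys, List.map_append, List.sum_append, List.map_map, List.map_reverse,
    List.sum_reverse]
  congr 1
  rw [List.map_flatMap, List.flatMap_def, List.sum_flatten, List.map_map]
  refine congrArg List.sum (List.map_congr_left fun b hb => ?_)
  simp only [Function.comp_apply, List.map_map]
  rw [List.map_congr_left (f := f ∘ fun j => (b, j)) (g := fun _ => a b)
    (fun j hj => ha b hb j (List.mem_range.1 hj))]
  simp

/-- With slot numbers forgotten, the forward half of `nodeKeys` repeats each box. Positive
multiplicities ensure that no box is skipped, so consecutive entries are equal or consecutive in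
`bs`. -/
theorem flatMap_replicate_chain {β : Type*} {S : β → β → Prop} (hS : ∀ b, S b b) {k : β → ℕ} :
    ∀ bs : List β, bs.IsChain S → (∀ b ∈ bs, 0 < k b) →
      (bs.flatMap fun b => List.replicate (k b) b).IsChain S ∧
      (bs.flatMap fun b => List.replicate (k b) b).head? = bs.head? ∧
      (bs.flatMap fun b => List.replicate (k b) b).getLast? = bs.getLast?
  | [], _, _ => by simp
  | b :: bs, h, hk => by
    obtain ⟨h1, h2, h3⟩ := flatMap_replicate_chain hS bs h.tail fun b' hb' => hk b' (by simp [hb'])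
    have hkb : 0 < k b := hk b (by simp)
    have hrep : List.replicate (k b) b ≠ [] := by simpa using hkb.ne'
    have hhead : (List.replicate (k b) b).head? = some b := by
      rw [List.head?_replicate, if_neg hkb.ne']
    have hlast : (List.replicate (k b) b).getLast? = some b := by
      rw [List.getLast?_replicate, if_neg hkb.ne']
    rw [List.flatMap_cons]
    refine ⟨?_, ?_, ?_⟩
    · rw [List.isChain_append]
      refine ⟨List.isChain_replicate_of_rel _ (hS b), h1, ?_⟩
      intro x hx y hy
      rw [hlast] at hx
      rw [h2] at hy
      obtain rfl : b = x := by simpa using hx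
      exact (List.isChain_cons.1 h).1 y hy
    · rw [List.head?_append_of_ne_nil _ hrep, hhead, List.head?_cons]
    · cases bs with
      | nil => simpa using hlast
      | cons b' bs' =>
        have hne : ((b' :: bs').flatMap fun b => List.replicate (k b) b) ≠ [] := by
          intro h0
          rw [h0] at h2
          simp at h2
        rw [List.getLast?_append_of_ne_nil _ hne, h3, List.getLast?_cons_cons]

/-- Consecutive nodes lie in near boxes. -/
theorem isChain_nodeKeys {d : ℕ} {bs : List (Fin d → ℕ)} {k : (Fin d → ℕ) → ℕ} {K : ℕ}
    (hbs : bs.IsChain (GridNear 1)) (hk : ∀ b ∈ bs, 0 < k b) (hne : bs ≠ []) :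
    (nodeKeys bs k K).IsChain (fun x y => GridNear 1 x.1 y.1) ∧
      ∀ x ∈ (nodeKeys bs k K).getLast?, ∀ y ∈ (nodeKeys bs k K).head?, GridNear 1 x.1 y.1 := by
  obtain ⟨h1, h2, h3⟩ := flatMap_replicate_chain (S := GridNear 1) GridNear.refl bs hbs hk
  have hmap : (nodeKeys bs k K).map Prod.fst =
      (bs.flatMap fun b => List.replicate (k b) b) ++ bs.reverse := by
    rw [nodeKeys, List.map_append, List.map_map, List.map_flatMap]
    congr 1
    · refine congrArg (fun f => List.flatMap f bs) (funext fun b => ?_)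
      rw [List.map_map]
      exact List.map_const'.trans (by simp)
    · exact List.map_id _
  have hrev : bs.reverse.IsChain (GridNear 1) := by
    rw [List.isChain_reverse]
    exact hbs.imp fun _ _ h => h.symm
  have hfne : (bs.flatMap fun b => List.replicate (k b) b) ≠ [] := by
    intro h0
    rw [h0] at h2
    exact hne (List.head?_eq_none_iff.1 h2.symm)
  refine ⟨?_, ?_⟩
  · rw [← List.isChain_map (R := GridNear 1) Prod.fst, hmap, List.isChain_append]
    refine ⟨h1, hrev, ?_⟩
    intro x hx y hy
    rw [h3] at hx
    rw [List.head?_reverse] at hy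
    rw [Option.mem_unique hx hy]
    exact GridNear.refl _
  · intro x hx y hy
    have hx' : x.1 ∈ ((nodeKeys bs k K).map Prod.fst).getLast? := by
      rw [List.getLast?_map, Option.mem_def.1 hx]; rfl
    have hy' : y.1 ∈ ((nodeKeys bs k K).map Prod.fst).head? := by
      rw [List.head?_map, Option.mem_def.1 hy]; rfl
    rw [hmap, List.getLast?_append_of_ne_nil _ (by simpa using hne), List.getLast?_reverse] at hx'
    rw [hmap, List.head?_append_of_ne_nil _ hfne, h2] at hy'
    rw [Option.mem_unique hx' hy']
    exact GridNear.refl _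

end Boxes

/-! ### Cycles along a chain of boxes. -/

section BoxCycle

/-- **Assembly over boxes.** A chain of boxes, each providing slots, gives cycles through `v` of all
lengths in an interval. -/
theorem hasCycleThrough_of_boxes {V : Type*} [DecidableEq V] {H : SimpleGraph V} {d : ℕ}
    (bx : V → Fin d → ℕ) {Q m R K : ℕ} (hm : 3 ≤ m)
    (hQ : (4 * R + 5) ^ d * (K + 1) * (m + 2) ≤ Q)
    (hconn : ∀ x y, x ≠ y → GridNear 2 (bx x) (bx y) → ∀ U : Finset V, U.card ≤ Q →
      ∃ p : List V, p.length = m ∧ (x :: (p ++ [y])).IsChain H.Adj ∧ p.Nodup ∧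
        ∀ z ∈ p, z ∉ U ∧ GridNear R (bx x) (bx z))
    (bs : List (Fin d → ℕ)) (hbs : bs.Nodup) (hchain : bs.IsChain (GridNear 1))
    (v : V) (hv : bx v ∈ bs) (x' : V) (hx' : H.Adj v x') (hvx' : GridNear 1 (bx v) (bx x'))
    (k cap : (Fin d → ℕ) → ℕ) (hk0 : ∀ b ∈ bs, 0 < k b) (hkK : ∀ b ∈ bs, k b ≤ K)
    (hslots : ∀ b ∈ bs, ∀ W : Finset V, W.card ≤ 3 → ∃ n : ℕ → PathNode H Q, ∀ j < k b,
      (n j).inn ∉ W ∧ (n j).out ∉ W ∧ (n j).inn ∈ (n j).dom ∧ (n j).out ∈ (n j).dom ∧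
      (n j).base = 4 ∧ (n j).cap = cap b ∧ (∀ x ∈ (n j).dom, bx x = b) ∧
      ∀ j' < k b, j ≠ j' → Disjoint (n j).dom (n j').dom)
    (hret : ∀ b ∈ bs, ∃ u, bx u = b ∧ u ≠ x') (L : ℕ)
    (hL : (m + 4) * (bs.map k).sum + (m + 1) * bs.length + 1 ≤ L)
    (hL' : L ≤ (m + 4) * (bs.map k).sum + (m + 1) * bs.length +
      2 * (bs.map fun b => k b * cap b).sum) :
    HasCycleThrough H L v := by
  classical
  -- In the box of `v` the return vertex is `v` itself, which forces the cycle through `v`. No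
  -- return vertex equals `x'`, as `x'` may be needed for parity.
  have hret' : ∀ b, ∃ u, b ∈ bs → bx u = b ∧ u ≠ x' ∧ (b = bx v → u = v) := by
    intro b
    by_cases hb : b ∈ bs
    · by_cases hbv : b = bx v
      · exact ⟨v, fun _ => ⟨hbv.symm, hx'.ne, fun _ => rfl⟩⟩
      · obtain ⟨u, h1, h2⟩ := hret b hb
        exact ⟨u, fun _ => ⟨h1, h2, fun h => absurd h hbv⟩⟩
    · exact ⟨v, fun h => absurd h hb⟩
  choose u hu using hret'
  have hslots' : ∀ b, ∃ n : ℕ → PathNode H Q, b ∈ bs → ∀ j < k b,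
      (n j).inn ∉ ({v, x', u b} : Finset V) ∧ (n j).out ∉ ({v, x', u b} : Finset V) ∧
      (n j).inn ∈ (n j).dom ∧ (n j).out ∈ (n j).dom ∧
      (n j).base = 4 ∧ (n j).cap = cap b ∧ (∀ x ∈ (n j).dom, bx x = b) ∧
      ∀ j' < k b, j ≠ j' → Disjoint (n j).dom (n j').dom := by
    intro b
    by_cases hb : b ∈ bs
    · obtain ⟨n, hn⟩ := hslots b hb {v, x', u b} Finset.card_le_three
      exact ⟨n, fun _ => hn⟩
    · exact ⟨fun _ => PathNode.single H Q v, fun h => absurd h hb⟩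
  choose n hn using hslots'
  set B₀ := (m + 4) * (bs.map k).sum + (m + 1) * bs.length with hB₀
  -- Slots change the length by even amounts only. The node at `v` is the single vertex or the edge
  -- to `x'`, according to the parity of `L - B₀`.
  obtain ⟨vn, bit, S, hvi, hvo, hvb, hvc, hvd, hLS⟩ : ∃ (vn : PathNode H Q) (bit S : ℕ),
      vn.inn = v ∧ (vn.out = v ∨ vn.out = x') ∧ vn.base = 1 + bit ∧ vn.cap = 0 ∧ vn.dom = ∅ ∧
      L = B₀ + bit + 2 * S := by
    rcases Nat.even_or_odd (L - B₀) with ⟨S, hS⟩ | ⟨S, hS⟩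
    · exact ⟨PathNode.single H Q v, 0, S, rfl, Or.inl rfl, rfl, rfl, rfl, by omega⟩
    · exact ⟨PathNode.edge H Q hx', 1, S, rfl, Or.inr rfl, rfl, rfl, rfl, by omega⟩
  let ret : (Fin d → ℕ) → PathNode H Q := fun b =>
    if b = bx v then vn else PathNode.single H Q (u b)
  let nd : (Fin d → ℕ) × ℕ → PathNode H Q := fun x => if x.2 < k x.1 then n x.1 x.2 else ret x.1
  have hnd_slot : ∀ b j, j < k b → nd (b, j) = n b j := fun b j hj => if_pos hj
  have hnd_ret : ∀ b ∈ bs, nd (b, K) = ret b := fun b hb => if_neg (not_lt.2 (hkK b hb))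
  set keys := nodeKeys bs k K with hkeys
  have hbsne : bs ≠ [] := fun h => by simp [h] at hv
  have hknd : keys.Nodup := nodup_nodeKeys hbs hkK
  obtain ⟨hkchain, hklast⟩ := isChain_nodeKeys (K := K) hchain hk0 hbsne
  have hkeyv : (bx v, K) ∈ keys := mem_nodeKeys.2 ⟨hv, Or.inr rfl⟩
  have hkey0 : (bx v, 0) ∈ keys := mem_nodeKeys.2 ⟨hv, Or.inl (hk0 _ hv)⟩
  have hK0 : 0 < K := (hk0 _ hv).trans_le (hkK _ hv)
  -- Guarantees `t ≠ t + 1` cyclically, so that every link joins two distinct vertices.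
  have hT2 : 2 ≤ keys.length := by
    have h1 : ({(bx v, K), (bx v, 0)} : Finset ((Fin d → ℕ) × ℕ)) ⊆ keys.toFinset := by
      intro x hx
      rw [List.mem_toFinset]
      rcases Finset.mem_insert.1 hx with rfl | hx
      · exact hkeyv
      · rw [Finset.mem_singleton.1 hx]; exact hkey0
    have h2 := Finset.card_le_card h1
    rw [Finset.card_pair (by simpa using hK0.ne')] at h2
    exact h2.trans (List.toFinset_card_le _)
  have : NeZero keys.length := ⟨by omega⟩
  have hkey : ∀ t : Fin keys.length, (keys.get t).1 ∈ bs ∧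
      ((keys.get t).2 < k (keys.get t).1 ∨ (keys.get t).2 = K) := fun t =>
    mem_nodeKeys.1 (keys.get_mem t)
  -- the properties of a single node
  have hinn : ∀ x ∈ keys, bx (nd x).inn = x.1 := by
    rintro ⟨b, j⟩ hx
    obtain ⟨hb, hj | hj⟩ := mem_nodeKeys.1 hx
    · rw [hnd_slot b j hj]
      have := hn b hb j hj
      exact this.2.2.2.2.2.2.1 _ this.2.2.1
    · obtain rfl : j = K := hj
      rw [hnd_ret b hb]
      simp only [ret]
      split_ifs with h
      · rw [hvi, h]
      · exact (hu b hb).1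
  have hout : ∀ x ∈ keys, GridNear 1 x.1 (bx (nd x).out) := by
    rintro ⟨b, j⟩ hx
    obtain ⟨hb, hj | hj⟩ := mem_nodeKeys.1 hx
    · rw [hnd_slot b j hj]
      have := hn b hb j hj
      rw [this.2.2.2.2.2.2.1 _ this.2.2.2.1]
      exact GridNear.refl _
    · obtain rfl : j = K := hj
      rw [hnd_ret b hb]
      simp only [ret]
      split_ifs with h
      · rcases hvo with h' | h' <;> rw [h', h]
        · exact GridNear.refl _
        · exact hvx'
      · simp only [PathNode.single, (hu b hb).1]
        exact GridNear.refl _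
  have hdom : ∀ x ∈ keys, ∀ y ∈ (nd x).dom, bx y = x.1 := by
    rintro ⟨b, j⟩ hx
    obtain ⟨hb, hj | hj⟩ := mem_nodeKeys.1 hx
    · rw [hnd_slot b j hj]
      exact (hn b hb j hj).2.2.2.2.2.2.1
    · obtain rfl : j = K := hj
      rw [hnd_ret b hb]
      simp only [ret]
      split_ifs with h
      · simp [hvd]
      · simp [PathNode.single]
  have hdd : ∀ x ∈ keys, ∀ y ∈ keys, x ≠ y → Disjoint (nd x).dom (nd y).dom := by
    intro x hx y hy hxy
    by_cases hb : x.1 = y.1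
    · obtain ⟨b, j⟩ := x
      obtain ⟨b', j'⟩ := y
      obtain rfl : b = b' := hb
      have hjj : j ≠ j' := fun h => hxy (by rw [h])
      obtain ⟨hbm, hj | hj⟩ := mem_nodeKeys.1 hx
      · obtain ⟨-, hj' | hj'⟩ := mem_nodeKeys.1 hy
        · rw [hnd_slot b j hj, hnd_slot b j' hj']
          exact (hn b hbm j hj).2.2.2.2.2.2.2 j' hj' hjj
        · obtain rfl : j' = K := hj'
          rw [hnd_ret b hbm]
          simp only [ret]
          split_ifs <;> simp [hvd, PathNode.single]
      · obtain rfl : j = K := hj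
        rw [hnd_ret b hbm]
        simp only [ret]
        split_ifs <;> simp [hvd, PathNode.single]
    · rw [Finset.disjoint_left]
      intro z hz hz'
      exact hb ((hdom x hx z hz).symm.trans (hdom y hy z hz'))
  -- every end of a node is an inner vertex of a slot, `v`, `x'`, or a return vertex
  have hends_ret : ∀ b ∈ bs, ∀ z ∈ ({(ret b).inn, (ret b).out} : Finset V),
      z = u b ∨ (b = bx v ∧ z = x') := by
    intro b hb z hz
    simp only [ret] at hz
    split_ifs at hz with h
    · rw [(hu b hb).2.2 h]
      rw [hvi] at hz
      rcases Finset.mem_insert.1 hz with h' | h'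
      · exact Or.inl h'
      · rw [Finset.mem_singleton] at h'
        rcases hvo with h2 | h2 <;> rw [h2] at h'
        · exact Or.inl h'
        · exact Or.inr ⟨h, h'⟩
    · left
      simpa [PathNode.single] using hz
  have hends_slot : ∀ b ∈ bs, ∀ j < k b, ∀ z ∈ ({(n b j).inn, (n b j).out} : Finset V),
      z ∈ (n b j).dom ∧ z ∉ ({v, x', u b} : Finset V) ∧ bx z = b := by
    intro b hb j hj z hz
    have := hn b hb j hj
    rcases Finset.mem_insert.1 hz with rfl | h'
    · exact ⟨this.2.2.1, this.1, this.2.2.2.2.2.2.1 _ this.2.2.1⟩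
    · rw [Finset.mem_singleton] at h'
      subst h'
      exact ⟨this.2.2.2.1, this.2.1, this.2.2.2.2.2.2.1 _ this.2.2.2.1⟩
  have hslot_ret : ∀ b ∈ bs, ∀ j < k b, ∀ b' ∈ bs, ∀ z,
      z ∈ ({(n b j).inn, (n b j).out} : Finset V) →
      z ∉ ({(ret b').inn, (ret b').out} : Finset V) := by
    intro b hb j hj b' hb' z hz hz'
    obtain ⟨-, h2, h3⟩ := hends_slot b hb j hj z hz
    simp only [Finset.mem_insert, Finset.mem_singleton, not_or] at h2
    rcases hends_ret b' hb' z hz' with rfl | ⟨-, rfl⟩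
    · rw [(hu b' hb').1] at h3
      subst h3
      exact h2.2.2 rfl
    · exact h2.2.1 rfl
  have hwp : ∀ x ∈ keys, ∀ y ∈ keys, x ≠ y →
      Disjoint ({(nd x).inn, (nd x).out} : Finset V) {(nd y).inn, (nd y).out} := by
    rintro ⟨b, j⟩ hx ⟨b', j'⟩ hy hxy
    rw [Finset.disjoint_left]
    intro z hz hz'
    obtain ⟨hb, hj | hj⟩ := mem_nodeKeys.1 hx <;> obtain ⟨hb', hj' | hj'⟩ := mem_nodeKeys.1 hy
    · have hd := hdd _ hx _ hy hxy
      rw [hnd_slot b j hj] at hz hd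
      rw [hnd_slot b' j' hj'] at hz' hd
      exact Finset.disjoint_left.1 hd (hends_slot b hb j hj z hz).1
        (hends_slot b' hb' j' hj' z hz').1
    · obtain rfl : j' = K := hj'
      rw [hnd_slot b j hj] at hz
      rw [hnd_ret b' hb'] at hz'
      exact hslot_ret b hb j hj b' hb' z hz hz'
    · obtain rfl : j = K := hj
      rw [hnd_ret b hb] at hz
      rw [hnd_slot b' j' hj'] at hz'
      exact hslot_ret b' hb' j' hj' b hb z hz' hz
    · obtain rfl : j = K := hj
      obtain rfl : j' = j := hj'
      have hbb : b ≠ b' := fun h => hxy (by rw [h])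
      rw [hnd_ret b hb] at hz
      rw [hnd_ret b' hb'] at hz'
      rcases hends_ret b hb z hz with h | ⟨h, h1⟩ <;>
        rcases hends_ret b' hb' z hz' with h' | ⟨h', h1'⟩
      · exact hbb ((hu b hb).1.symm.trans (by rw [← h, h', (hu b' hb').1]))
      · exact (hu b hb).2.1 (h.symm.trans h1')
      · exact (hu b' hb').2.1 (h'.symm.trans h1)
      · exact hbb (h.trans h'.symm)
  have hcap_sum : ∑ t : Fin keys.length, (nd (keys.get t)).cap =
      (bs.map fun b => k b * cap b).sum := by
    have h1 := sum_map_nodeKeys bs k K (fun x => (nd x).cap) cap (fun b hb j hj => by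
      rw [hnd_slot b j hj]; exact (hn b hb j hj).2.2.2.2.2.1)
    have h2 : (bs.map fun b => (nd (b, K)).cap).sum = 0 := by
      rw [List.sum_eq_zero]
      intro x hx
      obtain ⟨b, hb, rfl⟩ := List.mem_map.1 hx
      rw [hnd_ret b hb]
      simp only [ret]
      split_ifs
      · exact hvc
      · rfl
    rw [h2, add_zero, ← hkeys, ← Fin.sum_univ_getElem] at h1
    rw [← h1]
    exact Fintype.sum_equiv (finCongr (by simp)) _ _ fun t => by simp
  have hbase_sum : ∑ t : Fin keys.length, ((nd (keys.get t)).base + m) = B₀ + bit := by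
    have h1 := sum_map_nodeKeys bs k K (fun x => (nd x).base + m) (fun _ => m + 4)
      (fun b hb j hj => by
        rw [hnd_slot b j hj, (hn b hb j hj).2.2.2.2.1]; ring)
    have h2 : (bs.map fun b => (nd (b, K)).base + m).sum = (m + 1) * bs.length + bit := by
      have h3 : (bs.map fun b => (nd (b, K)).base + m) =
          bs.map fun b => (m + 1) + if b = bx v then bit else 0 := by
        refine List.map_congr_left fun b hb => ?_
        rw [hnd_ret b hb]
        simp only [ret]
        split_ifs
        · rw [hvb]; ring
        · simp [PathNode.single]; ring
      rw [h3, List.sum_map_add]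
      congr 1
      · simp [mul_comm]
      · rw [← List.sum_toFinset _ hbs]
        simp [hv]
    rw [h2, ← hkeys, ← Fin.sum_univ_getElem, List.sum_map_mul_right] at h1
    have h4 : ∑ t : Fin keys.length, ((nd (keys.get t)).base + m) =
        (bs.map k).sum * (m + 4) + ((m + 1) * bs.length + bit) := by
      rw [← h1]
      exact Fintype.sum_equiv (finCongr (by simp)) _ _ fun t => by simp
    rw [h4, hB₀]
    ring
  obtain ⟨s, hs, hsS⟩ := exists_sum_eq_of_le_sum (fun t : Fin keys.length => (nd (keys.get t)).cap)
    S (by rw [hcap_sum]; omega)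
  obtain ⟨t₀, ht₀⟩ := List.get_of_mem hkeyv
  -- Conflicting nodes have home boxes at grid distance at most `2R + 2`, leaving `(4R + 5)^d`
  -- boxes, each with at most `K + 1` keys.
  have hmain := hasCycleThrough_of_nodes (q := (4 * R + 5) ^ d * (K + 1)) bx (GridNear (R + 1))
    GridNear.refl (fun t : Fin keys.length => nd (keys.get t)) (fun t => (keys.get t).1) hm hQ
    (by
      intro t U hU
      have h1 : GridNear 1 (keys.get t).1 (keys.get (t + 1)).1 :=
        rel_getElem_add_one (S := fun x y => GridNear 1 x.1 y.1) hkchain hklast t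
      have h2 := hout _ (keys.get_mem t)
      have h3 := hinn _ (keys.get_mem (t + 1))
      have hne : keys.get t ≠ keys.get (t + 1) := by
        intro h
        have := (List.Nodup.get_inj_iff hknd).1 h
        have h5 := congrArg Fin.val this
        rw [Fin.val_add, Fin.val_one', Nat.mod_eq_of_lt (by omega : 1 < keys.length)] at h5
        by_cases h6 : t.1 + 1 < keys.length
        · rw [Nat.mod_eq_of_lt h6] at h5; omega
        · have h7 : t.1 + 1 = keys.length := by have := t.2; omega
          rw [h7, Nat.mod_self] at h5; omega
      have h4 : (nd (keys.get t)).out ≠ (nd (keys.get (t + 1))).inn := by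
        intro h
        exact Finset.disjoint_left.1 (hwp _ (keys.get_mem t) _ (keys.get_mem (t + 1)) hne)
          (show (nd (keys.get t)).out ∈ _ by simp) (by rw [h]; simp)
      obtain ⟨p, hp1, hp2, hp3, hp4⟩ := hconn _ _ h4 (by
        rw [h3]
        exact h2.symm.trans h1) U (hU.trans (le_trans (by ring_nf; rfl) hQ))
      refine ⟨p, hp1, hp2, hp3, fun z hz => ⟨(hp4 z hz).1, ?_⟩⟩
      rw [add_comm]
      exact h2.trans (hp4 z hz).2)
    (by
      intro t
      have hsub : (fun t' => keys.get t') '' {t' | ∃ b, GridNear (R + 1) (keys.get t).1 b ∧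
          GridNear (R + 1) (keys.get t').1 b} ⊆
          ((gridBall (2 * R + 2) (keys.get t).1 ×ˢ Finset.range (K + 1) :
            Finset ((Fin d → ℕ) × ℕ)) : Set ((Fin d → ℕ) × ℕ)) := by
        rintro _ ⟨t', ⟨b, h1, h2⟩, rfl⟩
        rw [Finset.mem_coe, Finset.mem_product, Finset.mem_range]
        refine ⟨mem_gridBall ((h1.trans h2.symm).mono (by omega)), ?_⟩
        have := hkey t'
        have h3 := hkK _ this.1
        rcases this.2 with h | h <;> simp only <;> omega
      rw [← Set.ncard_image_of_injective _ (List.nodup_iff_injective_get.1 hknd)]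
      refine (Set.ncard_le_ncard hsub (Finset.finite_toSet _)).trans ?_
      rw [Set.ncard_coe_finset, Finset.card_product, Finset.card_range]
      refine Nat.mul_le_mul_right _ ((card_gridBall_le _).trans_eq ?_)
      congr 1; ring)
    (fun t => by
      rw [hinn _ (keys.get_mem t)]
      exact GridNear.refl _)
    (fun t => (hout _ (keys.get_mem t)).mono (by omega))
    (fun t => hdom _ (keys.get_mem t))
    (fun t t' htt => hwp _ (keys.get_mem t) _ (keys.get_mem t')
      fun h => htt ((List.Nodup.get_inj_iff hknd).1 h))
    (fun t t' htt => hdd _ (keys.get_mem t) _ (keys.get_mem t')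
      fun h => htt ((List.Nodup.get_inj_iff hknd).1 h))
    s hs t₀
  have hlen : ∑ t : Fin keys.length, ((nd (keys.get t)).base + 2 * s t + m) = L := by
    rw [hLS, ← hbase_sum, ← hsS, Finset.mul_sum, ← Finset.sum_add_distrib]
    exact Finset.sum_congr rfl fun t _ => by ring
  have hvv : (nd (keys.get t₀)).inn = v := by
    rw [ht₀, hnd_ret _ hv]
    simp [ret, hvi]
  rwa [hlen, hvv] at hmain

end BoxCycle

/-! ### Hamiltonian paths of the grid, and subchains. -/

section Snake

/-- Boustrophedon order on a product with the first coordinate running through a list. -/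
def snake {d : ℕ} : List ℕ → List (Fin d → ℕ) → List (Fin (d + 1) → ℕ)
  | [], _ => []
  | a :: as, l => l.map (fun b => (Fin.cons a b : Fin (d + 1) → ℕ)) ++ snake as l.reverse

theorem mem_snake {d : ℕ} (as : List ℕ) : ∀ (l : List (Fin d → ℕ)) (b : Fin (d + 1) → ℕ),
    b ∈ snake as l ↔ b 0 ∈ as ∧ Fin.tail b ∈ l := by
  induction as with
  | nil => simp [snake]
  | cons a as ih =>
    intro l b
    simp only [snake, List.mem_append, List.mem_map, ih, List.mem_reverse, List.mem_cons]
    constructor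
    · rintro (⟨c, hc, rfl⟩ | h)
      · simpa using hc
      · exact ⟨Or.inr h.1, h.2⟩
    · rintro ⟨rfl | h, h'⟩
      · exact Or.inl ⟨_, h', Fin.cons_self_tail b⟩
      · exact Or.inr ⟨h, h'⟩

theorem nodup_snake {d : ℕ} (as : List ℕ) : ∀ l : List (Fin d → ℕ), as.Nodup → l.Nodup →
    (snake as l).Nodup := by
  induction as with
  | nil => simp [snake]
  | cons a as ih =>
    intro l ha hl
    rw [List.nodup_cons] at ha
    simp only [snake]
    rw [List.nodup_append']
    refine ⟨hl.map fun b c h => ?_, ih _ ha.2 (List.nodup_reverse.2 hl), ?_⟩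
    · exact (Fin.cons_injective2 h).2
    · intro x hx hx'
      obtain ⟨c, -, rfl⟩ := List.mem_map.1 hx
      have := ((mem_snake _ _ _).1 hx').1
      rw [Fin.cons_zero] at this
      exact ha.1 this

theorem GridNear.cons {d k a a' : ℕ} {b b' : Fin d → ℕ} (ha : a ≤ a' + k ∧ a' ≤ a + k)
    (hb : GridNear k b b') :
    GridNear k (Fin.cons a b : Fin (d + 1) → ℕ) (Fin.cons a' b' : Fin (d + 1) → ℕ) := by
  intro i
  refine Fin.cases ?_ (fun j => ?_) i
  · simpa using ha
  · simpa using hb j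

theorem head?_snake {d : ℕ} (a : ℕ) (as : List ℕ) (l : List (Fin d → ℕ)) (hl : l ≠ []) :
    (snake (a :: as) l).head? = l.head?.map fun b => (Fin.cons a b : Fin (d + 1) → ℕ) := by
  simp only [snake]
  rw [List.head?_append_of_ne_nil _ (by simpa using hl), List.head?_map]

/-- Because the list is reversed after each layer, the last entry of a layer and the first of the
next agree in all but the leading coordinate. -/
theorem isChain_snake {d : ℕ} (as : List ℕ) : ∀ l : List (Fin d → ℕ), l ≠ [] →
    as.IsChain (fun a a' => a ≤ a' + 1 ∧ a' ≤ a + 1) → l.IsChain (GridNear 1) →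
    (snake as l).IsChain (GridNear 1) := by
  induction as with
  | nil => intros; simp [snake]
  | cons a as ih =>
    intro l hne ha hl
    have hrev : l.reverse.IsChain (GridNear 1) := by
      rw [List.isChain_reverse]
      exact hl.imp fun _ _ h => h.symm
    simp only [snake]
    rw [List.isChain_append]
    refine ⟨?_, ih _ (by simpa using hne) ha.tail hrev, ?_⟩
    · rw [List.isChain_map]
      exact hl.imp fun _ _ h => h.cons ⟨by omega, by omega⟩
    · intro x hx y hy
      cases as with
      | nil => simp [snake] at hy
      | cons a' as =>
        rw [head?_snake _ _ _ (by simpa using hne), List.head?_reverse] at hy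
        rw [List.getLast?_map] at hx
        obtain ⟨b, hb, rfl⟩ := Option.mem_map.1 hx
        obtain ⟨b', hb', rfl⟩ := Option.mem_map.1 hy
        rw [Option.mem_unique hb hb']
        exact (GridNear.refl _).cons (List.isChain_cons_cons.1 ha).1

/-- The grid `{0, …, N-1}^d` has a Hamiltonian path. -/
theorem exists_grid_path (N : ℕ) (hN : 0 < N) : ∀ d : ℕ, ∃ l : List (Fin d → ℕ), l.Nodup ∧
    l.IsChain (GridNear 1) ∧ ∀ b, b ∈ l ↔ ∀ i, b i < N
  | 0 => ⟨[Fin.elim0], by simp, by simp, fun b => by simpa using Subsingleton.elim _ _⟩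
  | d + 1 => by
    obtain ⟨l, h1, h2, h3⟩ := exists_grid_path N hN d
    have hne : l ≠ [] := by
      intro h
      have := (h3 fun _ => 0).2 fun _ => hN
      simp [h] at this
    refine ⟨snake (List.range N) l, nodup_snake _ _ List.nodup_range h1,
      isChain_snake _ _ hne ?_ h2, fun b => ?_⟩
    · rw [List.isChain_iff_getElem]
      intro i hi
      simp only [List.getElem_range]
      omega
    · rw [mem_snake, h3, List.mem_range, Fin.forall_fin_succ]
      rfl

/-- In a chain of boxes there is a subchain containing a given box and fitting a given length. -/
theorem exists_subchain {β : Type*} {S : β → β → Prop} (f g : List β → ℕ) (L : ℕ) (b₀ : β)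
    (hf : f [b₀] ≤ L) : ∀ (n : ℕ) (l : List β), l.length = n → l.Nodup → l.IsChain S → b₀ ∈ l →
    (∀ bs : List β, bs ≠ [] → (∀ x ∈ bs, x ∈ l) → ∀ b ∈ l, f (b :: bs) ≤ g bs ∧
      f (bs ++ [b]) ≤ g bs) → L ≤ g l →
    ∃ bs : List β, (∀ x ∈ bs, x ∈ l) ∧ bs.Nodup ∧ bs.IsChain S ∧ b₀ ∈ bs ∧ f bs ≤ L ∧
      L ≤ g bs := by
  intro n
  induction n with
  | zero =>
    intro l hl _ _ hb
    rw [List.length_eq_zero_iff] at hl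
    simp [hl] at hb
  | succ n ih =>
    intro l hl hn hc hb hstep hL
    by_cases hfl : f l ≤ L
    · exact ⟨l, fun _ h => h, hn, hc, hb, hfl, hL⟩
    push Not at hfl
    obtain ⟨x, t, rfl⟩ := List.exists_cons_of_ne_nil (List.ne_nil_of_mem hb)
    -- Drop the head of the chain, or its last element if the head is `b₀`. The upper limit `g` of
    -- the shorter chain reaches the lower limit `f` of the longer one, so no length falls in
    -- between.
    by_cases hbt : b₀ ∈ t
    · have h1 := (hstep t (List.ne_nil_of_mem hbt) (fun y hy => List.mem_cons_of_mem _ hy) x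
        (by simp)).1
      obtain ⟨bs, h2, h3⟩ := ih t (by simpa using hl) (List.nodup_cons.1 hn).2 hc.tail hbt
        (fun bs hbs hsub b hb => hstep bs hbs (fun y hy => List.mem_cons_of_mem _ (hsub y hy)) b
          (List.mem_cons_of_mem _ hb)) (by omega)
      exact ⟨bs, fun y hy => List.mem_cons_of_mem _ (h2 y hy), h3⟩
    · obtain rfl : b₀ = x := by simpa [hbt] using hb
      rcases List.eq_nil_or_concat' t with rfl | ⟨t', y, rfl⟩
      · omega
      · have hsub : ∀ z ∈ b₀ :: t', z ∈ b₀ :: (t' ++ [y]) := by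
          intro z hz
          simp only [List.mem_cons, List.mem_append] at hz ⊢
          tauto
        have h1 := (hstep (b₀ :: t') (by simp) hsub y (by simp)).2
        rw [List.cons_append] at h1
        rw [← List.cons_append] at hn hc
        obtain ⟨bs, h2, h3⟩ := ih (b₀ :: t') (by simpa using hl) hn.of_append_left
          (List.isChain_append.1 hc).1 (by simp)
          (fun bs hbs hs b hb => hstep bs hbs (fun y hy => hsub _ (hs y hy)) b (hsub _ hb))
          (by omega)
        exact ⟨bs, fun y hy => hsub _ (h2 y hy), h3⟩

end Snake

/-! ### Paths of fixed length through cells. -/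

section Connect

/-- Routing through cells: if vertices of adjacent cells have many common neighbours, vertices
of cells at distance at most `Λ + 1` are joined by paths with exactly `2 * Λ + 1` inner vertices that
avoid a given small set. -/
theorem exists_path_through_cells {V : Type*} [DecidableEq V] {H : SimpleGraph V} {d M c : ℕ}
    (cell : V → Fin d → ℕ) (hcell : ∀ x i, cell x i < M)
    (hcommon : ∀ x z, GridNear 1 (cell x) (cell z) → ∀ U : Finset V, U.card ≤ c →
      ∃ w ∉ U, H.Adj x w ∧ H.Adj w z)
    (hpop : ∀ b : Fin d → ℕ, (∀ i, b i < M) → ∀ U : Finset V, U.card ≤ c → ∃ z ∉ U, cell z = b)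
    (Λ : ℕ) : ∀ (x y : V) (U : Finset V), x ≠ y → GridNear (Λ + 1) (cell x) (cell y) →
      U.card + 2 * Λ + 3 ≤ c → ∃ p : List V, p.length = 2 * Λ + 1 ∧
        (x :: (p ++ [y])).IsChain H.Adj ∧ p.Nodup ∧
        ∀ w ∈ p, w ∉ U ∧ w ≠ x ∧ w ≠ y ∧
          ∃ z, GridNear (Λ + 1) (cell x) (cell z) ∧ (w = z ∨ H.Adj z w) := by
  induction Λ with
  | zero =>
    intro x y U hxy hnear hU
    obtain ⟨w, hw, hxw, hwy⟩ := hcommon x y hnear U (by omega)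
    refine ⟨[w], rfl, by simpa using ⟨hxw, hwy⟩, by simp, ?_⟩
    intro w' hw'
    obtain rfl := List.mem_singleton.1 hw'
    exact ⟨hw, hxw.ne', hwy.ne, x, GridNear.refl _, Or.inr hxw⟩
  | succ Λ ih =>
    intro x y U hxy hnear hU
    -- One step towards the cell of `y`, staying put in coordinates that already agree; hence the
    -- number of inner vertices does not depend on the actual distance.
    let q : Fin d → ℕ := fun i => if cell x i < cell y i then cell x i + 1 else
      if cell y i < cell x i then cell x i - 1 else cell x i
    have hq1 : GridNear 1 (cell x) q := by
      intro i
      simp only [q]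
      split_ifs <;> omega
    have hq2 : GridNear (Λ + 1) q (cell y) := by
      intro i
      have := hnear i
      simp only [q]
      split_ifs <;> omega
    have hqM : ∀ i, q i < M := by
      intro i
      have h1 := hcell x i
      have h2 := hcell y i
      simp only [q]
      split_ifs <;> omega
    obtain ⟨z, hz, hzq⟩ := hpop q hqM (U ∪ {x, y}) (by
      have h1 := Finset.card_union_le U {x, y}
      have h2 := Finset.card_le_two (a := x) (b := y)
      omega)
    simp only [Finset.mem_union, Finset.mem_insert, Finset.mem_singleton, not_or] at hz
    obtain ⟨hzU, hzx, hzy⟩ := hz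
    obtain ⟨w, hw, hxw, hwz⟩ := hcommon x z (by rwa [hzq]) (U ∪ {y}) (by
      have h1 := Finset.card_union_le U {y}
      rw [Finset.card_singleton] at h1
      omega)
    simp only [Finset.mem_union, Finset.mem_singleton, not_or] at hw
    obtain ⟨p, hp, hpc, hpn, hpm⟩ := ih z y (U ∪ {x, w}) hzy (by rwa [hzq]) (by
      have h1 := Finset.card_union_le U {x, w}
      have h2 := Finset.card_le_two (a := x) (b := w)
      omega)
    refine ⟨w :: z :: p, by simp [hp]; ring, ?_, ?_, ?_⟩
    · simp only [List.cons_append, List.isChain_cons_cons] at hpc ⊢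
      exact ⟨hxw, hwz, hpc⟩
    · rw [List.nodup_cons, List.nodup_cons, List.mem_cons, not_or]
      refine ⟨⟨hwz.ne, fun h => ?_⟩, fun h => (hpm z h).2.1 rfl, hpn⟩
      exact (hpm w h).1 (by simp)
    · intro w' hw'
      rw [List.mem_cons, List.mem_cons] at hw'
      rcases hw' with rfl | rfl | hw'
      · exact ⟨hw.1, hxw.ne', hw.2, x, GridNear.refl _, Or.inr hxw⟩
      · exact ⟨hzU, hzx, hzy, w', (hzq ▸ hq1).mono (by omega), Or.inl rfl⟩
      · obtain ⟨h1, -, h3, z', h4, h5⟩ := hpm w' hw'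
        simp only [Finset.mem_union, Finset.mem_insert, Finset.mem_singleton, not_or] at h1
        refine ⟨h1.1, h1.2.1, h3, z', ?_, h5⟩
        rw [hzq] at h4
        rw [add_comm (Λ + 1)]
        exact hq1.trans h4

end Connect

/-! ### All lengths up to the total capacity of the grid. -/

section Grid

/-- If all boxes of the grid provide slots, there are cycles through `v` of all lengths up to the
total capacity of the slots. -/
theorem hasCycleThrough_of_grid {V : Type*} [DecidableEq V] {H : SimpleGraph V} {d N : ℕ}
    (bx : V → Fin d → ℕ) (hN : 0 < N) (hbx : ∀ x i, bx x i < N)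
    {Q m R K : ℕ} (hm : 3 ≤ m)
    (hQ : (4 * R + 5) ^ d * (K + 1) * (m + 2) ≤ Q)
    (hconn : ∀ x y, x ≠ y → GridNear 2 (bx x) (bx y) → ∀ U : Finset V, U.card ≤ Q →
      ∃ p : List V, p.length = m ∧ (x :: (p ++ [y])).IsChain H.Adj ∧ p.Nodup ∧
        ∀ z ∈ p, z ∉ U ∧ GridNear R (bx x) (bx z))
    (v : V) (x' : V) (hx' : H.Adj v x') (hvx' : GridNear 1 (bx v) (bx x'))
    (k cap : (Fin d → ℕ) → ℕ) (hk0 : ∀ b, (∀ i, b i < N) → 0 < k b)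
    (hkK : ∀ b, (∀ i, b i < N) → k b ≤ K)
    (hcap : ∀ b, (∀ i, b i < N) → (m + 4) * K + m + 2 ≤ cap b)
    (hslots : ∀ b, (∀ i, b i < N) → ∀ W : Finset V, W.card ≤ 3 →
      ∃ n : ℕ → PathNode H Q, ∀ j < k b,
      (n j).inn ∉ W ∧ (n j).out ∉ W ∧ (n j).inn ∈ (n j).dom ∧ (n j).out ∈ (n j).dom ∧
      (n j).base = 4 ∧ (n j).cap = cap b ∧ (∀ x ∈ (n j).dom, bx x = b) ∧
      ∀ j' < k b, j ≠ j' → Disjoint (n j).dom (n j').dom)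
    (hret : ∀ b, (∀ i, b i < N) → ∃ u, bx u = b ∧ u ≠ x') (L : ℕ)
    (hL : (m + 4) * K + m + 2 ≤ L)
    (hL' : L ≤ 2 * ∑ b ∈ Fintype.piFinset fun _ : Fin d => Finset.range N, k b * cap b) :
    HasCycleThrough H L v := by
  obtain ⟨l, hl, hlc, hlm⟩ := exists_grid_path N hN d
  let f : List (Fin d → ℕ) → ℕ := fun bs => (m + 4) * (bs.map k).sum + (m + 1) * bs.length + 1
  let g : List (Fin d → ℕ) → ℕ := fun bs => (m + 4) * (bs.map k).sum + (m + 1) * bs.length +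
    2 * (bs.map fun b => k b * cap b).sum
  -- A further box raises the minimal length by at most `(m + 4) * K + m + 1`, which the capacity of
  -- any single box of `bs` absorbs.
  have hstep : ∀ bs : List (Fin d → ℕ), bs ≠ [] → (∀ x ∈ bs, x ∈ l) → ∀ b ∈ l,
      f (b :: bs) ≤ g bs ∧ f (bs ++ [b]) ≤ g bs := by
    intro bs hbs hsub b hb
    obtain ⟨b', bs', rfl⟩ := List.exists_cons_of_ne_nil hbs
    have hb' : ∀ i, b' i < N := (hlm b').1 (hsub b' (by simp))
    have h1 := hcap b' hb'
    have h2 : 1 * cap b' ≤ k b' * cap b' := Nat.mul_le_mul_right _ (hk0 b' hb')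
    have h3 : (m + 4) * k b ≤ (m + 4) * K := Nat.mul_le_mul_left _ (hkK b ((hlm b).1 hb))
    simp only [f, g, List.map_cons, List.sum_cons, List.length_cons, List.map_append,
      List.sum_append, List.length_append, List.map_nil, List.sum_nil, List.length_nil, add_zero,
      mul_add (m + 4), mul_add (m + 1), mul_add 2, mul_one, zero_add, one_mul] at h2 ⊢
    constructor <;> omega
  have hgl : L ≤ g l := by
    refine hL'.trans ?_
    have h1 : l.toFinset = Fintype.piFinset fun _ : Fin d => Finset.range N := by
      ext b
      rw [List.mem_toFinset, hlm, Fintype.mem_piFinset]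
      simp
    rw [← h1, List.sum_toFinset _ hl]
    simp only [g]
    omega
  have hf : f [bx v] ≤ L := by
    have h3 : (m + 4) * k (bx v) ≤ (m + 4) * K := Nat.mul_le_mul_left _ (hkK _ (hbx v))
    simp only [f, List.map_cons, List.map_nil, List.sum_cons, List.sum_nil, List.length_cons,
      List.length_nil, add_zero, zero_add, mul_one]
    omega
  obtain ⟨bs, h1, h2, h3, h4, h5, h6⟩ := exists_subchain f g L (bx v) hf l.length l rfl hl hlc
    ((hlm _).2 (hbx v)) hstep hgl
  have hin : ∀ b ∈ bs, ∀ i, b i < N := fun b hb => (hlm b).1 (h1 b hb)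
  exact hasCycleThrough_of_boxes bx hm hQ hconn bs h2 h3 v h4 x' hx' hvx' k cap
    (fun b hb => hk0 b (hin b hb)) (fun b hb => hkK b (hin b hb))
    (fun b hb => hslots b (hin b hb)) (fun b hb => hret b (hin b hb)) L h5 h6

/-- Robust pairs of an induced subgraph are robust pairs of the graph. -/
theorem IsRobustPair.map_subtype {V : Type*} {H : SimpleGraph V} {P : V → Prop}
    {A B : Finset {x // P x}} {γ g : ℕ}
    (h : IsRobustPair (H.comap (Subtype.val : {x // P x} → V)) A B γ g) :
    IsRobustPair H (A.map (Function.Embedding.subtype P)) (B.map (Function.Embedding.subtype P))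
      γ g := by
  classical
  have key : ∀ (A : Finset {x // P x}) (A' : Finset V),
      A' ⊆ A.map (Function.Embedding.subtype P) →
      ∃ A₀ ⊆ A, A' = A₀.map (Function.Embedding.subtype P) ∧ A₀.card = A'.card := by
    intro A A' hA'
    rw [Finset.subset_map_iff] at hA'
    obtain ⟨A₀, h1, rfl⟩ := hA'
    exact ⟨A₀, h1, rfl, (Finset.card_map _).symm⟩
  refine ⟨?_, ?_, ?_⟩
  · intro A' hA' B' hB' hAc hBc
    obtain ⟨A₀, hA₀, rfl, hAe⟩ := key A A' hA'
    obtain ⟨B₀, hB₀, rfl, hBe⟩ := key B B' hB'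
    obtain ⟨a, ha, b, hb, hab⟩ := h.adj A₀ hA₀ B₀ hB₀ (by omega) (by omega)
    exact ⟨a, Finset.mem_map_of_mem _ ha, b, Finset.mem_map_of_mem _ hb, hab⟩
  · intro A' hA' B' hB' hAc hBc
    obtain ⟨A₀, hA₀, rfl, hAe⟩ := key A A' hA'
    obtain ⟨B₀, hB₀, rfl, hBe⟩ := key B B' hB'
    obtain ⟨a, ha, T, hT, hTc, hTa⟩ := h.left A₀ hA₀ B₀ hB₀ (by omega) (by omega)
    refine ⟨a, Finset.mem_map_of_mem _ ha, T.map (Function.Embedding.subtype P),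
      Finset.map_subset_map.2 hT, by rw [Finset.card_map, hTc], ?_⟩
    intro b hb
    obtain ⟨b', hb', rfl⟩ := Finset.mem_map.1 hb
    exact hTa b' hb'
  · intro A' hA' B' hB' hAc hBc
    obtain ⟨A₀, hA₀, rfl, hAe⟩ := key A A' hA'
    obtain ⟨B₀, hB₀, rfl, hBe⟩ := key B B' hB'
    obtain ⟨b, hb, T, hT, hTc, hTa⟩ := h.right A₀ hA₀ B₀ hB₀ (by omega) (by omega)
    refine ⟨b, Finset.mem_map_of_mem _ hb, T.map (Function.Embedding.subtype P),
      Finset.map_subset_map.2 hT, by rw [Finset.card_map, hTc], ?_⟩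
    intro a ha
    obtain ⟨a', ha', rfl⟩ := Finset.mem_map.1 ha
    exact hTa a' ha'

end Grid

/-! ### Volumes of boxes, cells and truncated balls. -/

section Volumes

/-- Half-open boxes in Euclidean space. -/
def icoBox {d : ℕ} (a b : Fin d → ℝ) : Set (EuclideanSpace ℝ (Fin d)) :=
  {x | ∀ i, x i ∈ Set.Ico (a i) (b i)}

theorem icoBox_eq_preimage {d : ℕ} (a b : Fin d → ℝ) :
    icoBox a b = (MeasurableEquiv.toLp 2 (Fin d → ℝ)).symm ⁻¹'
      (Set.univ.pi fun i => Set.Ico (a i) (b i)) := by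
  ext x; simp [icoBox, Set.mem_pi]

theorem measurableSet_icoBox {d : ℕ} (a b : Fin d → ℝ) : MeasurableSet (icoBox a b) := by
  rw [icoBox_eq_preimage]
  exact (MeasurableEquiv.measurable _) (MeasurableSet.univ_pi fun i => measurableSet_Ico)

theorem volume_icoBox {d : ℕ} (a b : Fin d → ℝ) :
    volume (icoBox a b) = ∏ i, ENNReal.ofReal (b i - a i) := by
  rw [icoBox_eq_preimage,
    (EuclideanSpace.volume_preserving_symm_measurableEquiv_toLp (Fin d)).measure_preimage_equiv,
    volume_pi_pi]
  simp

/-- The half-open unit cube. -/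
def halfCube (d : ℕ) : Set (EuclideanSpace ℝ (Fin d)) := icoBox (fun _ => 0) (fun _ => 1)

theorem volume_halfCube (d : ℕ) : volume (halfCube d) = 1 := by simp [halfCube, volume_icoBox]

/-- The cell with index `q` of the grid of mesh `1 / M`. -/
def gridCell {d : ℕ} (M : ℕ) (q : Fin d → ℕ) : Set (EuclideanSpace ℝ (Fin d)) :=
  icoBox (fun i => (q i : ℝ) / M) (fun i => ((q i : ℝ) + 1) / M)

theorem volume_gridCell {d M : ℕ} (q : Fin d → ℕ) :
    volume.real (gridCell M q) = 1 / (M : ℝ) ^ d := by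
  have h : ∀ i : Fin d, ((q i : ℝ) + 1) / M - (q i : ℝ) / M = 1 / M := fun i => by ring
  rw [Measure.real, gridCell, volume_icoBox]
  simp_rw [h]
  rw [Finset.prod_const, ENNReal.toReal_pow, ENNReal.toReal_ofReal (by positivity)]
  simp

/-- The index of the cell containing a point. -/
noncomputable def cellIndex {d : ℕ} (M : ℕ) (x : EuclideanSpace ℝ (Fin d)) : Fin d → ℕ :=
  fun i => ⌊x i * M⌋₊

theorem mem_gridCell_iff {d M : ℕ} (hM : 0 < M) {q : Fin d → ℕ} {x : EuclideanSpace ℝ (Fin d)}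
    (hx : x ∈ halfCube d) : x ∈ gridCell M q ↔ cellIndex M x = q := by
  have hM' : (0 : ℝ) < M := by exact_mod_cast hM
  have h0 : ∀ i, 0 ≤ x i * M := fun i => mul_nonneg (hx i).1 hM'.le
  simp only [gridCell, icoBox, Set.mem_ofPred_eq, Set.mem_Ico, cellIndex, funext_iff]
  refine forall_congr' fun i => ?_
  rw [Nat.floor_eq_iff (h0 i), div_le_iff₀ hM', lt_div_iff₀ hM']

theorem cellIndex_lt {d M : ℕ} (hM : 0 < M) {x : EuclideanSpace ℝ (Fin d)} (hx : x ∈ halfCube d)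
    (i : Fin d) : cellIndex M x i < M := by
  have hM' : (0 : ℝ) < M := by exact_mod_cast hM
  rw [cellIndex, Nat.floor_lt (mul_nonneg (hx i).1 hM'.le)]
  exact mul_lt_of_lt_one_left hM' (hx i).2

theorem gridCell_subset_halfCube {d M : ℕ} (hM : 0 < M) {q : Fin d → ℕ} (hq : ∀ i, q i < M) :
    gridCell M q ⊆ halfCube d := by
  intro x hx i
  have hM' : (0 : ℝ) < M := by exact_mod_cast hM
  have h1 := hx i
  simp only [Set.mem_Ico] at h1 ⊢
  refine ⟨le_trans (by positivity) h1.1, lt_of_lt_of_le h1.2 ?_⟩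
  rw [div_le_one hM']
  exact_mod_cast hq i

theorem abs_sub_le_dist {d : ℕ} (x y : EuclideanSpace ℝ (Fin d)) (i : Fin d) :
    |x i - y i| ≤ dist x y := by
  rw [dist_eq_norm]
  have := PiLp.norm_apply_le (x - y) i
  simpa using this

theorem dist_le_sqrt_mul {d : ℕ} {x y : EuclideanSpace ℝ (Fin d)} {a : ℝ} (ha : 0 ≤ a)
    (h : ∀ i, |x i - y i| ≤ a) : dist x y ≤ √d * a := by
  rw [EuclideanSpace.dist_eq]
  have h1 : ∑ i, dist (x i) (y i) ^ 2 ≤ d * a ^ 2 := by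
    have : ∀ i ∈ (Finset.univ : Finset (Fin d)), dist (x i) (y i) ^ 2 ≤ a ^ 2 := by
      intro i _
      rw [Real.dist_eq]
      exact pow_le_pow_left₀ (abs_nonneg _) (h i) 2
    simpa using Finset.sum_le_card_nsmul _ _ _ this
  calc √(∑ i, dist (x i) (y i) ^ 2) ≤ √(d * a ^ 2) := Real.sqrt_le_sqrt h1
    _ = √d * a := by rw [Real.sqrt_mul (by positivity), Real.sqrt_sq ha]

/-- The extra `1` accounts for the positions of the points inside their cells. -/
theorem abs_sub_le_of_gridNear {d M k : ℕ} (hM : 0 < M) {x y : EuclideanSpace ℝ (Fin d)}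
    (hx : x ∈ halfCube d) (hy : y ∈ halfCube d) (h : GridNear k (cellIndex M x) (cellIndex M y))
    (i : Fin d) : |x i - y i| ≤ ((k : ℝ) + 1) / M := by
  have hM' : (0 : ℝ) < M := by exact_mod_cast hM
  have h1 := h i
  simp only [cellIndex] at h1
  have hx1 := Nat.floor_le (mul_nonneg (hx i).1 hM'.le)
  have hx2 := Nat.lt_floor_add_one (x i * M)
  have hy1 := Nat.floor_le (mul_nonneg (hy i).1 hM'.le)
  have hy2 := Nat.lt_floor_add_one (y i * M)
  have h2 : (⌊x i * M⌋₊ : ℝ) ≤ ⌊y i * M⌋₊ + k := by exact_mod_cast h1.1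
  have h3 : (⌊y i * M⌋₊ : ℝ) ≤ ⌊x i * M⌋₊ + k := by exact_mod_cast h1.2
  rw [le_div_iff₀ hM', ← abs_of_pos hM', ← abs_mul, abs_le]
  constructor <;> linarith

theorem gridNear_of_abs_sub_le {d M k : ℕ} {x y : EuclideanSpace ℝ (Fin d)}
    (h : ∀ i, |x i - y i| * M ≤ k) (hx : x ∈ halfCube d) (hy : y ∈ halfCube d) :
    GridNear k (cellIndex M x) (cellIndex M y) := by
  intro i
  have h1 := h i
  have hx0 : 0 ≤ x i * M := mul_nonneg (hx i).1 (Nat.cast_nonneg _)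
  have hy0 : 0 ≤ y i * M := mul_nonneg (hy i).1 (Nat.cast_nonneg _)
  have h2 := abs_le.1 (le_of_eq_of_le (by rw [abs_mul, Nat.abs_cast]) h1 :
    |(x i - y i) * (M : ℝ)| ≤ k)
  simp only [cellIndex]
  constructor
  · rw [← Nat.floor_add_natCast hy0]
    exact Nat.floor_le_floor (by linarith [h2.2])
  · rw [← Nat.floor_add_natCast hx0]
    exact Nat.floor_le_floor (by linarith [h2.1])

theorem dist_le_of_mem_gridCell {d M : ℕ} {q : Fin d → ℕ} {x y : EuclideanSpace ℝ (Fin d)}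
    (hx : x ∈ gridCell M q) (hy : y ∈ gridCell M q) : dist x y ≤ √d / M := by
  have : dist x y ≤ √d * (1 / M) := by
    refine dist_le_sqrt_mul (by positivity) fun i => ?_
    have h1 := hx i
    have h2 := hy i
    simp only [Set.mem_Ico] at h1 h2
    have h3 : ((q i : ℝ) + 1) / M = (q i : ℝ) / M + 1 / M := by ring
    rw [h3] at h1 h2
    rw [abs_le]
    constructor <;> linarith [h1.1, h1.2, h2.1, h2.2]
  rwa [mul_one_div] at this

/-- The volume of the part of a ball inside the cube. -/
noncomputable def ballVol {d : ℕ} (x : EuclideanSpace ℝ (Fin d)) (R : ℝ) : ℝ :=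
  volume.real (Metric.closedBall x R ∩ halfCube d)

theorem volume_inter_halfCube_ne_top {d : ℕ} (s : Set (EuclideanSpace ℝ (Fin d))) :
    volume (s ∩ halfCube d) ≠ ⊤ :=
  ((measure_mono Set.inter_subset_right).trans_lt (by simp [volume_halfCube])).ne

theorem ballVol_mono {d : ℕ} {x y : EuclideanSpace ℝ (Fin d)} {R R' : ℝ}
    (h : dist x y + R ≤ R') : ballVol x R ≤ ballVol y R' := by
  refine measureReal_mono (Set.inter_subset_inter_left _ ?_) (volume_inter_halfCube_ne_top _)
  exact Metric.closedBall_subset_closedBall' (by linarith)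

theorem convex_halfCube (d : ℕ) : Convex ℝ (halfCube d) := by
  intro x hx y hy a b ha hb hab i
  have h := (convex_Ico (0 : ℝ) 1) (hx i) (hy i) ha hb hab
  simpa using h

/-- Scaling towards a point of the (convex) cube. -/
theorem ballVol_scale {d : ℕ} {x : EuclideanSpace ℝ (Fin d)} (hx : x ∈ halfCube d) {ρ R : ℝ}
    (hρ : 0 < ρ) (hR : ρ ≤ R) : (ρ / R) ^ d * ballVol x R ≤ ballVol x ρ := by
  have hR0 : 0 < R := hρ.trans_le hR
  have hc0 : 0 ≤ ρ / R := by positivity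
  have hc1 : ρ / R ≤ 1 := (div_le_one hR0).2 hR
  -- The homothety centred at `x` keeps points of the cube in the cube by convexity, so no case
  -- distinction at the boundary is needed.
  have hsub : AffineMap.homothety x (ρ / R) '' (Metric.closedBall x R ∩ halfCube d) ⊆
      Metric.closedBall x ρ ∩ halfCube d := by
    rintro _ ⟨y, ⟨hy1, hy2⟩, rfl⟩
    refine ⟨?_, ?_⟩
    · rw [Metric.mem_closedBall, dist_homothety_center, Real.norm_of_nonneg hc0, dist_comm]
      calc ρ / R * dist y x ≤ ρ / R * R := by gcongr; exact hy1
        _ = ρ := by field_simp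
    · rw [AffineMap.homothety_eq_lineMap]
      exact (convex_halfCube d).lineMap_mem hx hy2 ⟨hc0, hc1⟩
  have h1 : volume.real (AffineMap.homothety x (ρ / R) '' (Metric.closedBall x R ∩ halfCube d)) =
      (ρ / R) ^ d * ballVol x R := by
    rw [Measure.real, Measure.addHaar_image_homothety, ENNReal.toReal_mul, ballVol, Measure.real,
      ENNReal.toReal_ofReal (abs_nonneg _), abs_of_nonneg (by positivity)]
    simp
  rw [← h1]
  exact measureReal_mono hsub (volume_inter_halfCube_ne_top _)

/-- A ball of radius `√d` about a point of the cube contains the cube; scale it down to radius `R`.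
-/
theorem le_ballVol {d : ℕ} (hd : 1 ≤ d) {x : EuclideanSpace ℝ (Fin d)} (hx : x ∈ halfCube d)
    {R : ℝ} (hR : 0 < R) (hR1 : R ≤ 1) : (R / √d) ^ d ≤ ballVol x R := by
  have hd1 : (1 : ℝ) ≤ √d := by
    rw [Real.one_le_sqrt]; exact_mod_cast hd
  have h1 := ballVol_scale hx hR (hR1.trans hd1)
  have h2 : ballVol x (√d) = 1 := by
    have : Metric.closedBall x (√d) ∩ halfCube d = halfCube d := by
      rw [Set.inter_eq_right]
      intro y hy
      rw [Metric.mem_closedBall]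
      have := dist_le_sqrt_mul (x := y) (y := x) (a := 1) zero_le_one fun i => by
        have h3 := hx i
        have h4 := hy i
        simp only [Set.mem_Ico] at h3 h4
        rw [abs_le]
        constructor <;> linarith [h3.1, h3.2, h4.1, h4.2]
      simpa using this
    rw [ballVol, this, Measure.real, volume_halfCube]
    simp
  rwa [h2, mul_one] at h1

/-- The volume of the unit ball. -/
noncomputable def unitBallVol (d : ℕ) : ℝ :=
  volume.real (Metric.closedBall (0 : EuclideanSpace ℝ (Fin d)) 1)

theorem unitBallVol_pos (d : ℕ) : 0 < unitBallVol d := by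
  rw [unitBallVol, Measure.real, ENNReal.toReal_pos_iff]
  exact ⟨Metric.measure_closedBall_pos _ _ one_pos, measure_closedBall_lt_top⟩

theorem volume_closedBall_eq {d : ℕ} (x : EuclideanSpace ℝ (Fin d)) {R : ℝ} (hR : 0 ≤ R) :
    volume.real (Metric.closedBall x R) = R ^ d * unitBallVol d := by
  rw [Measure.real, Measure.addHaar_closedBall' _ _ hR, ENNReal.toReal_mul, unitBallVol,
    Measure.real, ENNReal.toReal_ofReal (by positivity)]
  simp

theorem ballVol_le {d : ℕ} (x : EuclideanSpace ℝ (Fin d)) {R : ℝ} (hR : 0 ≤ R) :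
    ballVol x R ≤ R ^ d * unitBallVol d := by
  rw [← volume_closedBall_eq x hR]
  exact measureReal_mono Set.inter_subset_left measure_closedBall_lt_top.ne

theorem ballVol_eq {d : ℕ} {x : EuclideanSpace ℝ (Fin d)} {R : ℝ} (hR : 0 ≤ R)
    (h : Metric.closedBall x R ⊆ halfCube d) : ballVol x R = R ^ d * unitBallVol d := by
  rw [ballVol, Set.inter_eq_left.2 h, volume_closedBall_eq x hR]

end Volumes

/-! ### Point counts in balls, and common neighbours. -/

section Counts

open Classical in
/-- The number of points in a set. -/
noncomputable def ptCount {d n : ℕ} (X : Fin n → EuclideanSpace ℝ (Fin d))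
    (S : Set (EuclideanSpace ℝ (Fin d))) : ℕ :=
  (Finset.univ.filter fun i => X i ∈ S).card

/-- The points `X` are evenly distributed over the cells of mesh `1 / M`, the boxes of mesh
`1 / N`, and the boxes of mesh `1 / N` shrunk by `r`. -/
structure EvenlySpread {d n : ℕ} (N M : ℕ) (δ r : ℝ) (X : Fin n → EuclideanSpace ℝ (Fin d)) :
    Prop where
  mem : ∀ i, X i ∈ halfCube d
  le_cell : ∀ q : Fin d → ℕ, (∀ i, q i < M) →
    (1 - δ) * (n * (1 / (M : ℝ) ^ d)) ≤ ptCount X (gridCell M q)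
  cell_le : ∀ q : Fin d → ℕ, (∀ i, q i < M) →
    ptCount X (gridCell M q) ≤ (1 + δ) * (n * (1 / (M : ℝ) ^ d))
  le_box : ∀ b : Fin d → ℕ, (∀ i, b i < N) →
    (1 - δ) * (n * (1 / (N : ℝ) ^ d)) ≤ ptCount X (gridCell N b)
  box_le : ∀ b : Fin d → ℕ, (∀ i, b i < N) →
    ptCount X (gridCell N b) ≤ (1 + δ) * (n * (1 / (N : ℝ) ^ d))
  le_inner : ∀ b : Fin d → ℕ, (∀ i, b i < N) →
    (1 - δ) * (n * (1 / (N : ℝ) - 2 * r) ^ d) ≤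
      ptCount X (icoBox (fun i => (b i : ℝ) / N + r) (fun i => ((b i : ℝ) + 1) / N - r))

theorem disjoint_gridCell {d M : ℕ} (hM : 0 < M) {q q' : Fin d → ℕ} (hq : ∀ i, q i < M)
    (h : q ≠ q') : Disjoint (gridCell M q) (gridCell M q') := by
  rw [Set.disjoint_left]
  intro x hx hx'
  have hxc := gridCell_subset_halfCube hM hq hx
  exact h (((mem_gridCell_iff hM hxc).1 hx).symm.trans ((mem_gridCell_iff hM hxc).1 hx'))

theorem volume_biUnion_gridCell {d M : ℕ} (hM : 0 < M) (C : Finset (Fin d → ℕ))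
    (hC : ∀ q ∈ C, ∀ i, q i < M) :
    volume.real (⋃ q ∈ C, gridCell M q) = C.card * (1 / (M : ℝ) ^ d) := by
  have hfin : ∀ q ∈ C, volume (gridCell M q) ≠ ⊤ := fun q hq =>
    ((measure_mono (gridCell_subset_halfCube hM (hC q hq))).trans_lt (by simp [volume_halfCube])).ne
  have hdisj : Set.PairwiseDisjoint (↑C) (gridCell M) := fun q hq q' _ hqq =>
    disjoint_gridCell hM (hC q hq) hqq
  rw [measureReal_biUnion_finset hdisj (fun q _ => measurableSet_icoBox _ _) hfin]
  simp_rw [volume_gridCell]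
  rw [Finset.sum_const, nsmul_eq_mul]

/-- The cells that contain a point of the ball lie in the ball enlarged by the cell diameter; add up
their counts. -/
theorem EvenlySpread.ptCount_closedBall_le {d n N M : ℕ} {δ r : ℝ}
    {X : Fin n → EuclideanSpace ℝ (Fin d)} (h : EvenlySpread N M δ r X) (hM : 0 < M) (hδ : 0 ≤ δ)
    (x : EuclideanSpace ℝ (Fin d)) (R : ℝ) :
    ptCount X (Metric.closedBall x R) ≤ (1 + δ) * (n * ballVol x (R + √d / M)) := by
  classical
  let C : Finset (Fin d → ℕ) := (Fintype.piFinset fun _ : Fin d => Finset.range M).filter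
    fun q => ∃ i, X i ∈ gridCell M q ∧ dist (X i) x ≤ R
  have hCM : ∀ q ∈ C, ∀ i, q i < M := by
    intro q hq i
    have := (Fintype.mem_piFinset.1 (Finset.mem_filter.1 hq).1) i
    simpa using this
  have h1 : ptCount X (Metric.closedBall x R) ≤ ∑ q ∈ C, ptCount X (gridCell M q) := by
    refine le_trans (Finset.card_le_card ?_) Finset.card_biUnion_le
    intro i hi
    have hi' : dist (X i) x ≤ R := by simpa using hi
    have hc := (mem_gridCell_iff hM (h.mem i)).2 rfl
    refine Finset.mem_biUnion.2 ⟨cellIndex M (X i), Finset.mem_filter.2 ⟨?_, i, hc, hi'⟩,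
      by simpa using hc⟩
    rw [Fintype.mem_piFinset]
    intro j
    rw [Finset.mem_range]
    exact cellIndex_lt hM (h.mem i) j
  have h2 : (∑ q ∈ C, (ptCount X (gridCell M q) : ℝ)) ≤
      C.card * ((1 + δ) * (n * (1 / (M : ℝ) ^ d))) := by
    rw [← nsmul_eq_mul]
    exact Finset.sum_le_card_nsmul _ _ _ fun q hq => h.cell_le q (hCM q hq)
  have h3 : (C.card : ℝ) * (1 / (M : ℝ) ^ d) ≤ ballVol x (R + √d / M) := by
    rw [← volume_biUnion_gridCell hM C hCM]
    refine measureReal_mono ?_ (volume_inter_halfCube_ne_top _)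
    refine Set.iUnion₂_subset fun q hq y hy => ?_
    refine ⟨?_, gridCell_subset_halfCube hM (hCM q hq) hy⟩
    obtain ⟨-, i, hi, hix⟩ := Finset.mem_filter.1 hq
    rw [Metric.mem_closedBall]
    have := dist_le_of_mem_gridCell hy hi
    have := dist_triangle y (X i) x
    linarith
  have h1' : (ptCount X (Metric.closedBall x R) : ℝ) ≤ ∑ q ∈ C, (ptCount X (gridCell M q) : ℝ) := by
    exact_mod_cast h1
  calc (ptCount X (Metric.closedBall x R) : ℝ) ≤ C.card * ((1 + δ) * (n * (1 / (M : ℝ) ^ d))) :=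
        h1'.trans h2
    _ = (1 + δ) * (n * (C.card * (1 / (M : ℝ) ^ d))) := by ring
    _ ≤ _ := by gcongr

/-- The cells meeting the ball shrunk by the cell diameter lie in the ball and cover the part of the
shrunk ball in the cube. -/
theorem EvenlySpread.le_ptCount_closedBall {d n N M : ℕ} {δ r : ℝ}
    {X : Fin n → EuclideanSpace ℝ (Fin d)} (h : EvenlySpread N M δ r X) (hM : 0 < M) (hδ : δ ≤ 1)
    (x : EuclideanSpace ℝ (Fin d)) (R : ℝ) :
    (1 - δ) * (n * ballVol x (R - √d / M)) ≤ ptCount X (Metric.closedBall x R) := by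
  classical
  let C : Finset (Fin d → ℕ) := (Fintype.piFinset fun _ : Fin d => Finset.range M).filter
    fun q => ∃ y ∈ gridCell M q, dist y x ≤ R - √d / M
  have hCM : ∀ q ∈ C, ∀ i, q i < M := by
    intro q hq i
    have := (Fintype.mem_piFinset.1 (Finset.mem_filter.1 hq).1) i
    simpa using this
  have h1 : ∑ q ∈ C, ptCount X (gridCell M q) ≤ ptCount X (Metric.closedBall x R) := by
    rw [show ∑ q ∈ C, ptCount X (gridCell M q) = ∑ q ∈ C,
      (Finset.univ.filter fun i => X i ∈ gridCell M q).card from rfl, ← Finset.card_biUnion]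
    · refine Finset.card_le_card fun i hi => ?_
      obtain ⟨q, hq, hi⟩ := Finset.mem_biUnion.1 hi
      have hi' : X i ∈ gridCell M q := by simpa using hi
      obtain ⟨-, y, hy, hyx⟩ := Finset.mem_filter.1 hq
      have h1 := dist_le_of_mem_gridCell hi' hy
      have h2 := dist_triangle (X i) y x
      have : dist (X i) x ≤ R := by linarith
      simpa using this
    · intro q hq q' hq' hqq
      rw [Function.onFun, Finset.disjoint_left]
      intro i hi hi'
      exact Set.disjoint_left.1 (disjoint_gridCell hM (hCM q hq) hqq) (by simpa using hi)
        (by simpa using hi')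
  have h2 : C.card * ((1 - δ) * (n * (1 / (M : ℝ) ^ d))) ≤
      (∑ q ∈ C, (ptCount X (gridCell M q) : ℝ)) := by
    rw [← nsmul_eq_mul]
    exact Finset.card_nsmul_le_sum _ _ _ fun q hq => h.le_cell q (hCM q hq)
  have h3 : ballVol x (R - √d / M) ≤ (C.card : ℝ) * (1 / (M : ℝ) ^ d) := by
    rw [← volume_biUnion_gridCell hM C hCM]
    have hsub : (⋃ q ∈ C, gridCell M q) ⊆ halfCube d :=
      Set.iUnion₂_subset fun q hq => gridCell_subset_halfCube hM (hCM q hq)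
    refine measureReal_mono ?_ ((measure_mono hsub).trans_lt (by simp [volume_halfCube])).ne
    rintro y ⟨hy1, hy2⟩
    have hc := (mem_gridCell_iff hM hy2).2 rfl
    refine Set.mem_iUnion₂.2 ⟨cellIndex M y,
      Finset.mem_filter.2 ⟨?_, y, hc, by simpa using hy1⟩, hc⟩
    rw [Fintype.mem_piFinset]
    intro j
    rw [Finset.mem_range]
    exact cellIndex_lt hM hy2 j
  have h1' : ∑ q ∈ C, (ptCount X (gridCell M q) : ℝ) ≤ (ptCount X (Metric.closedBall x R) : ℝ) := by
    exact_mod_cast h1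
  have hδ' : 0 ≤ 1 - δ := by linarith
  calc (1 - δ) * (n * ballVol x (R - √d / M)) ≤ (1 - δ) * (n * (C.card * (1 / (M : ℝ) ^ d))) := by
        gcongr
    _ = C.card * ((1 - δ) * (n * (1 / (M : ℝ) ^ d))) := by ring
    _ ≤ _ := h2.trans h1'

/-- The `+ 1` is the vertex `i`, which lies in its own ball. -/
theorem ncard_neighborSet_geomGraph {d n : ℕ} (X : Fin n → EuclideanSpace ℝ (Fin d)) {r : ℝ}
    (hr : 0 ≤ r) (i : Fin n) :
    ((geomGraph X r).neighborSet i).ncard + 1 = ptCount X (Metric.closedBall (X i) r) := by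
  classical
  have h : ((geomGraph X r).neighborSet i) =
      ((Finset.univ.filter fun j => X j ∈ Metric.closedBall (X i) r).erase i : Finset (Fin n)) := by
    ext j
    simp only [SimpleGraph.mem_neighborSet, geomGraph, Finset.coe_erase, Finset.coe_filter,
      Finset.mem_univ, true_and, Metric.mem_closedBall, Set.mem_sdiff, Set.mem_singleton_iff,
      Set.mem_ofPred_eq]
    rw [dist_comm, and_comm, ne_comm]
  rw [h, Set.ncard_coe_finset, Finset.card_erase_add_one]
  · rfl
  · simpa using hr

/-- Inclusion–exclusion: two neighbourhoods of size about `α * F0` each, inside a set of size about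
`F1 ≈ F0`, meet in about `(2α - 1) * F0 ≥ 2ε * F0` vertices. The slack between `2ε` and `ε` covers
all approximation errors. -/
theorem lt_card_inter_of_degrees {ε δ α F0 F1 dx dz a b u i S c : ℝ} (hε : 0 < ε) (hε1 : ε ≤ 1 / 2)
    (hδ : δ = ε / 1000) (hα : 1 / 2 + ε ≤ α) (hα1 : α ≤ 1) (hF0 : 0 ≤ F0) (hF1 : 0 ≤ F1)
    (hF : (1 - ε / 1000) * F1 ≤ F0) (hS : S ≤ (1 + δ) * F1) (hx : (1 - δ) * F0 ≤ dx + 1)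
    (hz : (1 - δ) * F0 ≤ dz + 1) (ha : α * dx ≤ a) (hb : α * dz ≤ b) (hui : u + i = a + b)
    (hu : u ≤ S) (hc : c + 3 ≤ ε * F0) : c < i := by
  have e1 : F1 ≤ (1 + ε / 100) * F0 := by
    have h1 : 1 ≤ (1 + ε / 100) * (1 - ε / 1000) := by nlinarith
    have h2 : F1 * 1 ≤ F1 * ((1 + ε / 100) * (1 - ε / 1000)) := by gcongr
    have h3 : (1 + ε / 100) * ((1 - ε / 1000) * F1) ≤ (1 + ε / 100) * F0 := by gcongr
    linarith
  have e2 : (1 + δ) * F1 ≤ (1 + ε / 10) * F0 := by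
    have h1 : (1 + ε / 1000) * F1 ≤ (1 + ε / 1000) * ((1 + ε / 100) * F0) := by gcongr
    have h3 : (1 + ε / 1000) * (1 + ε / 100) ≤ 1 + ε / 10 := by nlinarith
    have h4 := mul_le_mul_of_nonneg_right h3 hF0
    rw [hδ]
    linarith
  have h4 : 1 / 2 + 9 / 10 * ε ≤ α * (1 - δ) := by
    have : (1 / 2 + ε) * (1 - δ) ≤ α * (1 - δ) := by
      apply mul_le_mul_of_nonneg_right hα
      rw [hδ]; linarith
    rw [hδ] at this ⊢
    nlinarith
  have h5 := mul_le_mul_of_nonneg_right h4 hF0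
  have hα0 : 0 ≤ α := by linarith
  have e3 := mul_le_mul_of_nonneg_left hx hα0
  have e4 := mul_le_mul_of_nonneg_left hz hα0
  have hn : 0 ≤ ε * F0 := by positivity
  linarith

/-- Vertices in adjacent cells have many common neighbours. -/
theorem EvenlySpread.exists_common_neighbor {d n N M c : ℕ} (hd : 1 ≤ d) {ε δ r α : ℝ}
    {X : Fin n → EuclideanSpace ℝ (Fin d)} (h : EvenlySpread N M δ r X) (hM : 0 < M)
    (hε : 0 < ε) (hε1 : ε ≤ 1 / 2) (hδ : δ = ε / 1000) (hr : 0 < r) (hr1 : r ≤ 1)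
    (hα : 1 / 2 + ε ≤ α) (hα1 : α ≤ 1) (ht : 6 * (√d / M) ≤ r)
    (hratio : 1 - ε / 1000 ≤ ((r - 3 * (√d / M)) / (r + 3 * (√d / M))) ^ d)
    (hc : (c : ℝ) + 3 ≤ ε * (n * (r / (2 * √d)) ^ d))
    {H : SimpleGraph (Fin n)} (hH : IsAlphaSubgraph α H (geomGraph X r)) (x z : Fin n)
    (hxz : GridNear 1 (cellIndex M (X x)) (cellIndex M (X z))) (U : Finset (Fin n))
    (hU : U.card ≤ c) : ∃ w ∉ U, H.Adj x w ∧ H.Adj w z := by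
  classical
  set t := √d / M with htdef
  have ht0 : 0 ≤ t := by positivity
  have hM' : (0 : ℝ) < M := by exact_mod_cast hM
  have hdist : dist (X x) (X z) ≤ 2 * t := by
    have h1 := dist_le_sqrt_mul (x := X x) (y := X z) (a := ((1 : ℕ) + 1 : ℝ) / M) (by positivity)
      (abs_sub_le_of_gridNear hM (h.mem x) (h.mem z) hxz)
    calc _ ≤ _ := h1
      _ = 2 * t := by rw [htdef]; push_cast; ring
  -- Of the margin `3t`, `2t` bounds the distance between `X x` and `X z`, and `t` is the cell
  -- diameter lost in counting; the same holds for `r + 3t`.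
  set f₀ := ballVol (X x) (r - 3 * t) with hf₀
  have hδ0 : 0 ≤ δ := by rw [hδ]; positivity
  have hδ1 : δ ≤ 1 := by rw [hδ]; linarith
  have hn0 : (0 : ℝ) ≤ n := Nat.cast_nonneg _
  have hf₀1 : (r / (2 * √d)) ^ d ≤ f₀ := by
    have hsd : (1 : ℝ) ≤ √d := by rw [Real.one_le_sqrt]; exact_mod_cast hd
    refine le_trans ?_ (le_ballVol hd (h.mem x) (by linarith : 0 < r - 3 * t) (by linarith))
    rw [show r / (2 * √d) = (r / 2) / √d by rw [div_div]]
    gcongr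
    linarith
  have hS : (ptCount X (Metric.closedBall (X x) (r + 2 * t)) : ℝ) ≤
      (1 + δ) * (n * ballVol (X x) (r + 3 * t)) := by
    have := h.ptCount_closedBall_le hM hδ0 (X x) (r + 2 * t)
    rwa [← htdef, show r + 2 * t + t = r + 3 * t by ring] at this
  have hscale : (1 - ε / 1000) * ballVol (X x) (r + 3 * t) ≤ f₀ := by
    refine le_trans ?_ (ballVol_scale (h.mem x) (by linarith : 0 < r - 3 * t)
      (by linarith : r - 3 * t ≤ r + 3 * t))
    exact mul_le_mul_of_nonneg_right hratio measureReal_nonneg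
  have hdx : (1 - δ) * (n * f₀) ≤ ptCount X (Metric.closedBall (X x) r) := by
    refine le_trans ?_ (h.le_ptCount_closedBall hM hδ1 (X x) r)
    have : f₀ ≤ ballVol (X x) (r - √d / M) := ballVol_mono (by rw [dist_self, ← htdef]; linarith)
    have h2 : 0 ≤ 1 - δ := by linarith
    gcongr
  have hdz : (1 - δ) * (n * f₀) ≤ ptCount X (Metric.closedBall (X z) r) := by
    refine le_trans ?_ (h.le_ptCount_closedBall hM hδ1 (X z) r)
    have : f₀ ≤ ballVol (X z) (r - √d / M) := ballVol_mono (by rw [← htdef]; linarith)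
    have h2 : 0 ≤ 1 - δ := by linarith
    gcongr
  have hcx := ncard_neighborSet_geomGraph X hr.le x
  have hcz := ncard_neighborSet_geomGraph X hr.le z
  rw [← hcx] at hdx
  rw [← hcz] at hdz
  push_cast at hdx hdz
  have hHx := hH.2 x
  have hHz := hH.2 z
  let A : Finset (Fin n) := Finset.univ.filter (H.Adj x)
  let B : Finset (Fin n) := Finset.univ.filter (H.Adj z)
  have hA : (H.neighborSet x).ncard = A.card := by
    rw [← Set.ncard_coe_finset]; congr 1; ext j; simp [A]
  have hB : (H.neighborSet z).ncard = B.card := by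
    rw [← Set.ncard_coe_finset]; congr 1; ext j; simp [B]
  rw [hA] at hHx
  rw [hB] at hHz
  have hAB : (A ∪ B).card ≤ ptCount X (Metric.closedBall (X x) (r + 2 * t)) := by
    refine Finset.card_le_card fun j hj => ?_
    have : dist (X j) (X x) ≤ r + 2 * t := by
      rcases Finset.mem_union.1 hj with hj | hj
      · have h1 := (hH.1 (Finset.mem_filter.1 hj).2).2
        rw [dist_comm]
        linarith
      · have h1 := (hH.1 (Finset.mem_filter.1 hj).2).2
        have h2 := dist_triangle (X j) (X z) (X x)
        have h3 := dist_comm (X j) (X z)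
        have h4 := dist_comm (X z) (X x)
        linarith
    simpa using this
  have hinc : ((A ∪ B).card : ℝ) + (A ∩ B).card = A.card + B.card := by
    exact_mod_cast Finset.card_union_add_card_inter A B
  have hAB' : ((A ∪ B).card : ℝ) ≤ ptCount X (Metric.closedBall (X x) (r + 2 * t)) := by
    exact_mod_cast hAB
  have hlarge : (c : ℝ) < (A ∩ B).card := by
    have hnf : ε * (n * (r / (2 * √d)) ^ d) ≤ ε * (n * f₀) := by gcongr
    have hF0 : 0 ≤ n * f₀ := mul_nonneg hn0 measureReal_nonneg
    have hns : (1 - ε / 1000) * (n * ballVol (X x) (r + 3 * t)) ≤ n * f₀ := by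
      calc _ = n * ((1 - ε / 1000) * ballVol (X x) (r + 3 * t)) := by ring
        _ ≤ _ := by gcongr
    have hF1 : 0 ≤ n * ballVol (X x) (r + 3 * t) := mul_nonneg hn0 measureReal_nonneg
    exact lt_card_inter_of_degrees hε hε1 hδ hα hα1 hF0 hF1 hns hS hdx hdz hHx hHz hinc hAB'
      (hc.trans hnf)
  obtain ⟨w, hw, hwU⟩ : ∃ w ∈ A ∩ B, w ∉ U := by
    by_contra hcon
    push Not at hcon
    have h1 := Finset.card_le_card (show A ∩ B ⊆ U from hcon)
    have h2 : (A ∩ B).card ≤ c := h1.trans hU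
    have h3 : ((A ∩ B).card : ℝ) ≤ c := by exact_mod_cast h2
    linarith
  rw [Finset.mem_inter] at hw
  exact ⟨w, hwU, (Finset.mem_filter.1 hw.1).2, (Finset.mem_filter.1 hw.2).2.symm⟩

end Counts

/-! ### Degrees inside a box. -/

section BoxDegrees

theorem closedBall_subset_icoBox {d : ℕ} {a b : Fin d → ℝ} {r : ℝ} {x : EuclideanSpace ℝ (Fin d)}
    (hx : x ∈ icoBox (fun i => a i + r) (fun i => b i - r)) :
    Metric.closedBall x r ⊆ icoBox a b := by
  intro y hy i
  have h1 := hx i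
  have h2 := abs_le.1 ((abs_sub_le_dist y x i).trans hy)
  simp only [Set.mem_Ico] at h1 ⊢
  constructor <;> linarith [h1.1, h1.2, h2.1, h2.2]

open Classical in
theorem EvenlySpread.card_box {d n N M : ℕ} {δ r : ℝ} {X : Fin n → EuclideanSpace ℝ (Fin d)}
    (h : EvenlySpread N M δ r X) (hN : 0 < N) (b : Fin d → ℕ)
    (P : Fin n → Prop) (hP : ∀ x, P x ↔ cellIndex N (X x) = b) :
    Fintype.card {x // P x} = ptCount X (gridCell N b) := by
  rw [Fintype.card_subtype, ptCount]
  congr 1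
  ext i
  simp [hP, mem_gridCell_iff hN (h.mem i)]

-- Truncation by the cube only shrinks a ball, so this upper bound holds for every vertex, wherever
-- it lies.
open Classical in
theorem EvenlySpread.box_degree_le {d n N M : ℕ} {δ r ε : ℝ}
    {X : Fin n → EuclideanSpace ℝ (Fin d)} (h : EvenlySpread N M δ r X) (hM : 0 < M)
    (hδ : δ = ε / 1000) (hε : 0 < ε) (hr : 0 < r)
    (hup : (1 + ε / 1000) * (r + √d / M) ^ d ≤ (1 + ε / 100) * r ^ d)
    {H : SimpleGraph (Fin n)} (hH : H ≤ geomGraph X r) (P : Fin n → Prop) (v : {x // P x}) :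
    ((Finset.univ.filter fun w => (H.comap (Subtype.val : {x // P x} → Fin n)).Adj v w).card : ℝ) ≤
      (1 + ε / 100) * (n * (unitBallVol d * r ^ d)) := by
  have h1 : (Finset.univ.filter fun w =>
      (H.comap (Subtype.val : {x // P x} → Fin n)).Adj v w).card ≤
      ptCount X (Metric.closedBall (X v) r) := by
    refine Finset.card_le_card_of_injOn Subtype.val ?_ Subtype.val_injective.injOn
    intro w hw
    have hw' : H.Adj v w := by simpa using hw
    have := (hH hw').2
    rw [dist_comm] at this
    simpa using this
  have h2 := h.ptCount_closedBall_le hM (by rw [hδ]; positivity) (X v) r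
  have h3 := ballVol_le (X v) (R := r + √d / M) (by positivity)
  have hv := (unitBallVol_pos d).le
  calc _ ≤ (ptCount X (Metric.closedBall (X v) r) : ℝ) := by exact_mod_cast h1
    _ ≤ (1 + δ) * (n * ballVol (X v) (r + √d / M)) := h2
    _ ≤ (1 + ε / 1000) * (n * ((r + √d / M) ^ d * unitBallVol d)) := by rw [hδ]; gcongr
    _ = (n * unitBallVol d) * ((1 + ε / 1000) * (r + √d / M) ^ d) := by ring
    _ ≤ (n * unitBallVol d) * ((1 + ε / 100) * r ^ d) := by gcongr
    _ = _ := by ring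

-- A vertex at distance at least `r` from the boundary of its box has its whole ball, hence all its
-- `H`-neighbours, in the box. So low degree can occur only in the boundary layer, whose population
-- is the count of the box minus that of the inner box.
open Classical in
theorem EvenlySpread.card_box_low_degree_le {d n N M : ℕ} {δ r ε α : ℝ}
    {X : Fin n → EuclideanSpace ℝ (Fin d)} (h : EvenlySpread N M δ r X) (hN : 0 < N) (hM : 0 < M)
    (hδ : δ = ε / 1000) (hε : 0 < ε) (hε1 : ε ≤ 1 / 2) (hr : 0 < r) (ht : √d / M ≤ r)
    (hα : 0 ≤ α) (hα1 : α ≤ 1)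
    (hlow : (1 - ε / 200) * r ^ d ≤ (1 - ε / 1000) * (r - √d / M) ^ d)
    (hinner : (1 + ε / 1000) * (1 / (N : ℝ)) ^ d - (1 - ε / 1000) * (1 / (N : ℝ) - 2 * r) ^ d ≤
      ε / 100 * ((1 - ε / 1000) * (1 / (N : ℝ)) ^ d))
    (hD : 1 ≤ ε / 200 * (n * (unitBallVol d * r ^ d)))
    {H : SimpleGraph (Fin n)} (hH : IsAlphaSubgraph α H (geomGraph X r)) (b : Fin d → ℕ)
    (hb : ∀ i, b i < N) (P : Fin n → Prop) (hP : ∀ x, P x ↔ cellIndex N (X x) = b) :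
    ((Finset.univ.filter fun v : {x // P x} =>
      ((Finset.univ.filter fun w =>
        (H.comap (Subtype.val : {x // P x} → Fin n)).Adj v w).card : ℝ) <
        (α - ε / 100) * (n * (unitBallVol d * r ^ d))).card : ℝ) ≤
      ε / 100 * Fintype.card {x // P x} := by
  set V := {x // P x}
  set I := icoBox (fun i => (b i : ℝ) / N + r) (fun i => ((b i : ℝ) + 1) / N - r) with hI
  have hn0 : (0 : ℝ) ≤ n := Nat.cast_nonneg _
  have hinn : ∀ v : V, X v ∈ I → (α - ε / 100) * (n * (unitBallVol d * r ^ d)) ≤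
      ((Finset.univ.filter fun w => (H.comap (Subtype.val : V → Fin n)).Adj v w).card : ℝ) := by
    intro v hv
    have hsub : Metric.closedBall (X v) r ⊆ gridCell N b := closedBall_subset_icoBox hv
    have hdeg : (H.neighborSet v).ncard ≤
        (Finset.univ.filter fun w => (H.comap (Subtype.val : V → Fin n)).Adj v w).card := by
      rw [← Set.ncard_coe_finset, ← Set.ncard_image_of_injective _ (Subtype.val_injective (p := P))]
      refine Set.ncard_le_ncard ?_ (Set.toFinite _)
      intro w hw
      have hw1 : H.Adj v w := hw
      have hw2 := (hH.1 hw1).2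
      rw [dist_comm] at hw2
      have hw3 := (mem_gridCell_iff hN (h.mem w)).1 (hsub hw2)
      exact ⟨⟨w, (hP w).2 hw3⟩, by simpa using hw1, rfl⟩
    have h1 := h.le_ptCount_closedBall hM (by rw [hδ]; linarith) (X v) r
    have hball : ballVol (X v) (r - √d / M) = (r - √d / M) ^ d * unitBallVol d := by
      refine ballVol_eq (by linarith) ((Metric.closedBall_subset_closedBall ?_).trans
        (hsub.trans (gridCell_subset_halfCube hN hb)))
      have : 0 ≤ √d / (M : ℝ) := by positivity
      linarith
    rw [hball, ← ncard_neighborSet_geomGraph X hr.le v] at h1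
    push_cast at h1
    have h2 := hH.2 v
    have h3 : (1 - ε / 200) * (n * (unitBallVol d * r ^ d)) ≤
        (1 - δ) * (n * ((r - √d / M) ^ d * unitBallVol d)) := by
      have hv := (unitBallVol_pos d).le
      calc _ = (n * unitBallVol d) * ((1 - ε / 200) * r ^ d) := by ring
        _ ≤ (n * unitBallVol d) * ((1 - ε / 1000) * (r - √d / M) ^ d) := by gcongr
        _ = _ := by rw [hδ]; ring
    have h4 : α * ((1 - ε / 200) * (n * (unitBallVol d * r ^ d)) - 1) ≤
        α * ((geomGraph X r).neighborSet v).ncard := by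
      gcongr; linarith
    have h5 : ((H.neighborSet v).ncard : ℝ) ≤
        ((Finset.univ.filter fun w => (H.comap (Subtype.val : V → Fin n)).Adj v w).card : ℝ) := by
      exact_mod_cast hdeg
    refine le_trans ?_ (h4.trans (h2.trans h5))
    have h6 : α * (ε / 200 * (n * (unitBallVol d * r ^ d)) + 1) ≤
        1 * (ε / 200 * (n * (unitBallVol d * r ^ d)) + 1) := by
      apply mul_le_mul_of_nonneg_right hα1
      linarith
    linarith
  have hcount : (Finset.univ.filter fun v : V =>
      ((Finset.univ.filter fun w => (H.comap (Subtype.val : V → Fin n)).Adj v w).card : ℝ) <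
        (α - ε / 100) * (n * (unitBallVol d * r ^ d))).card + ptCount X I ≤
      ptCount X (gridCell N b) := by
    rw [← Finset.card_map (Function.Embedding.subtype P), ptCount,
      ← Finset.card_union_of_disjoint]
    · refine Finset.card_le_card ?_
      intro x hx
      rw [Finset.mem_filter]
      refine ⟨Finset.mem_univ _, ?_⟩
      rcases Finset.mem_union.1 hx with hx | hx
      · obtain ⟨v, -, rfl⟩ := Finset.mem_map.1 hx
        exact (mem_gridCell_iff hN (h.mem _)).2 ((hP _).1 v.2)
      · exact closedBall_subset_icoBox (Finset.mem_filter.1 hx).2 (Metric.mem_closedBall_self hr.le)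
    · rw [Finset.disjoint_left]
      intro x hx hx'
      obtain ⟨v, hv, rfl⟩ := Finset.mem_map.1 hx
      exact absurd (Finset.mem_filter.1 hv).2 (not_lt.2 (hinn v (Finset.mem_filter.1 hx').2))
  rw [h.card_box hN b P hP]
  have h1 := h.le_inner b hb
  have h2 := h.box_le b hb
  have h3 := h.le_box b hb
  have hcount' : ((Finset.univ.filter fun v : V =>
      ((Finset.univ.filter fun w => (H.comap (Subtype.val : V → Fin n)).Adj v w).card : ℝ) <
        (α - ε / 100) * (n * (unitBallVol d * r ^ d))).card : ℝ) + ptCount X I ≤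
      ptCount X (gridCell N b) := by exact_mod_cast hcount
  rw [← hI] at h1
  rw [← one_div_pow] at h2 h3
  rw [hδ] at h1 h2 h3
  have h4 := mul_le_mul_of_nonneg_left hinner hn0
  have h5 := mul_le_mul_of_nonneg_left h3 (show 0 ≤ ε / 100 by positivity)
  linarith

end BoxDegrees

/-! ### Slots inside a box as path nodes. -/

section BoxSlots

open Classical in
/-- Slots for the vertices satisfying `P`. -/
theorem exists_nodes_of_induced {ε κ : ℝ} (hε : 0 < ε) (hε1 : ε ≤ 1) (hκ : 0 < κ) :
    ∃ K N₀ : ℕ, 0 < K ∧ ∀ {V : Type} [Fintype V] [DecidableEq V] (H : SimpleGraph V)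
      (P : V → Prop) (D η : ℝ) (Q Z : ℕ), N₀ ≤ Fintype.card {x // P x} → K * (Q + 2 + Z) ≤ Fintype.card {x // P x} →
      κ * Fintype.card {x // P x} ≤ D → 1 / 2 ≤ η → η + ε ≤ 1 →
      (∀ v, ((Finset.univ.filter fun w =>
        (H.comap (Subtype.val : {x // P x} → V)).Adj v w).card : ℝ) ≤ (1 + ε / 100) * D) →
      ((Finset.univ.filter fun v : {x // P x} => ((Finset.univ.filter fun w =>
        (H.comap (Subtype.val : {x // P x} → V)).Adj v w).card : ℝ) <
          (η + ε - ε / 100) * D).card : ℝ) ≤ ε / 100 * Fintype.card {x // P x} →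
      ∃ k cap : ℕ, 0 < k ∧ k ≤ K ∧ Z ≤ cap ∧
        2 * η / (1 + η) * Fintype.card {x // P x} ≤ 2 * (k * cap : ℝ) ∧
        ∀ W : Finset V, W.card ≤ Q → ∃ n : ℕ → PathNode H Q, ∀ j < k,
          (n j).inn ∉ W ∧ (n j).out ∉ W ∧ (n j).inn ∈ (n j).dom ∧ (n j).out ∈ (n j).dom ∧
          (n j).base = 4 ∧ (n j).cap = cap ∧ (∀ x ∈ (n j).dom, P x) ∧
          ∀ j' < k, j ≠ j' → Disjoint (n j).dom (n j').dom := by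
  obtain ⟨K, N₀, hK, hslot⟩ := exists_slots hε hε1 hκ
  refine ⟨K, N₀, hK, ?_⟩
  intro V _ _ H P D η Q Z hN₀ hcard hD hη hηε hup hlow
  obtain ⟨k, h, γ, g, A, B, hkK, hA, hB, hAA, hBB, hAB, hrob, hγ, hg, hKγ, hcov⟩ :=
    hslot (H.comap (Subtype.val : {x // P x} → V)) D η hN₀ hD hη hηε hup hlow
  -- Large boxes force a large `γ`: `Q + 2 ≤ γ` is what the nodes need, and `Z ≤ γ ≤ g ≤ h - 3g`
  -- gives the capacity.
  have hγQ : Q + 2 + Z ≤ γ := Nat.le_of_mul_le_mul_left (hcard.trans hKγ) hK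
  have hcpos : 0 < Fintype.card {x // P x} := lt_of_lt_of_le (by positivity) hcard
  have hk : 0 < k := by
    rcases Nat.eq_zero_or_pos k with hk | hk
    · exfalso
      subst hk
      have h1 : 0 < 2 * η / (1 + η) * (Fintype.card {x // P x} : ℝ) := by
        have : (0 : ℝ) < Fintype.card {x // P x} := by exact_mod_cast hcpos
        have : 0 < η := by linarith
        positivity
      simp at hcov
      linarith
    · exact hk
  refine ⟨k, h - 3 * g, hk, hkK, by omega, ?_, ?_⟩
  · refine hcov.trans_eq ?_
    rw [Nat.cast_sub (by omega)]
    push_cast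
    ring
  · intro W hW
    let e := Function.Embedding.subtype P
    have hnode : ∀ j : Fin k, ∃ n : PathNode H Q, n.inn ∈ (A j).map e ∧ n.out ∈ (B j).map e ∧
        n.inn ∉ W ∧ n.out ∉ W ∧ n.base = 4 ∧ n.cap = h - 3 * g ∧
        n.dom = (A j).map e ∪ (B j).map e := fun j =>
      (hrob j).map_subtype.exists_pathNode ((Finset.disjoint_map e).2 (hAB j j))
        (by rw [Finset.card_map, hA]) (by rw [Finset.card_map, hB]) hγ hg (by omega) W hW
    choose f hf using hnode
    refine ⟨fun j => if hj : j < k then f ⟨j, hj⟩ else f ⟨0, hk⟩, ?_⟩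
    intro j hj
    simp only [hj, dif_pos]
    obtain ⟨h1, h2, h3, h4, h5, h6, h7⟩ := hf ⟨j, hj⟩
    refine ⟨h3, h4, ?_, ?_, h5, h6, ?_, ?_⟩
    · rw [h7]; exact Finset.mem_union_left _ h1
    · rw [h7]; exact Finset.mem_union_right _ h2
    · intro x hx
      rw [h7, ← Finset.map_union] at hx
      obtain ⟨y, -, rfl⟩ := Finset.mem_map.1 hx
      exact y.2
    · intro j' hj' hjj
      simp only [hj', dif_pos]
      have hne : (⟨j, hj⟩ : Fin k) ≠ ⟨j', hj'⟩ := fun h => hjj (congrArg Fin.val h)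
      rw [h7, (hf ⟨j', hj'⟩).2.2.2.2.2.2, ← Finset.map_union, ← Finset.map_union,
        Finset.disjoint_map, Finset.disjoint_union_left, Finset.disjoint_union_right,
        Finset.disjoint_union_right]
      exact ⟨⟨hAA _ _ hne, hAB _ _⟩, (hAB _ _).symm, hBB _ _ hne⟩

end BoxSlots

/-! ### Links between nearby boxes. -/

section Connection

/-- Short paths between vertices in nearby boxes. -/
theorem EvenlySpread.exists_connecting_path {d n N W c Q : ℕ} {δ r : ℝ}
    {X : Fin n → EuclideanSpace ℝ (Fin d)} (h : EvenlySpread N (N * W) δ r X) (hN : 0 < N)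
    (hW : 0 < W) (hrN : r * N ≤ 1) {H : SimpleGraph (Fin n)} (hH : H ≤ geomGraph X r)
    (hcommon : ∀ x z, GridNear 1 (cellIndex (N * W) (X x)) (cellIndex (N * W) (X z)) →
      ∀ U : Finset (Fin n), U.card ≤ c → ∃ w ∉ U, H.Adj x w ∧ H.Adj w z)
    (hpop : ∀ b : Fin d → ℕ, (∀ i, b i < N * W) → c < ptCount X (gridCell (N * W) b))
    (hc : Q + 6 * W + 1 ≤ c) (x y : Fin n) (hxy : x ≠ y)
    (hb : GridNear 2 (cellIndex N (X x)) (cellIndex N (X y))) (U : Finset (Fin n))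
    (hU : U.card ≤ Q) :
    ∃ p : List (Fin n), p.length = 6 * W - 1 ∧ (x :: (p ++ [y])).IsChain H.Adj ∧ p.Nodup ∧
      ∀ z ∈ p, z ∉ U ∧ GridNear 5 (cellIndex N (X x)) (cellIndex N (X z)) := by
  classical
  have hM : 0 < N * W := Nat.mul_pos hN hW
  have hN' : (0 : ℝ) < N := by exact_mod_cast hN
  have hW' : (0 : ℝ) < W := by exact_mod_cast hW
  have hpop' : ∀ b : Fin d → ℕ, (∀ i, b i < N * W) → ∀ U : Finset (Fin n), U.card ≤ c →
      ∃ z ∉ U, cellIndex (N * W) (X z) = b := by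
    intro b hb U hU
    by_contra hcon
    push Not at hcon
    have h1 : ptCount X (gridCell (N * W) b) ≤ U.card := by
      refine Finset.card_le_card fun z hz => ?_
      by_contra hzU
      exact hcon z hzU ((mem_gridCell_iff hM (h.mem z)).1 (Finset.mem_filter.1 hz).2)
    have := hpop b hb
    omega
  -- Coordinates of points in boxes at grid distance 2 differ by at most `3/N`, that is, by `3W`
  -- cells.
  have hnear : GridNear (3 * W - 1 + 1) (cellIndex (N * W) (X x)) (cellIndex (N * W) (X y)) := by
    refine gridNear_of_abs_sub_le (fun i => ?_) (h.mem x) (h.mem y)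
    have h1 := abs_sub_le_of_gridNear hN (h.mem x) (h.mem y) hb i
    rw [Nat.sub_add_cancel (by omega)]
    calc |X x i - X y i| * ((N * W : ℕ) : ℝ) ≤ ((2 : ℕ) + 1 : ℝ) / N * ((N * W : ℕ) : ℝ) := by
          gcongr
      _ = ((3 * W : ℕ) : ℝ) := by push_cast; field_simp; norm_num
  obtain ⟨p, hlen, hch, hnd, hp⟩ := exists_path_through_cells (fun x => cellIndex (N * W) (X x))
    (fun x i => cellIndex_lt hM (h.mem x) i) hcommon hpop' (3 * W - 1) x y U hxy hnear (by omega)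
  refine ⟨p, by omega, hch, hnd, fun w hw => ?_⟩
  obtain ⟨hwU, -, -, z, hz, hzw⟩ := hp w hw
  refine ⟨hwU, ?_⟩
  -- A detour of `3W` cells stays within 4 boxes; a final edge of length at most `r ≤ 1/N` adds one
  -- more.
  have hxz : GridNear 4 (cellIndex N (X x)) (cellIndex N (X z)) := by
    refine gridNear_of_abs_sub_le (fun i => ?_) (h.mem x) (h.mem z)
    have h1 := abs_sub_le_of_gridNear hM (h.mem x) (h.mem z) hz i
    rw [Nat.sub_add_cancel (by omega)] at h1
    have hW1 : (1 : ℝ) ≤ W := by exact_mod_cast hW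
    calc |X x i - X z i| * N ≤ (((3 * W : ℕ) : ℝ) + 1) / ((N * W : ℕ) : ℝ) * N := by gcongr
      _ = (3 * W + 1) / W := by push_cast; field_simp
      _ ≤ ((4 : ℕ) : ℝ) := by rw [div_le_iff₀ hW']; push_cast; linarith
  rcases hzw with rfl | hzw
  · exact hxz.mono (by omega)
  · have hzw' : GridNear 1 (cellIndex N (X z)) (cellIndex N (X w)) := by
      refine gridNear_of_abs_sub_le (fun i => ?_) (h.mem z) (h.mem w)
      have h1 := (abs_sub_le_dist (X z) (X w) i).trans (hH hzw).2
      calc |X z i - X w i| * N ≤ r * N := by gcongr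
        _ ≤ ((1 : ℕ) : ℝ) := by simpa using hrN
    exact hxz.trans hzw'

end Connection

/-! ### Cycles for evenly spread points. -/

section Deterministic

theorem one_sub_mul_le_pow {x : ℝ} (hx : x ≤ 1) (d : ℕ) : 1 - d * x ≤ (1 - x) ^ d := by
  have := one_add_mul_le_pow (a := -x) (by linarith) d
  rw [← sub_eq_add_neg] at this
  linarith

/-- With `t` the cell diameter: by Bernoulli's inequality, a relative error of order `ε/d` in the
radius costs one of order `ε` in the volume. -/
theorem radius_estimates {d : ℕ} (hd : 1 ≤ d) {ε r t : ℝ} (hε : 0 < ε) (hε1 : ε ≤ 1 / 2)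
    (hr : 0 < r) (ht0 : 0 ≤ t) (ht : t ≤ ε / (10000 * d) * r) :
    6 * t ≤ r ∧ 1 - ε / 1000 ≤ ((r - 3 * t) / (r + 3 * t)) ^ d ∧
      (1 + ε / 1000) * (r + t) ^ d ≤ (1 + ε / 100) * r ^ d ∧
      (1 - ε / 200) * r ^ d ≤ (1 - ε / 1000) * (r - t) ^ d := by
  have hd' : (1 : ℝ) ≤ d := by exact_mod_cast hd
  obtain ⟨s, rfl⟩ : ∃ s, t = s * r := ⟨t / r, by field_simp⟩
  have hs0 : 0 ≤ s := nonneg_of_mul_nonneg_left ht0 hr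
  have hs : s ≤ ε / (10000 * d) := le_of_mul_le_mul_right ht hr
  have hds : d * s ≤ ε / 10000 := by
    calc d * s ≤ d * (ε / (10000 * d)) := by gcongr
      _ = ε / 10000 := by field_simp
  have hs1 : s ≤ ε / 10000 := by nlinarith
  have hrd : 0 < r ^ d := by positivity
  refine ⟨by nlinarith, ?_, ?_, ?_⟩
  · have h1 : 1 - 6 * s ≤ (r - 3 * (s * r)) / (r + 3 * (s * r)) := by
      rw [le_div_iff₀ (by positivity)]
      nlinarith [mul_nonneg (mul_nonneg hs0 hs0) hr.le]
    calc 1 - ε / 1000 ≤ 1 - d * (6 * s) := by linarith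
      _ ≤ (1 - 6 * s) ^ d := one_sub_mul_le_pow (by linarith) d
      _ ≤ _ := pow_le_pow_left₀ (by linarith) h1 d
  · have h1 : 1 - ε / 10000 ≤ (1 - s) ^ d :=
      le_trans (by linarith) (one_sub_mul_le_pow (by linarith) d)
    have h2 : (1 + s) ^ d * (1 - s) ^ d ≤ 1 := by
      rw [← mul_pow]
      exact pow_le_one₀ (mul_nonneg (by linarith) (by linarith)) (by nlinarith)
    have h3 : 0 ≤ (1 + s) ^ d := by positivity
    have h4 : (1 + s) ^ d * (1 - ε / 10000) ≤ 1 := le_trans (by gcongr) h2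
    have h5 : (1 + ε / 1000) * (1 + s) ^ d ≤ 1 + ε / 100 := by
      have h6 : (1 + ε / 1000) ≤ (1 + ε / 100) * (1 - ε / 10000) := by nlinarith
      calc (1 + ε / 1000) * (1 + s) ^ d ≤ ((1 + ε / 100) * (1 - ε / 10000)) * (1 + s) ^ d := by
            gcongr
        _ = (1 + ε / 100) * ((1 + s) ^ d * (1 - ε / 10000)) := by ring
        _ ≤ (1 + ε / 100) * 1 := by gcongr
        _ = _ := by ring
    calc (1 + ε / 1000) * (r + s * r) ^ d = ((1 + ε / 1000) * (1 + s) ^ d) * r ^ d := by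
          rw [show r + s * r = (1 + s) * r by ring, mul_pow]; ring
      _ ≤ _ := by gcongr
  · have h1 : 1 - ε / 10000 ≤ (1 - s) ^ d :=
      le_trans (by linarith) (one_sub_mul_le_pow (by linarith) d)
    calc (1 - ε / 200) * r ^ d ≤ ((1 - ε / 1000) * (1 - ε / 10000)) * r ^ d := by
          gcongr; nlinarith
      _ ≤ ((1 - ε / 1000) * (1 - s) ^ d) * r ^ d := by
          have : 0 ≤ 1 - ε / 1000 := by linarith
          gcongr
      _ = _ := by rw [show r - s * r = (1 - s) * r by ring, mul_pow]; ring

/-- The layer of width `r` along the faces of a box has relative volume at most `2d * (r * N)`,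
which is at most `ε/1000`. -/
theorem inner_box_estimate {d N : ℕ} {ε r : ℝ} (hε : 0 < ε) (hε1 : ε ≤ 1 / 2) (hN : 0 < N)
    (h : 2000 * d * (r * N) ≤ ε) (h1 : 2 * (r * N) ≤ 1) :
    (1 + ε / 1000) * (1 / (N : ℝ)) ^ d - (1 - ε / 1000) * (1 / (N : ℝ) - 2 * r) ^ d ≤
      ε / 100 * ((1 - ε / 1000) * (1 / (N : ℝ)) ^ d) := by
  have hN' : (0 : ℝ) < N := by exact_mod_cast hN
  have e : 1 / (N : ℝ) - 2 * r = (1 - 2 * (r * N)) * (1 / N) := by field_simp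
  have h2 : 1 - ε / 1000 ≤ (1 - 2 * (r * N)) ^ d :=
    le_trans (by linarith) (one_sub_mul_le_pow h1 d)
  rw [e, mul_pow]
  have hp : 0 ≤ (1 / (N : ℝ)) ^ d := by positivity
  have h3 : (1 - ε / 1000) * (1 - ε / 1000) ≤ (1 - ε / 1000) * (1 - 2 * (r * N)) ^ d := by
    apply mul_le_mul_of_nonneg_left h2; linarith
  have h4 : (1 + ε / 1000) - (1 - ε / 1000) * (1 - 2 * (r * N)) ^ d ≤
      ε / 100 * (1 - ε / 1000) := by nlinarith
  have h5 := mul_le_mul_of_nonneg_right h4 hp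
  linarith

set_option maxHeartbeats 1000000 in
/-- In an `α`-subgraph of the geometric graph of an evenly spread point set there are cycles of
all lengths through every vertex. -/
theorem exists_cycles_of_evenlySpread {d : ℕ} (hd : 1 ≤ d) {ε : ℝ} (hε : 0 < ε)
    (hε1 : ε ≤ 1 / 2) :
    ∃ (B W Lmin : ℕ) (T : ℝ), 4 ≤ B ∧ B ≤ W ∧ 0 < Lmin ∧ ∀ {n N : ℕ} {r η : ℝ}
      {X : Fin n → EuclideanSpace ℝ (Fin d)}, 0 < r → 0 < N → B * (r * N) ≤ 1 →
      1 ≤ 2 * B * (r * N) → T ≤ n * r ^ d → EvenlySpread N (N * W) (ε / 1000) r X →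
      1 / 2 ≤ η → ε ≤ 1 - η → ∀ L : ℕ, Lmin ≤ L → (L : ℝ) ≤ 2 * η * n / (1 + η) →
      ∀ (v : Fin n) (H : SimpleGraph (Fin n)), IsAlphaSubgraph (η + ε) H (geomGraph X r) →
        HasCycleThrough H L v := by
  classical
  have hd' : (1 : ℝ) ≤ d := by exact_mod_cast hd
  set vd := unitBallVol d with hvd
  have hvd0 : 0 < vd := unitBallVol_pos d
  -- Boxes of side at least `B * r` have a negligible boundary layer.
  obtain ⟨B, hB⟩ := exists_nat_ge (2000 * d / ε)
  have hB' : 2000 * d ≤ ε * B := by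
    rw [div_le_iff₀ hε] at hB; linarith
  have hB4 : (4 : ℝ) ≤ B := by nlinarith
  have hB0 : (0 : ℝ) < B := by linarith
  -- The box side is at most `2Br`, so a box has at most `2n(2Br)^d` points, and `κ` times this is
  -- `D = n * vd * r^d`.
  set κ := vd / (2 * (2 * B) ^ d) with hκ
  have hκ0 : 0 < κ := by positivity
  obtain ⟨K, N₀, hK, hnodes⟩ := exists_nodes_of_induced hε (by linarith) hκ0
  -- Since `r * N ≥ 1/(2B)`, this makes the cell diameter at most `εr/(10000d)`.
  obtain ⟨W, hW⟩ := exists_nat_ge (20000 * B * (d * d) / ε + B)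
  have hWB : (B : ℝ) ≤ W :=
    le_trans (by linarith [show 0 ≤ 20000 * B * (d * d : ℝ) / ε by positivity]) hW
  have hW0 : (0 : ℝ) < W := by linarith
  have hWpos : 0 < W := by exact_mod_cast hW0
  have hW' : 20000 * B * (d * d) ≤ ε * W := by
    have : 20000 * B * (d * d) / ε ≤ W := by linarith
    rw [div_le_iff₀ hε] at this; linarith
  set m := 6 * W - 1 with hm
  set Q := (4 * 5 + 5) ^ d * (K + 1) * (m + 2) with hQ
  set c := Q + 6 * W + 1 with hc
  set Z := (m + 4) * K + m + 2 with hZ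
  -- The four summands ensure, in this order, enough common neighbours, enough points per cell, a
  -- large `D`, and enough points per box.
  set T : ℝ := (c + 3) * (2 * √d) ^ d / ε + 2 * (c + 1) * (W / B : ℝ) ^ d + 200 / (ε * vd) +
    2 * (N₀ + K * (Q + 2 + Z) + 2 : ℕ) with hT
  refine ⟨B, W, Z, T, by exact_mod_cast hB4, by exact_mod_cast hWB, by omega, ?_⟩
  intro n N r η X hr hN hBN hBN' hTn hX hη hηε L hL hL' v H hH
  have hN' : (0 : ℝ) < N := by exact_mod_cast hN
  have hM : 0 < N * W := Nat.mul_pos hN hWpos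
  have hn0 : (0 : ℝ) ≤ n := Nat.cast_nonneg _
  have hrN0 : 0 < r * N := by positivity
  have hrN : r * N ≤ 1 / 4 := by
    have := mul_le_mul_of_nonneg_right hB4 hrN0.le
    linarith
  have hN1 : (1 : ℝ) ≤ N := by exact_mod_cast hN
  have hr1 : r ≤ 1 := by
    have := mul_le_mul_of_nonneg_left hN1 hr.le
    linarith
  have hsd : √(d : ℝ) ≤ d := by
    rw [Real.sqrt_le_left (by linarith)]; nlinarith
  have ht : √d / ((N * W : ℕ) : ℝ) ≤ ε / (10000 * d) * r := by
    push_cast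
    rw [div_le_iff₀ (by positivity)]
    have h1 : (d : ℝ) ≤ ε / (10000 * d) * W * (1 / (2 * B)) := by
      rw [mul_one_div, le_div_iff₀ (by positivity), div_mul_eq_mul_div, le_div_iff₀ (by positivity)]
      linarith
    have h2 : 1 / (2 * B) ≤ r * N := by
      rw [div_le_iff₀ (by positivity)]; linarith
    calc √(d : ℝ) ≤ d := hsd
      _ ≤ ε / (10000 * d) * W * (1 / (2 * B)) := h1
      _ ≤ ε / (10000 * d) * W * (r * N) := by gcongr
      _ = _ := by ring
  obtain ⟨hr6, hratio, hup, hlow⟩ := radius_estimates hd hε hε1 hr (by positivity) ht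
  have hinner : (1 + ε / 1000) * (1 / (N : ℝ)) ^ d - (1 - ε / 1000) * (1 / (N : ℝ) - 2 * r) ^ d ≤
      ε / 100 * ((1 - ε / 1000) * (1 / (N : ℝ)) ^ d) := by
    refine inner_box_estimate hε hε1 hN ?_ (by linarith)
    have h1 := mul_le_mul_of_nonneg_right hB' hrN0.le
    have h2 := mul_le_mul_of_nonneg_left hBN hε.le
    linarith
  have hT1 : (c + 3) * (2 * √d) ^ d / ε ≤ n * r ^ d := le_trans (by
    have h1 : 0 ≤ 2 * ((c : ℝ) + 1) * (W / B : ℝ) ^ d := by positivity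
    have h2 : 0 ≤ 200 / (ε * vd) := by positivity
    rw [hT]; linarith [show (0 : ℝ) ≤ (N₀ + K * (Q + 2 + Z) + 2 : ℕ) from Nat.cast_nonneg _]) hTn
  have hT2 : 2 * (c + 1) * (W / B : ℝ) ^ d ≤ n * r ^ d := le_trans (by
    have h1 : 0 ≤ ((c : ℝ) + 3) * (2 * √d) ^ d / ε := by positivity
    have h2 : 0 ≤ 200 / (ε * vd) := by positivity
    rw [hT]; linarith [show (0 : ℝ) ≤ (N₀ + K * (Q + 2 + Z) + 2 : ℕ) from Nat.cast_nonneg _]) hTn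
  have hT3 : 200 / (ε * vd) ≤ n * r ^ d := le_trans (by
    have h1 : 0 ≤ ((c : ℝ) + 3) * (2 * √d) ^ d / ε := by positivity
    have h2 : 0 ≤ 2 * ((c : ℝ) + 1) * (W / B : ℝ) ^ d := by positivity
    rw [hT]; linarith [show (0 : ℝ) ≤ (N₀ + K * (Q + 2 + Z) + 2 : ℕ) from Nat.cast_nonneg _]) hTn
  have hT4 : 2 * ((N₀ + K * (Q + 2 + Z) + 2 : ℕ) : ℝ) ≤ n * r ^ d := le_trans (by
    have h1 : 0 ≤ ((c : ℝ) + 3) * (2 * √d) ^ d / ε := by positivity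
    have h2 : 0 ≤ 2 * ((c : ℝ) + 1) * (W / B : ℝ) ^ d := by positivity
    have h3 : 0 ≤ 200 / (ε * vd) := by positivity
    rw [hT]; linarith) hTn
  clear_value T Z Q c m
  have hcommon : ∀ x z, GridNear 1 (cellIndex (N * W) (X x)) (cellIndex (N * W) (X z)) →
      ∀ U : Finset (Fin n), U.card ≤ c → ∃ w ∉ U, H.Adj x w ∧ H.Adj w z := by
    refine hX.exists_common_neighbor hd hM hε hε1 rfl hr hr1 (by linarith) (by linarith) hr6
      hratio ?_ hH
    have hsd0 : 0 < √(d : ℝ) := Real.sqrt_pos.2 (by linarith)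
    rw [div_le_iff₀ hε] at hT1
    rw [div_pow]
    calc (c : ℝ) + 3 = (c + 3) * (2 * √d) ^ d / (2 * √d) ^ d := by field_simp
      _ ≤ (n * r ^ d * ε) / (2 * √d) ^ d := by gcongr
      _ = _ := by ring
  have hpop : ∀ b : Fin d → ℕ, (∀ i, b i < N * W) → c < ptCount X (gridCell (N * W) b) := by
    intro b hb
    have h1 := hX.le_cell b hb
    have h2 : (c : ℝ) + 1 ≤ (1 - ε / 1000) * (n * (1 / ((N * W : ℕ) : ℝ) ^ d)) := by
      have h3 : r * (B / W) ≤ 1 / ((N * W : ℕ) : ℝ) := by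
        push_cast
        rw [le_div_iff₀ (by positivity)]
        calc r * (B / W) * (N * W) = B * (r * N) := by field_simp
          _ ≤ 1 := hBN
      have h4 : 2 * ((c : ℝ) + 1) ≤ n * (1 / ((N * W : ℕ) : ℝ)) ^ d := by
        calc 2 * ((c : ℝ) + 1) = 2 * (c + 1) * (W / B : ℝ) ^ d * (B / W : ℝ) ^ d := by
              rw [mul_assoc, ← mul_pow, div_mul_div_cancel₀ (by positivity),
                div_self (by positivity)]
              simp
          _ ≤ n * r ^ d * (B / W : ℝ) ^ d := by gcongr
          _ = n * (r * (B / W)) ^ d := by rw [mul_pow]; ring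
          _ ≤ _ := by gcongr
      rw [one_div_pow] at h4
      have h5 := mul_le_mul_of_nonneg_left h4 (show 0 ≤ 1 - ε / 1000 by linarith)
      have h6 := mul_le_mul_of_nonneg_right hε1 (show (0 : ℝ) ≤ c + 1 by positivity)
      linarith
    have h3 : (c : ℝ) + 1 ≤ ptCount X (gridCell (N * W) b) := h2.trans h1
    exact_mod_cast h3
  have hconn := hX.exists_connecting_path hN hWpos (by linarith) hH.1 hcommon hpop hc.ge
  rw [← hm] at hconn
  obtain ⟨P, hP⟩ : ∃ P : (Fin d → ℕ) → Fin n → Prop, ∀ b x, P b x ↔ cellIndex N (X x) = b :=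
    ⟨_, fun _ _ => Iff.rfl⟩
  have hbox : ∀ b : Fin d → ℕ, (∀ i, b i < N) →
      N₀ + K * (Q + 2 + Z) + 2 ≤ Fintype.card {x // P b x} := by
    intro b hb
    have h1 := hX.le_box b hb
    rw [← hX.card_box hN b (P b) (hP b)] at h1
    have h3 : r ≤ 1 / N := by
      rw [le_div_iff₀ hN']; linarith
    have h4 : n * r ^ d ≤ n * (1 / N : ℝ) ^ d := by gcongr
    rw [one_div_pow] at h4
    have h5 : ((N₀ + K * (Q + 2 + Z) + 2 : ℕ) : ℝ) ≤
        Fintype.card {x // P b x} := by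
      have h6 := mul_le_mul_of_nonneg_left (hT4.trans h4) (show 0 ≤ 1 - ε / 1000 by linarith)
      have h7 := mul_le_mul_of_nonneg_right hε1
        (show (0 : ℝ) ≤ ((N₀ + K * (Q + 2 + Z) + 2 : ℕ) : ℝ) from Nat.cast_nonneg _)
      linarith
    exact_mod_cast h5
  have hboxD : ∀ b : Fin d → ℕ, (∀ i, b i < N) →
      κ * Fintype.card {x // P b x} ≤ n * (vd * r ^ d) := by
    intro b hb
    have h1 := hX.box_le b hb
    rw [← hX.card_box hN b (P b) (hP b), ← one_div_pow] at h1
    have h3 : 1 / (N : ℝ) ≤ 2 * B * r := by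
      rw [div_le_iff₀ hN']; linarith
    have h4 : (Fintype.card {x // P b x} : ℝ) ≤ 2 * (n * (2 * B * r) ^ d) := by
      refine h1.trans ?_
      gcongr
      linarith
    calc κ * Fintype.card {x // P b x} ≤ κ * (2 * (n * (2 * B * r) ^ d)) := by
          gcongr
      _ = n * (vd * r ^ d) := by rw [hκ, mul_pow (2 * (B : ℝ)) r]; field_simp
  have hD : 1 ≤ ε / 200 * (n * (vd * r ^ d)) := by
    rw [div_le_iff₀ (by positivity)] at hT3
    linarith
  have hsl : ∀ b : Fin d → ℕ, ∃ k cap : ℕ, (∀ i, b i < N) → (0 < k ∧ k ≤ K ∧ Z ≤ cap ∧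
        2 * η / (1 + η) * Fintype.card {x // P b x} ≤ 2 * (k * cap : ℝ) ∧
        ∀ W : Finset (Fin n), W.card ≤ Q → ∃ n : ℕ → PathNode H Q, ∀ j < k,
          (n j).inn ∉ W ∧ (n j).out ∉ W ∧ (n j).inn ∈ (n j).dom ∧ (n j).out ∈ (n j).dom ∧
          (n j).base = 4 ∧ (n j).cap = cap ∧ (∀ x ∈ (n j).dom, P b x) ∧
          ∀ j' < k, j ≠ j' → Disjoint (n j).dom (n j').dom) := by
    intro b
    by_cases hb : ∀ i, b i < N
    · have h0 := hbox b hb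
      obtain ⟨k, cap, hk⟩ := hnodes H (P b) (n * (vd * r ^ d)) η Q Z
        (by omega) (by omega) (hboxD b hb) hη (by linarith)
        (fun v => hX.box_degree_le hM rfl hε hr hup hH.1 _ v)
        (hX.card_box_low_degree_le hN hM rfl hε hε1 hr (by linarith) (by linarith) (by linarith)
          hlow hinner hD hH b hb (P b) (hP b))
      exact ⟨k, cap, fun _ => hk⟩
    · exact ⟨0, 0, fun h => absurd h hb⟩
  choose k cap hkc using hsl
  -- A common neighbour of `v` with itself is just a neighbour, to be used for the parity.
  obtain ⟨x', -, hvx', -⟩ := hcommon v v (GridNear.refl _) ∅ (by simp)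
  have hnear : GridNear 1 (cellIndex N (X v)) (cellIndex N (X x')) := by
    refine gridNear_of_abs_sub_le (fun i => ?_) (hX.mem v) (hX.mem x')
    have h1 := (abs_sub_le_dist (X v) (X x') i).trans (hH.1 hvx').2
    calc |X v i - X x' i| * N ≤ r * N := by gcongr
      _ ≤ ((1 : ℕ) : ℝ) := by push_cast; linarith
  have hQ3 : 3 ≤ Q := by
    have h1 : 1 ≤ (4 * 5 + 5) ^ d * (K + 1) := Nat.one_le_iff_ne_zero.2 (by positivity)
    calc 3 ≤ 1 * (m + 2) := by omega
      _ ≤ Q := by rw [hQ]; exact Nat.mul_le_mul_right _ h1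
  refine hasCycleThrough_of_grid (fun x => cellIndex N (X x)) hN
    (fun x i => cellIndex_lt hN (hX.mem x) i) (m := m) (R := 5) (K := K) (by omega) hQ.ge hconn v x'
    hvx' hnear k cap (fun b hb => (hkc b hb).1) (fun b hb => (hkc b hb).2.1)
    (fun b hb => hZ.ge.trans (hkc b hb).2.2.1)
    (fun b hb W hW => by
      simpa only [hP] using (hkc b hb).2.2.2.2 W (hW.trans hQ3)) ?_ L (hZ.ge.trans hL) ?_
  · intro b hb
    by_contra hcon
    push Not at hcon
    have h1 : Fintype.card {x // P b x} ≤ 1 := by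
      rw [Fintype.card_le_one_iff]
      rintro ⟨a, ha⟩ ⟨a', ha'⟩
      exact Subtype.ext ((hcon a ((hP _ _).1 ha)).trans (hcon a' ((hP _ _).1 ha')).symm)
    have h2 := hbox b hb
    omega
  -- The boxes partition the vertices and each offers the share `2η/(1+η)` of its own, so the
  -- capacities add up to the same share of `n`.
  · have hsum : (n : ℝ) = ∑ b ∈ Fintype.piFinset fun _ : Fin d => Finset.range N,
        (Fintype.card {x // P b x} : ℝ) := by
      have h1 := Finset.card_eq_sum_card_fiberwise (s := (Finset.univ : Finset (Fin n)))
        (t := Fintype.piFinset fun _ : Fin d => Finset.range N) (f := fun x => cellIndex N (X x))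
        (fun x _ => by
          rw [Finset.mem_coe, Fintype.mem_piFinset]
          exact fun i => Finset.mem_range.2 (cellIndex_lt hN (hX.mem x) i))
      simp_rw [Fintype.card_subtype, hP]
      rw [Finset.card_univ, Fintype.card_fin] at h1
      exact_mod_cast h1
    have h2 : (L : ℝ) ≤ 2 * ∑ b ∈ Fintype.piFinset fun _ : Fin d => Finset.range N,
        ((k b : ℝ) * cap b) := by
      calc (L : ℝ) ≤ 2 * η * n / (1 + η) := hL'
        _ = ∑ b ∈ Fintype.piFinset fun _ : Fin d => Finset.range N,
            2 * η / (1 + η) * (Fintype.card {x // P b x} : ℝ) := by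
          rw [← Finset.mul_sum, ← hsum]; ring
        _ ≤ _ := by
          rw [Finset.mul_sum]
          refine Finset.sum_le_sum fun b hb => ?_
          rw [Fintype.mem_piFinset] at hb
          exact (hkc b fun i => Finset.mem_range.1 (hb i)).2.2.2.1
    exact_mod_cast h2

end Deterministic

/-! ### Concentration of point counts. -/

section Concentration

/-- Moment generating function of a centred Bernoulli variable, from `e^l ≤ 1 + l + l²` for `|l| ≤
1` and `1 + x ≤ e^x`. -/
theorem integral_exp_count_le {Ω : Type*} [MeasurableSpace Ω] (μ : Measure Ω)
    [IsProbabilityMeasure μ] {S : Set Ω} (hS : MeasurableSet S) {l : ℝ} (hl : |l| ≤ 1) :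
    Integrable (fun x => Real.exp (l * (S.indicator 1 x - μ.real S))) μ ∧
      ∫ x, Real.exp (l * (S.indicator 1 x - μ.real S)) ∂μ ≤ Real.exp (μ.real S * l ^ 2) := by
  set p := μ.real S with hp
  have hp0 : 0 ≤ p := measureReal_nonneg
  have hfun : (fun x => Real.exp (l * (S.indicator 1 x - p))) =
      fun x => Real.exp (-(l * p)) * (1 + S.indicator (fun _ => Real.exp l - 1) x) := by
    funext x
    by_cases hx : x ∈ S
    · simp only [hx, Set.indicator_of_mem, Pi.one_apply, add_sub_cancel]
      rw [← Real.exp_add]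
      congr 1; ring
    · simp only [hx, not_false_eq_true, Set.indicator_of_notMem, add_zero, mul_one]
      congr 1; ring
  have hint : Integrable (S.indicator fun _ => Real.exp l - 1) μ :=
    (integrable_const _).indicator hS
  rw [hfun]
  refine ⟨((integrable_const 1).add hint).const_mul _, ?_⟩
  rw [integral_const_mul, integral_add (integrable_const 1) hint, integral_indicator_const _ hS]
  simp only [integral_const, probReal_univ, smul_eq_mul, mul_one]
  have h1 : Real.exp l - 1 ≤ l + l ^ 2 := by
    have := (abs_le.1 (Real.abs_exp_sub_one_sub_id_le hl)).2
    linarith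
  calc Real.exp (-(l * p)) * (1 + p * (Real.exp l - 1))
      ≤ Real.exp (-(l * p)) * Real.exp (p * (l + l ^ 2)) := by
        gcongr
        have h2 := Real.add_one_le_exp (p * (l + l ^ 2))
        have h3 := mul_le_mul_of_nonneg_left h1 hp0
        linarith
    _ = Real.exp (p * l ^ 2) := by rw [← Real.exp_add]; congr 1; ring

/-- Chernoff's method: Markov's inequality for the exponential, whose integral factorises by
independence. The sign of `l` selects the tail. -/
theorem measure_exp_count_ge_le {Ω : Type*} [MeasurableSpace Ω] (μ : Measure Ω)
    [IsProbabilityMeasure μ] (n : ℕ) {S : Set Ω} (hS : MeasurableSet S) {l : ℝ} (hl : |l| ≤ 1)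
    (a : ℝ) :
    (Measure.pi fun _ : Fin n => μ).real
      {X | a ≤ l * ((∑ i, S.indicator (1 : Ω → ℝ) (X i)) - n * μ.real S)} ≤
      Real.exp (n * μ.real S * l ^ 2 - a) := by
  obtain ⟨h1, h2⟩ := integral_exp_count_le μ hS hl
  set f : Ω → ℝ := fun x => Real.exp (l * (S.indicator 1 x - μ.real S)) with hf
  have h3 : ∫ X : Fin n → Ω, ∏ i, f (X i) ∂(Measure.pi fun _ : Fin n => μ) ≤
      Real.exp (n * μ.real S * l ^ 2) := by
    rw [integral_fintype_prod_eq_pow, Fintype.card_fin]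
    calc _ ≤ Real.exp (μ.real S * l ^ 2) ^ n :=
          pow_le_pow_left₀ (integral_nonneg fun x => (Real.exp_pos _).le) h2 n
      _ = _ := by rw [← Real.exp_nat_mul]; congr 1; ring
  have h4 := mul_meas_ge_le_integral_of_nonneg
    (Filter.Eventually.of_forall fun X : Fin n → Ω =>
      Finset.prod_nonneg fun i _ => (Real.exp_pos _).le)
    (Integrable.fintype_prod (μ := fun _ : Fin n => μ) (f := fun _ => f) fun _ => h1) (Real.exp a)
  have hset : {X : Fin n → Ω | Real.exp a ≤ ∏ i, f (X i)} =
      {X | a ≤ l * ((∑ i, S.indicator (1 : Ω → ℝ) (X i)) - n * μ.real S)} := by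
    ext X
    simp only [Set.mem_ofPred_eq, hf]
    rw [← Real.exp_sum, Real.exp_le_exp, ← Finset.mul_sum, Finset.sum_sub_distrib]
    simp
  rw [hset] at h4
  rw [Real.exp_sub, le_div_iff₀ (Real.exp_pos _), mul_comm]
  exact h4.trans h3

theorem measure_count_deviation_le {Ω : Type*} [MeasurableSpace Ω] (μ : Measure Ω)
    [IsProbabilityMeasure μ] (n : ℕ) {S : Set Ω} (hS : MeasurableSet S) {δ : ℝ} (hδ : 0 < δ)
    (hδ1 : δ ≤ 1) :
    (Measure.pi fun _ : Fin n => μ).real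
      {X | ¬ ((1 - δ) * (n * μ.real S) ≤ ∑ i, S.indicator (1 : Ω → ℝ) (X i) ∧
        ∑ i, S.indicator (1 : Ω → ℝ) (X i) ≤ (1 + δ) * (n * μ.real S))} ≤
      2 * Real.exp (-(δ ^ 2 / 4 * (n * μ.real S))) := by
  -- With `l = ±δ/2` the exponent is `(δ²/4 - δ²/2) * n * μ(S)`.
  have h1 := measure_exp_count_ge_le μ n hS (l := δ / 2) (by rw [abs_le]; constructor <;> linarith)
    (δ ^ 2 / 2 * (n * μ.real S))
  have h2 := measure_exp_count_ge_le μ n hS (l := -(δ / 2))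
    (by rw [abs_le]; constructor <;> linarith) (δ ^ 2 / 2 * (n * μ.real S))
  have e1 : n * μ.real S * (δ / 2) ^ 2 - δ ^ 2 / 2 * (n * μ.real S) =
      -(δ ^ 2 / 4 * (n * μ.real S)) := by ring
  have e2 : n * μ.real S * (-(δ / 2)) ^ 2 - δ ^ 2 / 2 * (n * μ.real S) =
      -(δ ^ 2 / 4 * (n * μ.real S)) := by ring
  rw [e1] at h1
  rw [e2] at h2
  rw [two_mul]
  refine le_trans (le_trans (measureReal_mono ?_) (measureReal_union_le _ _)) (add_le_add h1 h2)
  intro X hX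
  simp only [Set.mem_ofPred_eq, not_and_or, not_le] at hX
  rcases hX with hX | hX
  · right
    have := mul_le_mul_of_nonneg_left hX.le (show 0 ≤ δ / 2 by positivity)
    simp only [Set.mem_ofPred_eq]
    linarith
  · left
    have := mul_le_mul_of_nonneg_left hX.le (show 0 ≤ δ / 2 by positivity)
    simp only [Set.mem_ofPred_eq]
    linarith

theorem ptCount_eq_sum_indicator {d n : ℕ} (X : Fin n → EuclideanSpace ℝ (Fin d))
    (S : Set (EuclideanSpace ℝ (Fin d))) :
    (ptCount X S : ℝ) = ∑ i, S.indicator (1 : EuclideanSpace ℝ (Fin d) → ℝ) (X i) := by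
  classical
  simp [ptCount, Set.indicator_apply, Finset.sum_boole]

theorem halfCube_subset_unitCube (d : ℕ) : halfCube d ⊆ unitCube d := fun _ hx i =>
  ⟨(hx i).1, (hx i).2.le⟩

theorem uniformCube_real_eq {d : ℕ} {S : Set (EuclideanSpace ℝ (Fin d))} (hS : MeasurableSet S)
    (h : S ⊆ halfCube d) : (uniformCube d).real S = volume.real S := by
  rw [Measure.real, uniformCube, Measure.restrict_apply hS,
    Set.inter_eq_left.2 (h.trans (halfCube_subset_unitCube d)), Measure.real]

/-- Half-open cells partition only the half-open cube; the missing faces have measure zero. -/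
theorem ae_mem_halfCube (d n : ℕ) : ∀ᵐ X ∂(pointsLaw d n), ∀ i, X i ∈ halfCube d := by
  rw [ae_all_iff]
  intro i
  have h1 : ∀ᵐ x ∂(uniformCube d), x ∈ halfCube d := by
    have hm : MeasurableSet (halfCube d) := measurableSet_icoBox _ _
    change halfCube d ∈ ae (uniformCube d)
    rw [mem_ae_iff_prob_eq_one hm, uniformCube, Measure.restrict_apply hm,
      Set.inter_eq_left.2 (halfCube_subset_unitCube d), volume_halfCube]
  exact (measurePreserving_eval (fun _ : Fin n => uniformCube d) i).quasiMeasurePreserving.ae h1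

theorem volume_innerBox {d N : ℕ} {r : ℝ} (b : Fin d → ℕ) (h : 0 ≤ 1 / (N : ℝ) - 2 * r) :
    volume.real (icoBox (fun i => (b i : ℝ) / N + r) (fun i => ((b i : ℝ) + 1) / N - r)) =
      (1 / (N : ℝ) - 2 * r) ^ d := by
  have e : ∀ i : Fin d, ((b i : ℝ) + 1) / N - r - ((b i : ℝ) / N + r) = 1 / N - 2 * r :=
    fun i => by ring
  rw [Measure.real, volume_icoBox]
  simp_rw [e]
  rw [Finset.prod_const, ENNReal.toReal_pow, ENNReal.toReal_ofReal h]
  simp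

/-- Random points are evenly spread with high probability. -/
theorem measure_not_evenlySpread_le {d n N M : ℕ} {δ r : ℝ} (hδ : 0 < δ) (hδ1 : δ ≤ 1)
    (hN : 0 < N) (hNM : N ≤ M) (hr : 0 ≤ r) (h : 1 / (M : ℝ) ≤ 1 / N - 2 * r) :
    (pointsLaw d n).real {X | ¬ EvenlySpread N M δ r X} ≤
      6 * (M : ℝ) ^ d * Real.exp (-(δ ^ 2 / 4 * (n * (1 / (M : ℝ) ^ d)))) := by
  have hM : 0 < M := hN.trans_le hNM
  have hN' : (0 : ℝ) < N := by exact_mod_cast hN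
  have hM' : (0 : ℝ) < M := by exact_mod_cast hM
  set t := 2 * Real.exp (-(δ ^ 2 / 4 * (n * (1 / (M : ℝ) ^ d)))) with ht
  have hinn0 : 0 ≤ 1 / (N : ℝ) - 2 * r := le_trans (by positivity) h
  let bad : Set (EuclideanSpace ℝ (Fin d)) → Set (Fin n → EuclideanSpace ℝ (Fin d)) := fun S =>
    {X | ¬ ((1 - δ) * (n * volume.real S) ≤ ptCount X S ∧
      (ptCount X S : ℝ) ≤ (1 + δ) * (n * volume.real S))}
  -- Cells, boxes and inner boxes all have at least the volume of a cell, so one tail bound `t`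
  -- serves the three families, each of at most `M^d` sets.
  have hbad : ∀ S : Set (EuclideanSpace ℝ (Fin d)), MeasurableSet S → S ⊆ halfCube d →
      1 / (M : ℝ) ^ d ≤ volume.real S → (pointsLaw d n).real (bad S) ≤ t := by
    intro S hS hSH hSv
    have h1 := measure_count_deviation_le (uniformCube d) n hS hδ hδ1
    rw [uniformCube_real_eq hS hSH] at h1
    simp only [bad, ptCount_eq_sum_indicator]
    refine h1.trans ?_
    rw [ht]
    gcongr
  let I (b : Fin d → ℕ) : Set (EuclideanSpace ℝ (Fin d)) :=
    icoBox (fun i => (b i : ℝ) / N + r) (fun i => ((b i : ℝ) + 1) / N - r)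
  let PM := Fintype.piFinset fun _ : Fin d => Finset.range M
  let PN := Fintype.piFinset fun _ : Fin d => Finset.range N
  have hPM : ∀ q : Fin d → ℕ, q ∈ PM ↔ ∀ i, q i < M := fun q => by simp [PM]
  have hPN : ∀ q : Fin d → ℕ, q ∈ PN ↔ ∀ i, q i < N := fun q => by simp [PN]
  have hbox : 1 / (M : ℝ) ^ d ≤ 1 / (N : ℝ) ^ d := by gcongr
  have hinn : 1 / (M : ℝ) ^ d ≤ (1 / (N : ℝ) - 2 * r) ^ d := by
    rw [← one_div_pow]; gcongr
  have hIsub : ∀ b : Fin d → ℕ, I b ⊆ gridCell N b := by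
    intro b x hx i
    have h1 := hx i
    simp only [Set.mem_Ico] at h1 ⊢
    constructor <;> linarith [h1.1, h1.2]
  have hsub : {X | ¬ EvenlySpread N M δ r X} ⊆ {X | ¬ ∀ i, X i ∈ halfCube d} ∪
      ((⋃ q ∈ PM, bad (gridCell M q)) ∪
        ((⋃ b ∈ PN, bad (gridCell N b)) ∪ ⋃ b ∈ PN, bad (I b))) := by
    intro X hX
    by_contra hcon
    simp only [Set.mem_union, Set.mem_iUnion, not_or, not_exists, Set.mem_ofPred_eq, not_not,
      bad] at hcon
    obtain ⟨h1, h2, h3, h4⟩ := hcon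
    refine hX ⟨h1, ?_, ?_, ?_, ?_, ?_⟩
    · intro q hq
      have := (h2 q ((hPM q).2 hq)).1
      rwa [volume_gridCell] at this
    · intro q hq
      have := (h2 q ((hPM q).2 hq)).2
      rwa [volume_gridCell] at this
    · intro q hq
      have := (h3 q ((hPN q).2 hq)).1
      rwa [volume_gridCell] at this
    · intro q hq
      have := (h3 q ((hPN q).2 hq)).2
      rwa [volume_gridCell] at this
    · intro q hq
      have := (h4 q ((hPN q).2 hq)).1
      rwa [volume_innerBox q hinn0] at this
  have hzero : (pointsLaw d n).real {X | ¬ ∀ i, X i ∈ halfCube d} = 0 := by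
    rw [Measure.real, ae_iff.1 (ae_mem_halfCube d n)]; simp
  have hunion : ∀ (C : Finset (Fin d → ℕ)) (F : (Fin d → ℕ) → Set (EuclideanSpace ℝ (Fin d))),
      C.card ≤ M ^ d → (∀ q ∈ C, (pointsLaw d n).real (bad (F q)) ≤ t) →
      (pointsLaw d n).real (⋃ q ∈ C, bad (F q)) ≤ (M : ℝ) ^ d * t := by
    intro C F hC hF
    refine (measureReal_biUnion_finset_le _ _).trans ((Finset.sum_le_card_nsmul _ _ _ hF).trans ?_)
    rw [nsmul_eq_mul]
    have : 0 ≤ t := by positivity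
    gcongr
    exact_mod_cast hC
  have hPMc : PM.card ≤ M ^ d := by simp [PM]
  have hPNc : PN.card ≤ M ^ d := by
    simp only [PN, Fintype.card_piFinset_const, Finset.card_range]
    exact Nat.pow_le_pow_left hNM d
  have u1 := hunion PM (gridCell M) hPMc fun q hq => hbad _ (measurableSet_icoBox _ _)
    (gridCell_subset_halfCube hM ((hPM q).1 hq)) (by rw [volume_gridCell])
  have u2 := hunion PN (gridCell N) hPNc fun q hq => hbad _ (measurableSet_icoBox _ _)
    (gridCell_subset_halfCube hN ((hPN q).1 hq)) (by rw [volume_gridCell]; exact hbox)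
  have u3 := hunion PN I hPNc fun q hq => hbad _ (measurableSet_icoBox _ _)
    ((hIsub q).trans (gridCell_subset_halfCube hN ((hPN q).1 hq)))
    (by rw [volume_innerBox q hinn0]; exact hinn)
  have v1 := measureReal_mono (μ := pointsLaw d n) hsub
  have v2 := measureReal_union_le (μ := pointsLaw d n) {X | ¬ ∀ i, X i ∈ halfCube d}
    ((⋃ q ∈ PM, bad (gridCell M q)) ∪ ((⋃ b ∈ PN, bad (gridCell N b)) ∪ ⋃ b ∈ PN, bad (I b)))
  have v3 := measureReal_union_le (μ := pointsLaw d n) (⋃ q ∈ PM, bad (gridCell M q))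
    ((⋃ b ∈ PN, bad (gridCell N b)) ∪ ⋃ b ∈ PN, bad (I b))
  have v4 := measureReal_union_le (μ := pointsLaw d n) (⋃ b ∈ PN, bad (gridCell N b))
    (⋃ b ∈ PN, bad (I b))
  have e : 6 * (M : ℝ) ^ d * Real.exp (-(δ ^ 2 / 4 * (n * (1 / (M : ℝ) ^ d)))) =
      3 * ((M : ℝ) ^ d * t) := by rw [ht]; ring
  rw [e]
  linarith

end Concentration

/-! ### The failure probability and the theorem. -/

/-- The expected count of a cell is at least `(8/δ²) * log n`, so the exponential factor is at most
`n⁻²`; as this expectation is at least 1, there are at most `n` cells for the union bound. -/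
theorem measure_not_evenlySpread_le_inv {d n N B W : ℕ} (hd : 1 ≤ d) {δ r : ℝ} (hδ : 0 < δ)
    (hδ1 : δ ≤ 1) (hB : 4 ≤ B) (hBW : B ≤ W) (hr : 0 < r) (hN : 0 < N) (hBN : B * (r * N) ≤ 1)
    (hlog : 1 ≤ Real.log n)
    (hn : (W / B * (8 / δ ^ 2)) ^ d * Real.log n ≤ n * r ^ d) :
    (pointsLaw d n).real {X | ¬ EvenlySpread N (N * W) δ r X} ≤ 6 / n := by
  have hN' : (0 : ℝ) < N := by exact_mod_cast hN
  have hB4 : (4 : ℝ) ≤ B := by exact_mod_cast hB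
  have hW4 : (4 : ℝ) ≤ W := by exact_mod_cast hB.trans hBW
  have hWpos : 0 < W := by omega
  have hW0 : (0 : ℝ) < W := by linarith
  have hB0 : (0 : ℝ) < B := by linarith
  have hn0 : (0 : ℝ) < n := by
    rcases Nat.eq_zero_or_pos n with h | h
    · subst h; norm_num at hlog
    · exact_mod_cast h
  have hrN0 : 0 < r * N := by positivity
  have hrN : r * N ≤ 1 / 4 := by
    have := mul_le_mul_of_nonneg_right hB4 hrN0.le
    linarith
  have hM0 : (0 : ℝ) < ((N * W : ℕ) : ℝ) := by push_cast; positivity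
  have hinner : 1 / ((N * W : ℕ) : ℝ) ≤ 1 / N - 2 * r := by
    have e : 1 / (N : ℝ) - 2 * r = (1 - 2 * (r * N)) / N := by field_simp
    rw [e]
    push_cast
    rw [div_le_div_iff₀ (by positivity) hN']
    have h1 : 1 / 2 * W ≤ (1 - 2 * (r * N)) * W := by gcongr; linarith
    have h2 : (1 : ℝ) ≤ (1 - 2 * (r * N)) * W := by linarith
    calc 1 * (N : ℝ) ≤ ((1 - 2 * (r * N)) * W) * N := by gcongr
      _ = _ := by ring
  refine (measure_not_evenlySpread_le hδ hδ1 hN (Nat.le_mul_of_pos_right N hWpos) hr.le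
    hinner).trans ?_
  set a := 8 / δ ^ 2 with ha
  have ha1 : 1 ≤ a := by
    rw [ha, le_div_iff₀ (by positivity)]
    have : δ ^ 2 ≤ 1 := pow_le_one₀ hδ.le hδ1
    linarith
  have had : a ≤ a ^ d := le_self_pow₀ ha1 (by omega)
  have hcell : a * Real.log n ≤ n * (1 / ((N * W : ℕ) : ℝ) ^ d) := by
    have h3 : r * (B / W) ≤ 1 / ((N * W : ℕ) : ℝ) := by
      push_cast
      rw [le_div_iff₀ (by positivity)]
      calc r * (B / W) * (N * W) = B * (r * N) := by field_simp
        _ ≤ 1 := hBN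
    calc a * Real.log n ≤ a ^ d * Real.log n := by gcongr
      _ = ((W / B * a) ^ d * Real.log n) * (B / W : ℝ) ^ d := by
        rw [mul_right_comm, ← mul_pow]
        congr 2
        field_simp
      _ ≤ n * r ^ d * (B / W : ℝ) ^ d := by gcongr
      _ = n * (r * (B / W)) ^ d := by rw [mul_pow]; ring
      _ ≤ n * (1 / ((N * W : ℕ) : ℝ)) ^ d := by gcongr
      _ = _ := by rw [one_div_pow]
  have hMn : ((N * W : ℕ) : ℝ) ^ d ≤ n := by
    have h1 : 1 ≤ n * (1 / ((N * W : ℕ) : ℝ) ^ d) :=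
      le_trans (one_le_mul_of_one_le_of_one_le ha1 hlog) hcell
    rwa [mul_one_div, le_div_iff₀ (by positivity), one_mul] at h1
  have hexp : Real.exp (-(δ ^ 2 / 4 * (n * (1 / ((N * W : ℕ) : ℝ) ^ d)))) ≤ 1 / (n : ℝ) ^ 2 := by
    have h1 : 2 * Real.log n ≤ δ ^ 2 / 4 * (n * (1 / ((N * W : ℕ) : ℝ) ^ d)) := by
      calc 2 * Real.log n = δ ^ 2 / 4 * (a * Real.log n) := by rw [ha]; field_simp; norm_num
        _ ≤ _ := by gcongr
    calc _ ≤ Real.exp (-(2 * Real.log n)) := Real.exp_le_exp.2 (by linarith)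
      _ = 1 / (n : ℝ) ^ 2 := by
        rw [Real.exp_neg, one_div, two_mul, Real.exp_add, Real.exp_log hn0, sq]
  calc _ ≤ 6 * (n : ℝ) * (1 / (n : ℝ) ^ 2) := by gcongr
    _ = 6 / n := by field_simp

theorem theorem4p1 (d : ℕ) (hd : 1 ≤ d) (ε : ℝ) (hε : 0 < ε) :
    ∃ c₃ C₃ : ℝ, 0 < c₃ ∧ 0 < C₃ ∧
      ∀ η : ℝ, 1 / 2 ≤ η → η < 1 → ε ≤ 1 - η →
        ∀ r : ℕ → ℝ,
          (∀ᶠ n : ℕ in Filter.atTop,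
            C₃ * (Real.log (n : ℝ) / (n : ℝ)) ^ (1 / (d : ℝ)) ≤ r n ∧ r n ≤ c₃) →
          Filter.Tendsto
            (fun n : ℕ => pointsLaw d n
              {X | ∀ L : ℕ, c₃⁻¹ ≤ (L : ℝ) → (L : ℝ) ≤ 2 * η * (n : ℝ) / (1 + η) →
                ∀ v : Fin n, ∀ H : SimpleGraph (Fin n),
                  IsAlphaSubgraph (η + ε) H (geomGraph X (r n)) → HasCycleThrough H L v})
            Filter.atTop (nhds 1) := by
  -- For `ε > 1/2` no `η ≥ 1/2` satisfies `ε ≤ 1 - η`.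
  by_cases hε1 : ε ≤ 1 / 2
  swap
  · exact ⟨1, 1, one_pos, one_pos, fun η h1 _ h2 => absurd (by linarith) hε1⟩
  obtain ⟨B, W, Lmin, T, hB, hBW, hLmin, hcyc⟩ := exists_cycles_of_evenlySpread hd hε hε1
  have hB4 : (4 : ℝ) ≤ B := by exact_mod_cast hB
  have hB0 : (0 : ℝ) < B := by linarith
  have hBW' : (B : ℝ) ≤ W := by exact_mod_cast hBW
  have hW0 : (0 : ℝ) < W := by linarith
  have hLmin' : (0 : ℝ) < Lmin := by exact_mod_cast hLmin
  set δ := ε / 1000 with hδ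
  have hδ0 : 0 < δ := by positivity
  have hδ1 : δ ≤ 1 := by rw [hδ]; linarith
  set C : ℝ := W / B * (8 / δ ^ 2) with hC
  have hC1 : 1 ≤ C := by
    rw [hC]
    refine one_le_mul_of_one_le_of_one_le ((one_le_div hB0).2 hBW') ?_
    rw [le_div_iff₀ (by positivity)]
    have : δ ^ 2 ≤ 1 := pow_le_one₀ hδ0.le hδ1
    linarith
  -- The first bound on `c₃` makes room for at least one box of side `B * r`; the second turns `c₃⁻¹
  -- ≤ L` into `Lmin ≤ L`.
  refine ⟨min (1 / (2 * B)) (1 / Lmin), C, lt_min (by positivity) (by positivity), by linarith, ?_⟩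
  intro η hη _ hηε r hr
  set c₃ : ℝ := min (1 / (2 * B)) (1 / Lmin) with hc₃
  have hc₃0 : 0 < c₃ := lt_min (by positivity) (by positivity)
  have hloglim : Filter.Tendsto (fun n : ℕ => Real.log n) Filter.atTop Filter.atTop :=
    Real.tendsto_log_atTop.comp tendsto_natCast_atTop_atTop
  have hev : ∀ᶠ n : ℕ in Filter.atTop, 1 - ENNReal.ofReal (6 / n) ≤ pointsLaw d n
      {X | ∀ L : ℕ, c₃⁻¹ ≤ (L : ℝ) → (L : ℝ) ≤ 2 * η * (n : ℝ) / (1 + η) →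
        ∀ v : Fin n, ∀ H : SimpleGraph (Fin n),
          IsAlphaSubgraph (η + ε) H (geomGraph X (r n)) → HasCycleThrough H L v} := by
    filter_upwards [hr, hloglim.eventually_ge_atTop (max 1 T)] with n hrn hlogn
    have hlog1 : 1 ≤ Real.log n := (le_max_left _ _).trans hlogn
    have hlogT : T ≤ Real.log n := (le_max_right _ _).trans hlogn
    have hn0 : (0 : ℝ) < n := by
      rcases Nat.eq_zero_or_pos n with h | h
      · subst h; norm_num at hlog1
      · exact_mod_cast h
    set x := Real.log n / n with hx
    have hx0 : 0 < x := by positivity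
    have hr0 : 0 < r n := lt_of_lt_of_le (by positivity) hrn.1
    have hrd : C ^ d * Real.log n ≤ n * r n ^ d := by
      have h1 : (C * x ^ (1 / (d : ℝ))) ^ d ≤ r n ^ d :=
        pow_le_pow_left₀ (by positivity) hrn.1 d
      rw [mul_pow, one_div, Real.rpow_inv_natCast_pow hx0.le (by omega)] at h1
      calc C ^ d * Real.log n = n * (C ^ d * x) := by rw [hx]; field_simp
        _ ≤ _ := by gcongr
    have hTn : T ≤ n * r n ^ d := by
      refine hlogT.trans (le_trans ?_ hrd)
      exact le_mul_of_one_le_left (by linarith) (one_le_pow₀ hC1)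
    have hBr : B * r n ≤ 1 / 2 := by
      have h1 : r n ≤ 1 / (2 * B) := hrn.2.trans (min_le_left _ _)
      rw [le_div_iff₀ (by positivity)] at h1
      linarith
    have hBr0 : 0 < B * r n := by positivity
    -- The floor of a number at least 1 is more than half of it, hence `1/2 ≤ B * r * N ≤ 1`.
    set N := ⌊1 / (B * r n)⌋₊ with hN
    have h2 : 2 ≤ 1 / (B * r n) := by
      rw [le_div_iff₀ hBr0]; linarith
    have hNpos : 0 < N := by
      rw [hN, Nat.floor_pos]; linarith
    have hNle : B * (r n * N) ≤ 1 := by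
      have h3 : (N : ℝ) ≤ 1 / (B * r n) := Nat.floor_le (by positivity)
      rw [le_div_iff₀ hBr0] at h3
      linarith
    have hNge : 1 ≤ 2 * B * (r n * N) := by
      have h3 : 1 / (B * r n) < N + 1 := Nat.lt_floor_add_one _
      rw [div_lt_iff₀ hBr0] at h3
      linarith
    have hbad := measure_not_evenlySpread_le_inv hd hδ0 hδ1 hB hBW hr0 hNpos hNle hlog1 hrd
    have hbad' : pointsLaw d n {X | ¬ EvenlySpread N (N * W) δ (r n) X} ≤
        ENNReal.ofReal (6 / n) :=
      (ENNReal.le_ofReal_iff_toReal_le (measure_ne_top _ _) (by positivity)).2 hbad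
    -- Covering the whole space by the good event and the failure of even spread bounds the measure
    -- from below without measurability of either.
    rw [tsub_le_iff_right]
    calc (1 : ENNReal) = pointsLaw d n Set.univ := measure_univ.symm
      _ ≤ _ := measure_mono (t := _ ∪ {X | ¬ EvenlySpread N (N * W) δ (r n) X}) ?_
      _ ≤ _ := measure_union_le _ _
      _ ≤ _ := by gcongr
    intro X _
    by_cases hX : EvenlySpread N (N * W) δ (r n) X
    · left
      intro L hL hL' v H hH
      refine hcyc hr0 hNpos hNle hNge hTn hX hη hηε L ?_ hL' v H hH
      have h5 : (Lmin : ℝ) ≤ c₃⁻¹ := by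
        rw [le_inv_comm₀ hLmin' hc₃0, ← one_div]
        exact min_le_right _ _
      exact_mod_cast h5.trans hL
    · exact Or.inr hX
  refine tendsto_of_tendsto_of_tendsto_of_le_of_le' ?_ tendsto_const_nhds hev
    (Filter.Eventually.of_forall fun n => prob_le_one)
  have h6 : Filter.Tendsto (fun n : ℕ => (6 : ℝ) / n) Filter.atTop (nhds 0) :=
    tendsto_const_div_atTop_nhds_zero_nat 6
  have h7 := ENNReal.tendsto_ofReal h6
  rw [ENNReal.ofReal_zero] at h7
  have h8 := ENNReal.Tendsto.sub (tendsto_const_nhds (x := (1 : ENNReal))) h7 (Or.inl (by simp))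
  simpa using h8
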